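/- **Setting.** Fix $\alpha>2$, $\gamma>0$ and $0<\theta<\min(\gamma,2)$. For $n\ge 1$ let $\Lambda_n=\{1,\dots,n-1\}$ and $\mathcal X_n=\{0,1\}^{\Lambda_n}$. Let $s_\alpha(x)=|x|^{-1-\alpha}\mathbf 1_{\{x\neq0\}}$, $p_\gamma(x)=|x|^{-1-\gamma}\mathbf 1_{\{x>0\}}$, $a_\gamma(x)=\tfrac12(p_\gamma(x)-p_\gamma(-x))$ for $x\in\mathbb Z$, and $m=\sum_{y\in\mathbb Z}y\,p_\gamma(y)$. Write $\eta^{x,y}$ for $\eta$ with the values at $x,y$ exchanged and $\eta^x$ for $\eta$ with the value at $x$ flipped. Let $(\eta(t))_{t\ge0}$ be the Markov process on $\mathcal X_n$ with càdlàg paths and generator $L_n=n^2L_s+n^\theta L_a$, where $$L_sf(\eta)=\sum_{x,y\in\Lambda_n}s_\alpha(x-y)[f(\eta^{x,y})-f(\eta)]+\tfrac12\sum_{x\in\Lambda_n,\,y\notin\Lambda_n}s_\alpha(x-y)[f(\eta^x)-f(\eta)],$$ $$\begin{aligned}L_af(\eta)&=\sum_{x,y\in\Lambda_n}p_\gamma(y-x)\eta_x(1-\eta_y)[f(\eta^{x,y})-f(\eta)]+\tfrac12\sum_{x\in\Lambda_n,\,y\le0}p_\gamma(x-y)(1-\eta_x)[f(\eta^x)-f(\eta)]\\&\quad+\tfrac12\sum_{x\in\Lambda_n,\,y\ge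 n}p_\gamma(y-x)\eta_x[f(\eta^x)-f(\eta)],\end{aligned}$$ started from the product measure $\nu_{1/2}$ with density $1/2$ on $\mathcal X_n$; let $\mathbb E$ denote the corresponding expectation. Put $\bar\eta_x=\eta_x-\tfrac12$. Let $\mathcal S$ be the set of $H\in C^\infty([0,1])$ with $H^{(i)}(0)=H^{(i)}(1)=0$ for all $i\ge0$. For $H\in\mathcal S$ let $$A^{n,4}_s(H)=-\frac{n^\theta}{\sqrt n}\sum_{x,y\in\Lambda_n}a_\gamma(y-x)\big[H(\tfrac yn)-H(\tfrac xn)\big]\bar\eta_x(s)\bar\eta_y(s).$$ For $\varepsilon\in(0,\tfrac12]$ put $\ell=\lfloor\varepsilon n\rfloor$ and, for $n$ so large that $\ell\ge1$, $$\bar\eta^{\ell}_x=\begin{cases}\frac1\ell\sum_{y=0}^{\ell-1}\bar\eta_{x+y},&x=1,\dots,n-\ell-1,\\[2pt]\frac1\ell\sum_{y=0}^{\ell-1}\bar\eta_{x-y},&x=n-\ell,\dots,n-1.\end{cases}$$ **Proposition 3.1 (second order Boltzmann–Gibbs principle).** 1. If $\theta<3/2$, then for every $T>0$ and every $H\in\mathcal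 S$, $$\lim_{n\to\infty}\mathbb E\Big[\sup_{0\le t\le T}\Big(\int_0^tA^{n,4}_s(H)\,ds\Big)^2\Big]=0.$$ 2. If $\theta=3/2$, then there is a constant $C>0$, depending only on $\alpha$ and $\gamma$, such that for every $T>0$, every $H\in\mathcal S$ and every $\varepsilon\in(0,\tfrac12]$, $$\limsup_{n\to\infty}\mathbb E\Big[\sup_{0\le t\le T}\Big(\int_0^t\Big\{A^{n,4}_s(H)+m\sum_{x\in\Lambda_n}\Big(\big(\bar\eta^{\ell}_x(s)\big)^2-\frac1{4\ell}\Big)H'(\tfrac xn)\Big\}ds\Big)^2\Big]\le C\,T\,\varepsilon\,\|H'\|^2_{L^2([0,1])}.$$ -/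

import Mathlib

open Filter Topology MeasureTheory

noncomputable section

namespace LongJumpExclusion

/-! ### Continuous-time Markov chains on a finite state space -/

/-- The rate matrix of an operator `L` on functions on a finite set: `Q e e' = (L 1_{e'})(e)`. -/
def rateMatrix {E : Type*} [Fintype E] [DecidableEq E] (L : (E → ℝ) → E → ℝ) : Matrix E E ℝ :=
  Matrix.of fun e e' => L (Pi.single e' 1) e

/-- `X = (X t)_{t ≥ 0}`, defined on a probability space with probability measure `P`, is a
right-continuous process with left limits with values in the finite (discrete) set `E`, and it is
the Markov process with generator `L` started from the distribution `μ` (given by its weights):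
its finite-dimensional distributions are
`P (X 0 = σ 0, X (τ 1) = σ 1, …, X (τ k) = σ k)
  = μ (σ 0) * ∏_{i < k} exp ((τ (i+1) - τ i) L) (σ i, σ (i+1))`.
Only the times `t ≥ 0` matter. -/
structure IsMarkovProcess {E : Type*} [Fintype E] [DecidableEq E] (L : (E → ℝ) → E → ℝ)
    (μ : E → ℝ) {Ω : Type*} [MeasurableSpace Ω] (P : Measure Ω) (X : ℝ → Ω → E) : Prop where
  isProbabilityMeasure : IsProbabilityMeasure P
  measurableSet_eq : ∀ t : ℝ, 0 ≤ t → ∀ e : E, MeasurableSet {ω | X t ω = e}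
  right_continuous : ∀ ω, ∀ t : ℝ, 0 ≤ t → ∀ᶠ s in 𝓝[>] t, X s ω = X t ω
  left_limit : ∀ ω, ∀ t : ℝ, 0 < t → ∃ e : E, ∀ᶠ s in 𝓝[<] t, X s ω = e
  finite_dim : ∀ (k : ℕ) (τ : ℕ → ℝ) (σ : ℕ → E), Monotone τ → τ 0 = 0 →
    P.real {ω | ∀ i ≤ k, X (τ i) ω = σ i} =
      μ (σ 0) * ∏ i ∈ Finset.range k,
        (NormedSpace.exp ((τ (i + 1) - τ i) • rateMatrix L)) (σ i) (σ (i + 1))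

/-! ### The exclusion process with long jumps and reservoirs -/

/-- The set of sites `Λ_n = {1, …, n - 1}`. -/
def sites (n : ℕ) : Finset ℤ := Finset.Ioo 0 (n : ℤ)

/-- The state space `{0,1}^{Λ_n}`. -/
abbrev Config (n : ℕ) : Type := sites n → Fin 2

/-- The occupation variable `η_x` as a real number. -/
def occ {n : ℕ} (η : Config n) (x : sites n) : ℝ := ((η x : ℕ) : ℝ)

/-- The centred occupation variable `η_x - 1/2`. -/
def cocc {n : ℕ} (η : Config n) (x : sites n) : ℝ := occ η x - 1 / 2

/-- `η^{x,y}`: the values at `x` and `y` are exchanged. -/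
def exchange {n : ℕ} (η : Config n) (x y : sites n) : Config n := fun z => η (Equiv.swap x y z)

/-- `η^x`: the value at `x` is flipped. -/
def flip {n : ℕ} (η : Config n) (x : sites n) : Config n := Function.update η x (1 - η x)

/-- `s_α(x) = |x|^{-1-α}` for `x ≠ 0`, and `s_α(0) = 0`. -/
def symRate (α : ℝ) (x : ℤ) : ℝ := if x ≠ 0 then |(x : ℝ)| ^ (-1 - α) else 0

/-- `p_γ(x) = |x|^{-1-γ}` for `x > 0`, and `p_γ(x) = 0` for `x ≤ 0`. -/
def asymRate (γ : ℝ) (x : ℤ) : ℝ := if 0 < x then |(x : ℝ)| ^ (-1 - γ) else 0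

/-- `a_γ`, the antisymmetric part of `p_γ`. -/
def antiRate (γ : ℝ) (x : ℤ) : ℝ := (asymRate γ x - asymRate γ (-x)) / 2

/-- The mean `m = ∑_y y p_γ(y)`. -/
def meanRate (γ : ℝ) : ℝ := ∑' y : ℤ, (y : ℝ) * asymRate γ y

/-- The symmetric part `L_s` of the dynamics. -/
def genSym (α : ℝ) (n : ℕ) (f : Config n → ℝ) (η : Config n) : ℝ :=
  (∑ x : sites n, ∑ y : sites n, symRate α (x - y) * (f (exchange η x y) - f η))
  + 1 / 2 * ∑ x : sites n, ∑' y : {y : ℤ // y ∉ sites n},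
      symRate α (x - y) * (f (flip η x) - f η)

/-- The asymmetric part `L_a` of the dynamics. -/
def genAsym (γ : ℝ) (n : ℕ) (f : Config n → ℝ) (η : Config n) : ℝ :=
  (∑ x : sites n, ∑ y : sites n,
      asymRate γ (y - x) * occ η x * (1 - occ η y) * (f (exchange η x y) - f η))
  + 1 / 2 * (∑ x : sites n, ∑' y : {y : ℤ // y ≤ 0},
      asymRate γ (x - y) * (1 - occ η x) * (f (flip η x) - f η))
  + 1 / 2 * (∑ x : sites n, ∑' y : {y : ℤ // (n : ℤ) ≤ y},
      asymRate γ (y - x) * occ η x * (f (flip η x) - f η))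

/-- The generator `L_n = n² L_s + n^θ L_a`. -/
def gen (α θ γ : ℝ) (n : ℕ) (f : Config n → ℝ) (η : Config n) : ℝ :=
  (n : ℝ) ^ 2 * genSym α n f η + (n : ℝ) ^ θ * genAsym γ n f η

/-- The weights of the Bernoulli product measure `ν_ρ` with density `ρ`. -/
def bernoulliWeight (ρ : ℝ) {n : ℕ} (η : Config n) : ℝ :=
  ∏ x : sites n, if η x = 1 then ρ else 1 - ρ

/-- `η` is the Markov process with generator `L_n` started from `ν_{1/2}`. -/
def IsExclusionProcess (α θ γ : ℝ) (n : ℕ) {Ω : Type*} [MeasurableSpace Ω] (P : Measure Ω)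
    (η : ℝ → Ω → Config n) : Prop :=
  IsMarkovProcess (gen α θ γ n) (bernoulliWeight (1 / 2)) P η

/-! ### Test functions and observables -/

/-- The space `𝒮`: smooth functions on `[0,1]` all of whose derivatives (of order `0, 1, 2, …`)
vanish at `0` and `1`. The values of `H` outside `[0,1]` are irrelevant. -/
structure IsTestFunction (H : ℝ → ℝ) : Prop where
  smooth : ContDiffOn ℝ (⊤ : ℕ∞) H (Set.Icc 0 1)
  at_zero : ∀ i : ℕ, iteratedDerivWithin i H (Set.Icc 0 1) 0 = 0
  at_one : ∀ i : ℕ, iteratedDerivWithin i H (Set.Icc 0 1) 1 = 0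

/-- The derivative `H'` of a function on `[0,1]`. -/
def grad (H : ℝ → ℝ) (u : ℝ) : ℝ := derivWithin H (Set.Icc 0 1) u

/-- `‖∇H‖²_{L²([0,1])}`. -/
def gradSqNorm (H : ℝ → ℝ) : ℝ := ∫ u in (0 : ℝ)..1, grad H u ^ 2

/-- The quadratic term `A^{n,4}(H)` as a function of the configuration. -/
def quadTerm (θ γ : ℝ) (n : ℕ) (H : ℝ → ℝ) (η : Config n) : ℝ :=
  -((n : ℝ) ^ θ / √(n : ℝ)) * ∑ x : sites n, ∑ y : sites n,
    antiRate γ (y - x) * (H (((y : ℤ) : ℝ) / n) - H (((x : ℤ) : ℝ) / n)) * cocc η x * cocc η y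

/-- The occupation variable at an arbitrary integer, set to `0` outside `Λ_n`. (When `2 ℓ ≤ n`,
the box averages below only involve sites of `Λ_n`.) -/
def occZ {n : ℕ} (η : Config n) (z : ℤ) : ℝ := if h : z ∈ sites n then occ η ⟨z, h⟩ else 0

/-- The box average `η_x^ℓ`: over the box of length `ℓ` to the right of `x` (with `x` included) if
`x ≤ n - ℓ - 1`, and over the box of length `ℓ` to the left of `x` (with `x` included) otherwise. -/
def boxAvg {n : ℕ} (ℓ : ℕ) (η : Config n) (x : sites n) : ℝ :=
  if (x : ℤ) ≤ (n : ℤ) - ℓ - 1 then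
    1 / (ℓ : ℝ) * ∑ y ∈ Finset.range ℓ, occZ η (x + y)
  else
    1 / (ℓ : ℝ) * ∑ y ∈ Finset.range ℓ, occZ η (x - y)

/-- `∑_{x ∈ Λ_n} { (η_x^ℓ - 1/2)² - 1/(4ℓ) } H'(x/n)`. -/
def boxSquareSum (n ℓ : ℕ) (H : ℝ → ℝ) (η : Config n) : ℝ :=
  ∑ x : sites n, ((boxAvg ℓ η x - 1 / 2) ^ 2 - 1 / (4 * (ℓ : ℝ))) * grad H (((x : ℤ) : ℝ) / n)

/-- `𝔼 [ sup_{0 ≤ t ≤ T} ( ∫_0^t F(X_s) ds )² ]`, as an element of `[0, ∞]`. -/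
def supSqTimeIntegral {E Ω : Type*} [MeasurableSpace Ω] (P : Measure Ω) (X : ℝ → Ω → E) (T : ℝ)
    (F : E → ℝ) : ENNReal :=
  ∫⁻ ω, ⨆ t ∈ Set.Icc (0 : ℝ) T, ENNReal.ofReal ((∫ s in (0 : ℝ)..t, F (X s ω)) ^ 2) ∂P

end LongJumpExclusion

end

/-!
The proof combines the Kipnis–Varadhan inequality with an explicit replacement of the quadratic term
by squares of box averages, in the stationary state: the uniform measure on `{0,1}^{Λ_n}`, which is
`ν_{1/2}`, is invariant (`sum_gen_eq_zero`).

**Kipnis–Varadhan.** If `F = -(Q + Qᵀ) g / 2` for the rate matrix `Q`, the time integral of `F` is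
half the sum of the Dynkin martingales of `g` for the process and for its time reversal, the boundary
terms cancelling. Doob's inequality bounds it by a multiple of `T` times the Dirichlet form of `g`,
that is, of the `H_{-1}` norm of `F` (`IsMarkovProcess.supSqTimeIntegral_le`). As only the
finite-dimensional distributions are given, the argument is carried out for the chains sampled along
the grids of step `T / N`, where Doob's inequality follows from a pathwise identity
(`sum_runMax_mul_le`), and right continuity and Fatou's lemma give the limit `N → ∞`.

**The `H_{-1}` norm.** The Dirichlet form dominates `n²/2` times the one of nearest-neighbour
exchanges, so that `∑_z g_z (η_z - η_{z+1})`, with `g_z` invariant under the exchange of the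
occupation variables at `z` and `z + 1`, has squared `H_{-1}` norm at most `∑_z 𝔼 g_z² / (2 n²)`
(`two_mul_sum_gradient_le`).

**The replacement.** Each pair of sites is attached to one of its points `u`, its anchor, in such a
way that it lies in the box of `u` if its diameter `k` is less than `ℓ`. Up to an error in the Taylor
expansion of `H`, which is small in `L²`, the quadratic term is
`-n^(θ - 3/2) ∑ H'(u/n) k^{-γ} η̄_u η̄_w`. For fixed `u` the factors `η̄_w` are moved to the average
over the rest of the box, and then `η̄_u` to the average over the box. Both steps are summations by
parts against a flow supported on the box and bounded by the transported mass (`sum_pairs_eq`), and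
the energy of these flows is of order `ℓ m² ∑ H'(u/n)²` (`sum_bondCoeff_sq_le`); divided by `n²`, it
gives `m² ε ‖H'‖²`. The weight of the pairs anchored at `u` differs from `m` by a tail of the series
`∑ k^{-γ}`, which is negligible on average over `u`.

For `θ = 3/2` this is the claim. For `θ < 3/2` and `γ > 1` one takes `ε = 1/2`: all terms, including
the box averages, are bounded, and the prefactor `n^(θ - 3/2)` tends to `0`. For `γ ≤ 1` the series
`m` diverges, but then `θ < γ`, and the variance of the quadratic term, of order `n^(2(θ - γ))`,
already tends to `0`.
-/

open Filter Topology MeasureTheory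

noncomputable section

namespace LongJumpExclusion

/-! ### Riemann sums of right-continuous functions -/

/-- The right endpoint of the cell of the grid `δ ℕ` that contains `s`. It is larger than `s`, so
that right continuity alone controls a function along these points as `δ → 0`. -/
def gridRight (δ s : ℝ) : ℝ := ((⌊s / δ⌋₊ : ℝ) + 1) * δ

lemma lt_gridRight {δ s : ℝ} (hδ : 0 < δ) : s < gridRight δ s := by
  have := Nat.lt_floor_add_one (s / δ)
  rwa [div_lt_iff₀ hδ] at this

lemma gridRight_le {δ s : ℝ} (hδ : 0 < δ) (hs : 0 ≤ s) : gridRight δ s ≤ s + δ := by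
  have h := Nat.floor_le (div_nonneg hs hδ.le)
  rw [le_div_iff₀ hδ] at h
  unfold gridRight
  linarith

lemma tendsto_gridRight {δ : ℕ → ℝ} (hδ : ∀ᶠ N in atTop, 0 < δ N) (hδ0 : Tendsto δ atTop (𝓝 0))
    {s : ℝ} (hs : 0 ≤ s) : Tendsto (fun N => gridRight (δ N) s) atTop (𝓝[>] s) := by
  refine tendsto_nhdsWithin_iff.2 ⟨?_, hδ.mono fun N h => lt_gridRight h⟩
  have h1 : Tendsto (fun N => s + δ N) atTop (𝓝 s) := by simpa using hδ0.const_add s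
  exact tendsto_of_tendsto_of_tendsto_of_le_of_le' tendsto_const_nhds h1
    (hδ.mono fun N h => (lt_gridRight h).le) (hδ.mono fun N h => gridRight_le h hs)

lemma measurable_comp_gridRight (δ : ℝ) (y : ℝ → ℝ) : Measurable fun s => y (gridRight δ s) := by
  have h : Measurable fun k : ℕ => y (((k : ℝ) + 1) * δ) := measurable_from_nat
  exact h.comp (Nat.measurable_floor.comp (measurable_id.div_const δ))

lemma tendsto_comp_gridRight {y : ℝ → ℝ} (hy : ∀ t, 0 ≤ t → ∀ᶠ s in 𝓝[>] t, y s = y t)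
    {δ : ℕ → ℝ} (hδ : ∀ᶠ N in atTop, 0 < δ N) (hδ0 : Tendsto δ atTop (𝓝 0)) {s : ℝ}
    (hs : 0 ≤ s) : Tendsto (fun N => y (gridRight (δ N) s)) atTop (𝓝 (y s)) :=
  tendsto_const_nhds.congr' <|
    ((tendsto_gridRight hδ hδ0 hs).eventually (hy s hs)).mono fun _ h => h.symm

lemma aestronglyMeasurable_of_rightContinuous {y : ℝ → ℝ}
    (hy : ∀ t, 0 ≤ t → ∀ᶠ s in 𝓝[>] t, y s = y t) (t : ℝ) :
    AEStronglyMeasurable y (volume.restrict (Set.Ioc 0 t)) := by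
  refine aestronglyMeasurable_of_tendsto_ae atTop
    (f := fun N : ℕ => fun s => y (gridRight (1 / ((N : ℝ) + 1)) s))
    (fun N => (measurable_comp_gridRight _ y).aestronglyMeasurable) ?_
  filter_upwards [ae_restrict_mem measurableSet_Ioc] with s hs
  exact tendsto_comp_gridRight hy (Eventually.of_forall fun N => by positivity)
    tendsto_one_div_add_atTop_nhds_zero_nat hs.1.le

lemma intervalIntegrable_of_rightContinuous {y : ℝ → ℝ} {C : ℝ} (hC : ∀ s, |y s| ≤ C)
    (hy : ∀ t, 0 ≤ t → ∀ᶠ s in 𝓝[>] t, y s = y t) {t : ℝ} (ht : 0 ≤ t) :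
    IntervalIntegrable y volume 0 t := by
  rw [intervalIntegrable_iff_integrableOn_Ioc_of_le ht]
  exact Integrable.of_bound (aestronglyMeasurable_of_rightContinuous hy t) C
    (ae_of_all _ fun s => hC s)

lemma integral_comp_gridRight {δ : ℝ} (hδ : 0 < δ) (y : ℝ → ℝ) (k : ℕ)
    (hi : ∀ a b, IntervalIntegrable (fun s => y (gridRight δ s)) volume a b) :
    ∫ s in (0 : ℝ)..k * δ, y (gridRight δ s) = δ * ∑ j ∈ Finset.range k, y (((j : ℝ) + 1) * δ) := by
  have h := intervalIntegral.sum_integral_adjacent_intervals (n := k)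
    (a := fun j : ℕ => (j : ℝ) * δ) (μ := volume) (f := fun s => y (gridRight δ s))
    (fun _ _ => hi _ _)
  simp only [Nat.cast_zero, zero_mul] at h
  rw [← h, Finset.mul_sum]
  refine Finset.sum_congr rfl fun j _ => ?_
  have hle : (j : ℝ) * δ ≤ ((j + 1 : ℕ) : ℝ) * δ := by push_cast; nlinarith
  rw [intervalIntegral.integral_of_le hle, ← integral_Ico_eq_integral_Ioc,
    setIntegral_congr_fun (g := fun _ => y (((j : ℝ) + 1) * δ)) measurableSet_Ico]
  · simp only [setIntegral_const, smul_eq_mul, Measure.real, Real.volume_Ico]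
    rw [ENNReal.toReal_ofReal (by linarith)]
    push_cast; ring
  · intro s hs
    have h1 : ⌊s / δ⌋₊ = j := by
      rw [Nat.floor_eq_iff (div_nonneg (le_trans (by positivity) hs.1) hδ.le)]
      refine ⟨by rw [le_div_iff₀ hδ]; exact hs.1, ?_⟩
      rw [div_lt_iff₀ hδ]
      have := hs.2; push_cast at this; exact this
    simp only [gridRight, h1]

/-- Riemann sums at right endpoints converge for a bounded right-continuous step function. -/
lemma tendsto_riemannSum {y : ℝ → ℝ} {C : ℝ} (hC : ∀ s, |y s| ≤ C)
    (hy : ∀ t, 0 ≤ t → ∀ᶠ s in 𝓝[>] t, y s = y t) {T t : ℝ} (hT : 0 < T) (ht : 0 ≤ t) :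
    Tendsto (fun N : ℕ => T / N * ∑ j ∈ Finset.range ⌊t / (T / N)⌋₊, y (((j : ℝ) + 1) * (T / N)))
      atTop (𝓝 (∫ s in (0 : ℝ)..t, y s)) := by
  have hδ : ∀ᶠ N : ℕ in atTop, 0 < T / (N : ℝ) :=
    (eventually_gt_atTop 0).mono fun N hN => div_pos hT (by exact_mod_cast hN)
  have hδ0 : Tendsto (fun N : ℕ => T / (N : ℝ)) atTop (𝓝 0) :=
    tendsto_const_div_atTop_nhds_zero_nat T
  have hi : ∀ δ a b, IntervalIntegrable (fun s => y (gridRight δ s)) volume a b := fun δ a b =>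
    (intervalIntegrable_const (c := C)).mono_fun
      (measurable_comp_gridRight δ y).aestronglyMeasurable
      (ae_of_all _ fun s => by
        simpa [Real.norm_eq_abs] using (hC _).trans (le_abs_self C))
  have h1 : Tendsto (fun N : ℕ => ∫ s in (0 : ℝ)..t, y (gridRight (T / N) s)) atTop
      (𝓝 (∫ s in (0 : ℝ)..t, y s)) := by
    refine intervalIntegral.tendsto_integral_filter_of_dominated_convergence (fun _ => C)
      (Eventually.of_forall fun N => (measurable_comp_gridRight _ y).aestronglyMeasurable)
      (Eventually.of_forall fun N => ae_of_all _ fun s _ => hC _) intervalIntegrable_const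
      (ae_of_all _ fun s hs => ?_)
    rw [Set.uIoc_of_le ht] at hs
    exact tendsto_comp_gridRight hy hδ hδ0 hs.1.le
  have h2 : Tendsto (fun N : ℕ => ∫ s in (⌊t / (T / N)⌋₊ * (T / N) : ℝ)..t,
      y (gridRight (T / N) s)) atTop (𝓝 0) := by
    refine squeeze_zero_norm' (a := fun N : ℕ => C * (T / N)) ?_ (by simpa using hδ0.const_mul C)
    filter_upwards [hδ] with N hN
    refine (intervalIntegral.norm_integral_le_of_norm_le_const (C := C) fun s _ => hC _).trans ?_
    have hC0 : 0 ≤ C := (abs_nonneg _).trans (hC 0)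
    have h3 := Nat.floor_le (div_nonneg ht hN.le)
    have h4 := Nat.lt_floor_add_one (t / (T / N))
    rw [le_div_iff₀ hN] at h3
    rw [div_lt_iff₀ hN] at h4
    gcongr
    rw [abs_of_nonneg (by linarith)]
    linarith
  have h3 := h1.sub h2
  rw [sub_zero] at h3
  refine h3.congr' ?_
  filter_upwards [hδ] with N hN
  rw [← integral_comp_gridRight hN y _ (hi _)]
  rw [← intervalIntegral.integral_add_adjacent_intervals (hi _ 0 (⌊t / (T / N)⌋₊ * (T / N)))
    (hi _ _ t)]
  ring

/-! ### Doob's inequality in discrete time -/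

/-- The running maximum `max_{j ≤ k} |M_j|`. -/
def runMax (M : ℕ → ℝ) : ℕ → ℝ
  | 0 => |M 0|
  | k + 1 => max (runMax M k) |M (k + 1)|

lemma abs_le_runMax (M : ℕ → ℝ) {j k : ℕ} (h : j ≤ k) : |M j| ≤ runMax M k := by
  induction k with
  | zero => obtain rfl : j = 0 := by omega
            exact le_rfl
  | succ k ih =>
    rcases Nat.lt_or_ge k j with h1 | h1
    · obtain rfl : j = k + 1 := by omega
      exact le_max_right _ _
    · exact (ih h1).trans (le_max_left _ _)

lemma runMax_nonneg (M : ℕ → ℝ) (k : ℕ) : 0 ≤ runMax M k :=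
  (abs_nonneg _).trans (abs_le_runMax M le_rfl)

lemma runMax_congr {M M' : ℕ → ℝ} {k : ℕ} (h : ∀ j ≤ k, M j = M' j) : runMax M k = runMax M' k := by
  induction k with
  | zero => simp [runMax, h 0 le_rfl]
  | succ k ih => simp [runMax, ih fun j hj => h j (by omega), h (k + 1) le_rfl]

/-- The pathwise form of Doob's `L²` inequality: the sum on the left is a martingale transform up
to a submartingale drift, so its expectation is nonnegative. -/
lemma sum_runMax_mul_le (M : ℕ → ℝ) (h0 : M 0 = 0) (N : ℕ) :
    ∑ i ∈ Finset.range N, runMax M i * (|M (i + 1)| - |M i|)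
      ≤ runMax M N * |M N| - runMax M N ^ 2 / 2 := by
  induction N with
  | zero => simp [runMax, h0]
  | succ k ih =>
    rw [Finset.sum_range_succ]
    simp only [runMax]
    have h2 := abs_nonneg (M (k + 1))
    rcases le_total (runMax M k) |M (k + 1)| with h | h
    · rw [max_eq_right h]
      nlinarith [sq_nonneg (runMax M k - |M (k + 1)|)]
    · rw [max_eq_left h]
      nlinarith

section Chain

variable {E : Type*} [Fintype E] {Ω : Type*}

/-- The increment `g (Y_{j+1}) - (R g) (Y_j)`. -/
def chainIncr (Y : ℕ → Ω → E) (R : Matrix E E ℝ) (g : E → ℝ) (j : ℕ) (ω : Ω) : ℝ :=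
  g (Y (j + 1) ω) - R.mulVec g (Y j ω)

/-- The martingale `∑_{j < k} (g (Y_{j+1}) - (R g) (Y_j))`. -/
def chainMart (Y : ℕ → Ω → E) (R : Matrix E E ℝ) (g : E → ℝ) (ω : Ω) (k : ℕ) : ℝ :=
  ∑ j ∈ Finset.range k, chainIncr Y R g j ω

lemma chainIncr_congr {Y : ℕ → Ω → E} (R : Matrix E E ℝ) (g : E → ℝ) {j : ℕ} {ω ω' : Ω}
    (h : ∀ i ≤ j + 1, Y i ω = Y i ω') : chainIncr Y R g j ω = chainIncr Y R g j ω' := by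
  simp [chainIncr, h j (by omega), h (j + 1) le_rfl]

lemma chainMart_congr {Y : ℕ → Ω → E} (R : Matrix E E ℝ) (g : E → ℝ) {k : ℕ} {ω ω' : Ω}
    (h : ∀ i ≤ k, Y i ω = Y i ω') {j : ℕ} (hj : j ≤ k) :
    chainMart Y R g ω j = chainMart Y R g ω' j := by
  refine Finset.sum_congr rfl fun i hi => chainIncr_congr R g fun l hl => h l ?_
  have := Finset.mem_range.1 hi
  omega

variable [MeasurableSpace Ω]

/-- Functions of finitely many coordinates of a finite-state process are measurable. -/
lemma measurable_of_path {Y : ℕ → Ω → E} (hY : ∀ i e, MeasurableSet {ω | Y i ω = e}) (j : ℕ)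
    {Φ : Ω → ℝ} (hΦ : ∀ ω ω', (∀ i ≤ j, Y i ω = Y i ω') → Φ ω = Φ ω') : Measurable Φ := by
  let _ : MeasurableSpace E := ⊤
  have hp : Measurable fun ω => fun i : Fin (j + 1) => Y i ω :=
    measurable_pi_lambda _ fun i => measurable_to_countable' fun e => hY i e
  intro s _
  have : Φ ⁻¹' s = (fun ω => fun i : Fin (j + 1) => Y i ω) ⁻¹'
      ((fun ω => fun i : Fin (j + 1) => Y i ω) '' (Φ ⁻¹' s)) := by
    refine Set.Subset.antisymm (Set.subset_preimage_image _ _) ?_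
    rintro ω ⟨ω', h1, h2⟩
    have : Φ ω' = Φ ω := hΦ _ _ fun i hi => by
      have := congr_fun h2 ⟨i, by omega⟩
      simpa using this
    simpa [Set.mem_preimage, ← this] using h1
  rw [this]
  exact hp (Set.toFinite _).measurableSet

lemma integrable_of_path {P : Measure Ω} [IsFiniteMeasure P] {Y : ℕ → Ω → E}
    (hY : ∀ i e, MeasurableSet {ω | Y i ω = e}) (j : ℕ)
    {Φ : Ω → ℝ} (hΦ : ∀ ω ω', (∀ i ≤ j, Y i ω = Y i ω') → Φ ω = Φ ω') : Integrable Φ P := by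
  classical
  have hfin : (Set.range Φ).Finite := by
    have : Set.range Φ ⊆ Set.range (fun σ : Fin (j + 1) → E =>
        if h : ∃ ω, (fun i : Fin (j + 1) => Y i ω) = σ then Φ h.choose else 0) := by
      rintro _ ⟨ω, rfl⟩
      refine ⟨fun i => Y i ω, ?_⟩
      have h : ∃ ω', (fun i : Fin (j + 1) => Y i ω') = fun i : Fin (j + 1) => Y i ω := ⟨ω, rfl⟩
      simp only
      rw [dif_pos h]
      refine hΦ _ _ fun i hi => ?_
      have := congr_fun h.choose_spec ⟨i, by omega⟩
      simpa using this
    exact (Set.finite_range _).subset this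
  obtain ⟨C, hC⟩ := hfin.isBounded.exists_norm_le
  exact Integrable.of_bound (measurable_of_path hY j hΦ).aestronglyMeasurable C
    (ae_of_all _ fun ω => hC _ ⟨ω, rfl⟩)

/-- `Y_0, …, Y_N` is a stationary Markov chain with transition matrix `R` and uniform marginals. -/
structure IsUniformChain (P : Measure Ω) (Y : ℕ → Ω → E) (R : Matrix E E ℝ) (N : ℕ) : Prop where
  measurableSet_eq : ∀ i e, MeasurableSet {ω | Y i ω = e}
  markov : ∀ j < N, ∀ σ : ℕ → E, ∀ e, P.real {ω | (∀ i ≤ j, Y i ω = σ i) ∧ Y (j + 1) ω = e} =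
    P.real {ω | ∀ i ≤ j, Y i ω = σ i} * R (σ j) e
  uniform : ∀ j ≤ N, ∀ e, P.real {ω | Y j ω = e} = (Fintype.card E : ℝ)⁻¹

lemma IsUniformChain.integral_eq {P : Measure Ω} [IsProbabilityMeasure P] {Y : ℕ → Ω → E}
    {R : Matrix E E ℝ} {N : ℕ} (h : IsUniformChain P Y R N) {j : ℕ} (hj : j ≤ N) (f : E → ℝ) :
    ∫ ω, f (Y j ω) ∂P = (Fintype.card E : ℝ)⁻¹ * ∑ e, f e := by
  classical
  have h1 : ∀ ω, f (Y j ω) = ∑ e, {ω | Y j ω = e}.indicator (fun _ => f e) ω := fun ω => by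
    simp [Set.indicator_apply]
  simp_rw [h1]
  rw [integral_finsetSum _ fun e _ => (integrable_const _).indicator (h.measurableSet_eq j e)]
  rw [Finset.mul_sum]
  refine Finset.sum_congr rfl fun e _ => ?_
  rw [integral_indicator_const _ (h.measurableSet_eq j e), h.uniform j hj e, smul_eq_mul]

/-- The increments are orthogonal to the past. -/
lemma IsUniformChain.integral_mul_incr {P : Measure Ω} [IsProbabilityMeasure P] {Y : ℕ → Ω → E}
    {R : Matrix E E ℝ} {N : ℕ} (h : IsUniformChain P Y R N) {j : ℕ} (hj : j < N) (g : E → ℝ)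
    {Φ : Ω → ℝ} (hΦ : ∀ ω ω', (∀ i ≤ j, Y i ω = Y i ω') → Φ ω = Φ ω') :
    ∫ ω, Φ ω * chainIncr Y R g j ω ∂P = 0 := by
  classical
  rcases isEmpty_or_nonempty E with hE | hE
  · have : IsEmpty Ω := ⟨fun ω => hE.elim (Y 0 ω)⟩
    simp [Measure.eq_zero_of_isEmpty P]
  let A : (Fin (j + 1) → E) → Set Ω := fun σ => {ω | ∀ i : Fin (j + 1), Y i ω = σ i}
  have hA : ∀ σ, MeasurableSet (A σ) := fun σ => by
    have : A σ = ⋂ i : Fin (j + 1), {ω | Y i ω = σ i} := by ext; simp [A]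
    rw [this]
    exact MeasurableSet.iInter fun i => h.measurableSet_eq _ _
  have hint : ∀ σ, ∫ ω in A σ, chainIncr Y R g j ω ∂P = 0 := fun σ => by
    let σ' : ℕ → E := fun i => if hi : i < j + 1 then σ ⟨i, hi⟩ else Classical.arbitrary E
    have hA' : A σ = {ω | ∀ i ≤ j, Y i ω = σ' i} := by
      ext ω
      simp only [A, Set.mem_ofPred_eq, σ']
      constructor
      · intro hh i hi
        rw [dif_pos (by omega : i < j + 1)]
        exact hh ⟨i, by omega⟩
      · intro hh i
        have := hh i (by omega)
        rwa [dif_pos i.2] at this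
    have h1 : ∀ ω ∈ A σ, chainIncr Y R g j ω =
        ∑ e, ({ω | Y (j + 1) ω = e}.indicator (fun _ => g e) ω - R (σ' j) e * g e) := by
      intro ω hω
      rw [hA'] at hω
      rw [Finset.sum_sub_distrib]
      simp [chainIncr, Set.indicator_apply, hω j le_rfl, Matrix.mulVec, dotProduct]
    rw [setIntegral_congr_fun (hA σ) h1, integral_finsetSum]
    · refine Finset.sum_eq_zero fun e _ => ?_
      rw [integral_sub, integral_indicator_const _ (h.measurableSet_eq _ _)]
      · have h2 := h.markov j hj σ' e
        rw [Measure.real, Measure.restrict_apply (h.measurableSet_eq _ _)]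
        have h3 : {ω | Y (j + 1) ω = e} ∩ A σ =
            {ω | (∀ i ≤ j, Y i ω = σ' i) ∧ Y (j + 1) ω = e} := by
          rw [hA']; ext; simp [and_comm]
        rw [h3, ← Measure.real, h2]
        simp only [smul_eq_mul, setIntegral_const, hA']
        ring
      · exact (integrable_const _).indicator (h.measurableSet_eq _ _)
      · exact integrable_const _
    · intro e _
      exact ((integrable_const _).indicator (h.measurableSet_eq _ _)).sub (integrable_const _)
  have hΦm : ∀ ω ω', (∀ i ≤ j + 1, Y i ω = Y i ω') →
      Φ ω * chainIncr Y R g j ω = Φ ω' * chainIncr Y R g j ω' := fun ω ω' hh => by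
    rw [hΦ ω ω' fun i hi => hh i (by omega), chainIncr_congr R g hh]
  have hI : Integrable (fun ω => Φ ω * chainIncr Y R g j ω) P :=
    integrable_of_path h.measurableSet_eq (j + 1) hΦm
  have huniv : (⋃ σ, A σ) = Set.univ := by
    ext ω
    simp only [Set.mem_iUnion, Set.mem_univ, iff_true]
    exact ⟨fun i => Y i ω, fun i => rfl⟩
  rw [← setIntegral_univ, ← huniv, integral_iUnion_fintype hA]
  · refine Finset.sum_eq_zero fun σ _ => ?_
    rcases (A σ).eq_empty_or_nonempty with h0 | ⟨ω₀, h0⟩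
    · simp [h0]
    · rw [setIntegral_congr_fun (g := fun ω => Φ ω₀ * chainIncr Y R g j ω) (hA σ),
        integral_const_mul, hint σ, mul_zero]
      intro ω hω
      have : Φ ω = Φ ω₀ := hΦ _ _ fun i hi => by
        have h1 := hω ⟨i, by omega⟩
        have h2 := h0 ⟨i, by omega⟩
        exact h1.trans h2.symm
      simp only [this]
  · intro σ τ hne
    refine Set.disjoint_left.2 fun ω h1 h2 => hne ?_
    ext i
    exact (h1 i).symm.trans (h2 i)
  · exact fun σ => hI.integrableOn

/-- `L²` norm of the martingale. -/
lemma IsUniformChain.integral_mart_sq {P : Measure Ω} [IsProbabilityMeasure P] {Y : ℕ → Ω → E}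
    {R : Matrix E E ℝ} {N : ℕ} (h : IsUniformChain P Y R N) (g : E → ℝ) {k : ℕ} (hk : k ≤ N) :
    ∫ ω, chainMart Y R g ω k ^ 2 ∂P =
      k * ((Fintype.card E : ℝ)⁻¹ * ∑ e, (g e ^ 2 - R.mulVec g e ^ 2)) := by
  have hm := h.measurableSet_eq
  induction k with
  | zero => simp [chainMart]
  | succ k ih =>
    have e1 : ∀ ω, chainMart Y R g ω (k + 1) ^ 2 = chainMart Y R g ω k ^ 2
        + ((2 * chainMart Y R g ω k) * chainIncr Y R g k ω
        + ((g (Y (k + 1) ω) ^ 2 - R.mulVec g (Y k ω) ^ 2)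
        + (-2 * R.mulVec g (Y k ω)) * chainIncr Y R g k ω)) := fun ω => by
      rw [chainMart, Finset.sum_range_succ, ← chainMart]
      simp only [chainIncr]
      ring
    simp_rw [e1]
    have c1 : ∀ ω ω', (∀ i ≤ k + 1, Y i ω = Y i ω') → chainMart Y R g ω k = chainMart Y R g ω' k :=
      fun ω ω' hh => chainMart_congr R g hh (by omega)
    have c2 : ∀ ω ω', (∀ i ≤ k + 1, Y i ω = Y i ω') → chainIncr Y R g k ω = chainIncr Y R g k ω' :=
      fun ω ω' hh => chainIncr_congr R g hh
    have i1 : Integrable (fun ω => chainMart Y R g ω k ^ 2) P :=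
      integrable_of_path hm (k + 1) fun ω ω' hh => by rw [c1 ω ω' hh]
    have i2 : Integrable (fun ω => (2 * chainMart Y R g ω k) * chainIncr Y R g k ω) P :=
      integrable_of_path hm (k + 1) fun ω ω' hh => by rw [c1 ω ω' hh, c2 ω ω' hh]
    have i3 : Integrable (fun ω => (-2 * R.mulVec g (Y k ω)) * chainIncr Y R g k ω) P :=
      integrable_of_path hm (k + 1) fun ω ω' hh => by rw [hh k (by omega), c2 ω ω' hh]
    have i4 : Integrable (fun ω => g (Y (k + 1) ω) ^ 2) P :=
      integrable_of_path hm (k + 1) fun ω ω' hh => by rw [hh (k + 1) le_rfl]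
    have i5 : Integrable (fun ω => R.mulVec g (Y k ω) ^ 2) P :=
      integrable_of_path hm (k + 1) fun ω ω' hh => by rw [hh k (by omega)]
    have i45 : Integrable (fun ω => g (Y (k + 1) ω) ^ 2 - R.mulVec g (Y k ω) ^ 2) P := i4.sub i5
    have i6 : Integrable (fun ω => (g (Y (k + 1) ω) ^ 2 - R.mulVec g (Y k ω) ^ 2)
        + (-2 * R.mulVec g (Y k ω)) * chainIncr Y R g k ω) P := i45.add i3
    have i26 : Integrable (fun ω => (2 * chainMart Y R g ω k) * chainIncr Y R g k ω
        + ((g (Y (k + 1) ω) ^ 2 - R.mulVec g (Y k ω) ^ 2)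
        + (-2 * R.mulVec g (Y k ω)) * chainIncr Y R g k ω)) P := i2.add i6
    rw [integral_add i1 i26, integral_add i2 i6, integral_add i45 i3, integral_sub i4 i5,
      ih (by omega),
      h.integral_mul_incr (by omega) g fun ω ω' hh => by rw [chainMart_congr R g hh le_rfl],
      h.integral_mul_incr (by omega) g (Φ := fun ω => -2 * R.mulVec g (Y k ω))
        fun ω ω' hh => by rw [hh k le_rfl],
      h.integral_eq (by omega) fun e => g e ^ 2,
      h.integral_eq (by omega) fun e => R.mulVec g e ^ 2, Finset.sum_sub_distrib]
    push_cast
    ring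

/-- Doob's maximal inequality for the martingale of the chain. -/
lemma IsUniformChain.integral_runMax_sq_le {P : Measure Ω} [IsProbabilityMeasure P]
    {Y : ℕ → Ω → E} {R : Matrix E E ℝ} {N : ℕ} (h : IsUniformChain P Y R N) (g : E → ℝ) :
    ∫ ω, runMax (chainMart Y R g ω) N ^ 2 ∂P ≤
      4 * (N * ((Fintype.card E : ℝ)⁻¹ * ∑ e, (g e ^ 2 - R.mulVec g e ^ 2))) := by
  have hm := h.measurableSet_eq
  set M := chainMart Y R g
  have c1 : ∀ k, ∀ ω ω', (∀ i ≤ k, Y i ω = Y i ω') → M ω k = M ω' k :=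
    fun k ω ω' hh => chainMart_congr R g hh le_rfl
  have c2 : ∀ k, ∀ ω ω', (∀ i ≤ k, Y i ω = Y i ω') → runMax (M ω) k = runMax (M ω') k :=
    fun k ω ω' hh => runMax_congr fun j hj => chainMart_congr R g hh hj
  have hi : ∀ i, Integrable (fun ω => runMax (M ω) i * (|M ω (i + 1)| - |M ω i|)) P := fun i =>
    integrable_of_path hm (i + 1) fun ω ω' hh => by
      rw [c1 _ ω ω' hh, c1 i ω ω' fun l hl => hh l (by omega),
        c2 i ω ω' fun l hl => hh l (by omega)]
  have h1 : ∀ i < N, 0 ≤ ∫ ω, runMax (M ω) i * (|M ω (i + 1)| - |M ω i|) ∂P := fun i hiN => by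
    have h2 := h.integral_mul_incr hiN g
      (Φ := fun ω => runMax (M ω) i * (SignType.sign (M ω i) : ℝ))
      fun ω ω' hh => by rw [c1 i ω ω' hh, c2 i ω ω' hh]
    rw [← h2]
    refine integral_mono (integrable_of_path hm (i + 1) fun ω ω' hh => by
      rw [chainIncr_congr R g hh, c1 i ω ω' fun l hl => hh l (by omega),
        c2 i ω ω' fun l hl => hh l (by omega)]) (hi i) fun ω => ?_
    have h3 : M ω (i + 1) = M ω i + chainIncr Y R g i ω := by
      simp only [M, chainMart, Finset.sum_range_succ]
    simp only
    rw [mul_assoc]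
    refine mul_le_mul_of_nonneg_left ?_ (runMax_nonneg _ _)
    have h4 : (SignType.sign (M ω i) : ℝ) * M ω i = |M ω i| := sign_mul_self _
    have h5 : (SignType.sign (M ω i) : ℝ) * M ω (i + 1) ≤ |M ω (i + 1)| := by
      rcases lt_trichotomy (M ω i) 0 with h | h | h
      · rw [sign_neg h]; simpa using neg_le_abs (M ω (i + 1))
      · simp [h]
      · rw [sign_pos h]; simpa using le_abs_self (M ω (i + 1))
    rw [h3] at h5 ⊢
    linarith
  have h2 : 0 ≤ ∫ ω, ∑ i ∈ Finset.range N, runMax (M ω) i * (|M ω (i + 1)| - |M ω i|) ∂P := by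
    rw [integral_finsetSum _ fun i _ => hi i]
    exact Finset.sum_nonneg fun i hiN => h1 i (Finset.mem_range.1 hiN)
  have iS : Integrable (fun ω => runMax (M ω) N ^ 2) P :=
    integrable_of_path hm N fun ω ω' hh => by rw [c2 N ω ω' hh]
  have iM : Integrable (fun ω => M ω N ^ 2) P :=
    integrable_of_path hm N fun ω ω' hh => by rw [c1 N ω ω' hh]
  have h3 : ∫ ω, ∑ i ∈ Finset.range N, runMax (M ω) i * (|M ω (i + 1)| - |M ω i|) ∂P ≤
      ∫ ω, (M ω N ^ 2 - runMax (M ω) N ^ 2 / 4) ∂P := by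
    refine integral_mono (integrable_finsetSum _ fun i _ => hi i) (iM.sub (iS.div_const 4))
      fun ω => ?_
    refine (sum_runMax_mul_le (M ω) (by simp [M, chainMart]) N).trans ?_
    have := sq_abs (M ω N)
    nlinarith [sq_nonneg (runMax (M ω) N / 2 - |M ω N|)]
  rw [integral_sub iM (iS.div_const 4), integral_div] at h3
  rw [← h.integral_mart_sq g le_rfl]
  linarith

/-- The dissipation bound `‖g‖² - ‖R g‖² ≤ 2 ⟨g, (1 - R) g⟩`. -/
lemma sum_sq_sub_mulVec_sq_le (R : Matrix E E ℝ) (g : E → ℝ) :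
    ∑ e, (g e ^ 2 - R.mulVec g e ^ 2) ≤ 2 * ∑ e, g e * (g e - R.mulVec g e) := by
  rw [Finset.mul_sum]
  exact Finset.sum_le_sum fun e _ => by nlinarith [sq_nonneg (g e - R.mulVec g e)]

end Chain

/-! ### The transition matrices of a finite-state Markov process -/

section Exp

variable {E : Type*} [Fintype E] [DecidableEq E]

attribute [local instance] Matrix.linftyOpNormedRing Matrix.linftyOpNormedAlgebra

lemma exp_mulVec_eq_self {A : Matrix E E ℝ} {v : E → ℝ} (h : A.mulVec v = 0) :
    (NormedSpace.exp A).mulVec v = v := by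
  have h1 := NormedSpace.exp_series_hasSum_exp' (𝕂 := ℝ) A
  let φ : Matrix E E ℝ →+ (E → ℝ) := ⟨⟨fun B => B.mulVec v, by simp⟩,
    fun B C => Matrix.add_mulVec B C v⟩
  have hφ : Continuous φ := by
    show Continuous fun B : Matrix E E ℝ => B.mulVec v
    fun_prop
  have h2 := h1.map φ hφ
  have h3 : HasSum (φ ∘ fun n => ((n.factorial : ℝ))⁻¹ • A ^ n) v := by
    have : φ ((((0 : ℕ).factorial : ℝ))⁻¹ • A ^ 0) = v := by simp [φ]
    rw [← this]
    refine hasSum_single 0 fun n hn => ?_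
    obtain ⟨k, rfl⟩ := Nat.exists_eq_succ_of_ne_zero hn
    show ((((k + 1).factorial : ℝ))⁻¹ • A ^ (k + 1)).mulVec v = 0
    rw [Matrix.smul_mulVec, pow_succ, ← Matrix.mulVec_mulVec, h]
    simp
  exact h2.unique h3

lemma hasDerivAt_exp_smul_mulVec (A : Matrix E E ℝ) (g : E → ℝ) (e : E) :
    HasDerivAt (fun u : ℝ => (NormedSpace.exp (u • A)).mulVec g e) (A.mulVec g e) 0 := by
  have h := hasDerivAt_exp_smul_const A (0 : ℝ)
  simp only [zero_smul, NormedSpace.exp_zero, one_mul] at h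
  let φ : Matrix E E ℝ →ₗ[ℝ] ℝ :=
    { toFun := fun B => B.mulVec g e
      map_add' := fun B C => by rw [Matrix.add_mulVec]; rfl
      map_smul' := fun c B => by rw [Matrix.smul_mulVec]; rfl }
  exact (LinearMap.toContinuousLinearMap φ).hasFDerivAt.comp_hasDerivAt (0 : ℝ) h

lemma tendsto_exp_smul_slope (A : Matrix E E ℝ) (g : E → ℝ) (e : E) {T : ℝ} (hT : 0 < T) :
    Tendsto (fun N : ℕ => (T / N)⁻¹ * (g e - (NormedSpace.exp ((T / (N : ℝ)) • A)).mulVec g e))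
      atTop (𝓝 (-A.mulVec g e)) := by
  have h := (hasDerivAt_exp_smul_mulVec A g e).tendsto_slope
  have hδ : Tendsto (fun N : ℕ => T / (N : ℝ)) atTop (𝓝[≠] 0) := by
    refine tendsto_nhdsWithin_iff.2 ⟨tendsto_const_div_atTop_nhds_zero_nat T, ?_⟩
    filter_upwards [eventually_gt_atTop 0] with N hN
    exact (div_pos hT (by exact_mod_cast hN)).ne'
  refine ((h.comp hδ).neg).congr fun N => ?_
  simp only [Function.comp_apply, slope_def_field, sub_zero, zero_smul, NormedSpace.exp_zero,
    Matrix.one_mulVec, div_eq_inv_mul (b := T / (N : ℝ))]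
  ring

end Exp

section ChainOnFiniteSet

variable {E : Type*} [Fintype E] {Ω : Type*} [MeasurableSpace Ω]

lemma sum_measureReal_and {P : Measure Ω} [IsFiniteMeasure P] {Z : Ω → E}
    (hZ : ∀ e, MeasurableSet {ω | Z ω = e}) {A : Set Ω} (hA : MeasurableSet A) :
    ∑ e, P.real {ω | Z ω = e ∧ ω ∈ A} = P.real A := by
  have h : A = ⋃ e, {ω | Z ω = e ∧ ω ∈ A} := by ext; simp
  conv_rhs => rw [h]
  rw [measureReal_iUnion_fintype]
  · intro e e' hne
    refine Set.disjoint_left.2 fun ω h1 h2 => hne ?_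
    exact h1.1.symm.trans h2.1
  · exact fun e => (hZ e).inter hA

variable [DecidableEq E] {L : (E → ℝ) → E → ℝ} {μ : E → ℝ} {P : Measure Ω} {X : ℝ → Ω → E}

/-- Stationarity: along the grid `δ ℕ`, the law of a window of the process does not depend on
where the window starts. -/
lemma IsMarkovProcess.real_window (h : IsMarkovProcess L μ P X)
    (hμ : ∀ e, μ e = (Fintype.card E : ℝ)⁻¹) {δ : ℝ} (hδ : 0 ≤ δ)
    (hcol : ∀ e', ∑ e, NormedSpace.exp (δ • rateMatrix L) e e' = 1) (a k : ℕ) (σ : ℕ → E) :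
    P.real {ω | ∀ i ≤ k, X (((a + i : ℕ) : ℝ) * δ) ω = σ i} = (Fintype.card E : ℝ)⁻¹ *
      ∏ i ∈ Finset.range k, NormedSpace.exp (δ • rateMatrix L) (σ i) (σ (i + 1)) := by
  have hP := h.isProbabilityMeasure
  have hm : ∀ (i : ℕ) (e : E), MeasurableSet {ω | X ((i : ℝ) * δ) ω = e} := fun i e =>
    h.measurableSet_eq _ (by positivity) e
  induction a generalizing k σ with
  | zero =>
    have h1 := h.finite_dim k (fun i => (i : ℝ) * δ) σ
      (fun i j hij => mul_le_mul_of_nonneg_right (by exact_mod_cast hij) hδ) (by simp)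
    simp only [zero_add]
    rw [h1, hμ]
    congr 1
    refine Finset.prod_congr rfl fun i _ => ?_
    have h2 : ((i + 1 : ℕ) : ℝ) * δ - i * δ = δ := by push_cast; ring
    rw [h2]
  | succ a ih =>
    rw [← sum_measureReal_and (Z := X ((a : ℝ) * δ)) (hm a)]
    · have h1 : ∀ e, {ω | X ((a : ℝ) * δ) ω = e ∧
          ω ∈ {ω | ∀ i ≤ k, X (((a + 1 + i : ℕ) : ℝ) * δ) ω = σ i}} =
          {ω | ∀ i ≤ k + 1, X (((a + i : ℕ) : ℝ) * δ) ω
            = (fun i => Nat.casesOn i e σ : ℕ → E) i} := fun e => by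
        ext ω
        simp only [Set.mem_ofPred_eq]
        constructor
        · rintro ⟨h1, h2⟩ i hi
          cases i with
          | zero => simpa using h1
          | succ i =>
            have := h2 i (by omega)
            rwa [add_right_comm, add_assoc] at this
        · intro h1
          refine ⟨by simpa using h1 0 (by omega), fun i hi => ?_⟩
          have := h1 (i + 1) (by omega)
          rwa [add_right_comm, add_assoc]
      have h2 : ∀ e, P.real {ω | X ((a : ℝ) * δ) ω = e ∧
          ω ∈ {ω | ∀ i ≤ k, X (((a + 1 + i : ℕ) : ℝ) * δ) ω = σ i}} = (Fintype.card E : ℝ)⁻¹ *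
          ((∏ i ∈ Finset.range k, NormedSpace.exp (δ • rateMatrix L) (σ i) (σ (i + 1))) *
            NormedSpace.exp (δ • rateMatrix L) e (σ 0)) := fun e => by
        rw [h1, ih, Finset.prod_range_succ']
        rfl
      rw [Finset.sum_congr rfl fun e _ => h2 e, ← Finset.mul_sum, ← Finset.mul_sum, hcol, mul_one]
    · have : {ω | ∀ i ≤ k, X (((a + 1 + i : ℕ) : ℝ) * δ) ω = σ i} =
          ⋂ i, ⋂ (_ : i ≤ k), {ω | X (((a + 1 + i : ℕ) : ℝ) * δ) ω = σ i} := by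
        ext; simp
      rw [this]
      exact MeasurableSet.iInter fun i => MeasurableSet.iInter fun _ => hm _ _

/-- The process sampled along the grid `δ ℕ`. -/
lemma IsMarkovProcess.isUniformChain (h : IsMarkovProcess L μ P X)
    (hμ : ∀ e, μ e = (Fintype.card E : ℝ)⁻¹) {δ : ℝ} (hδ : 0 ≤ δ)
    (hcol : ∀ e', ∑ e, NormedSpace.exp (δ • rateMatrix L) e e' = 1) (N : ℕ) :
    IsUniformChain P (fun i => X ((i : ℝ) * δ)) (NormedSpace.exp (δ • rateMatrix L)) N where
  measurableSet_eq i e := h.measurableSet_eq _ (by positivity) e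
  markov j _ σ e := by
    have h1 := h.real_window hμ hδ hcol 0 j σ
    have h2 := h.real_window hμ hδ hcol 0 (j + 1) (Function.update σ (j + 1) e)
    simp only [zero_add] at h1 h2
    have h3 : {ω | (∀ i ≤ j, X ((i : ℝ) * δ) ω = σ i) ∧ X (((j + 1 : ℕ) : ℝ) * δ) ω = e} =
        {ω | ∀ i ≤ j + 1, X ((i : ℝ) * δ) ω = Function.update σ (j + 1) e i} := by
      ext ω
      simp only [Set.mem_ofPred_eq]
      constructor
      · rintro ⟨h3, h4⟩ i hi
        rcases Nat.lt_or_ge i (j + 1) with h5 | h5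
        · rw [Function.update_of_ne (by omega)]
          exact h3 i (by omega)
        · obtain rfl : i = j + 1 := by omega
          simpa using h4
      · intro h3
        refine ⟨fun i hi => ?_, by simpa using h3 (j + 1) le_rfl⟩
        have := h3 i (by omega)
        rwa [Function.update_of_ne (by omega)] at this
    rw [h3, h1, h2, Finset.prod_range_succ, Function.update_self,
      Function.update_of_ne (by omega : j ≠ j + 1), mul_assoc]
    congr 2
    refine Finset.prod_congr rfl fun i hi => ?_
    have := Finset.mem_range.1 hi
    rw [Function.update_of_ne (by omega), Function.update_of_ne (by omega)]
  uniform j _ e := by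
    have h1 := h.real_window hμ hδ hcol j 0 (fun _ => e)
    simpa using h1

/-- The time reversal of the process sampled along the grid `δ ℕ`: the transition matrix is
transposed since the invariant measure is uniform. -/
lemma IsMarkovProcess.isUniformChain_reverse (h : IsMarkovProcess L μ P X)
    (hμ : ∀ e, μ e = (Fintype.card E : ℝ)⁻¹) {δ : ℝ} (hδ : 0 ≤ δ)
    (hcol : ∀ e', ∑ e, NormedSpace.exp (δ • rateMatrix L) e e' = 1) (N : ℕ) :
    IsUniformChain P (fun i => X (((N - i : ℕ) : ℝ) * δ))
      (NormedSpace.exp (δ • rateMatrix L)).transpose N where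
  measurableSet_eq i e := h.measurableSet_eq _ (by positivity) e
  markov j hj σ e := by
    have h1 := h.real_window hμ hδ hcol (N - j) j fun i => σ (j - i)
    have h2 := h.real_window hμ hδ hcol (N - (j + 1)) (j + 1)
      fun i => Nat.casesOn i e fun i => σ (j - i)
    have h3 : {ω | ∀ i ≤ j, X (((N - i : ℕ) : ℝ) * δ) ω = σ i} =
        {ω | ∀ i ≤ j, X (((N - j + i : ℕ) : ℝ) * δ) ω = σ (j - i)} := by
      ext ω
      simp only [Set.mem_ofPred_eq]
      constructor
      · intro h3 i hi
        have := h3 (j - i) (by omega)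
        rwa [show N - (j - i) = N - j + i by omega] at this
      · intro h3 i hi
        have := h3 (j - i) (by omega)
        rwa [show N - j + (j - i) = N - i by omega, show j - (j - i) = i by omega] at this
    have h4 : {ω | (∀ i ≤ j, X (((N - i : ℕ) : ℝ) * δ) ω = σ i) ∧
          X (((N - (j + 1) : ℕ) : ℝ) * δ) ω = e} =
        {ω | ∀ i ≤ j + 1, X (((N - (j + 1) + i : ℕ) : ℝ) * δ) ω =
          (fun i => Nat.casesOn i e fun i => σ (j - i) : ℕ → E) i} := by
      ext ω
      simp only [Set.mem_ofPred_eq]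
      constructor
      · rintro ⟨h3, h4⟩ i hi
        cases i with
        | zero => simpa using h4
        | succ i =>
          have := h3 (j - i) (by omega)
          rwa [show N - (j - i) = N - (j + 1) + (i + 1) by omega] at this
      · intro h3
        refine ⟨fun i hi => ?_, by simpa using h3 0 (by omega)⟩
        have := h3 (j - i + 1) (by omega)
        rw [show N - (j + 1) + (j - i + 1) = N - i by omega] at this
        simpa [show j - (j - i) = i by omega] using this
    rw [h3, h4, h1, h2, Finset.prod_range_succ', mul_assoc]
    simp [Matrix.transpose_apply]
  uniform j _ e := by
    have h1 := h.real_window hμ hδ hcol (N - j) 0 (fun _ => e)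
    simpa using h1

end ChainOnFiniteSet

/-! ### The Kipnis–Varadhan inequality -/

section KipnisVaradhan

variable {E : Type*}

/-- A function whose `H_{-1}` norm for the symmetric part of `-Q` is finite lies in the range of
that symmetric part, and its preimage has energy at most the square of the norm. -/
lemma exists_poisson_solution [Fintype E] (Q : Matrix E E ℝ) (F : E → ℝ) {κ : ℝ}
    (hF : ∀ f : E → ℝ, 2 * ∑ e, F e * f e ≤ κ - ∑ e, f e * Q.mulVec f e) :
    ∃ g : E → ℝ, (∀ e, -(Q.mulVec g e + Q.transpose.mulVec g e) = 2 * F e) ∧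
      -∑ e, g e * Q.mulVec g e ≤ κ := by
  classical
  have htr : ∀ f : E → ℝ, ∑ e, f e * Q.transpose.mulVec f e = ∑ e, f e * Q.mulVec f e := by
    intro f
    have h : f ⬝ᵥ Q.transpose.mulVec f = f ⬝ᵥ Q.mulVec f := by
      rw [Matrix.mulVec_transpose, dotProduct_comm, ← Matrix.dotProduct_mulVec]
    exact h
  set S : Matrix E E ℝ := Q + Q.transpose with hS
  have hsymm : S.IsHermitian := by
    rw [Matrix.IsHermitian, Matrix.conjTranspose_eq_transpose_of_trivial, hS,
      Matrix.transpose_add, Matrix.transpose_transpose, add_comm]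
  have hsymm' := Matrix.isSymmetric_toEuclideanLin_iff.2 hsymm
  have hmem : (WithLp.toLp 2 F : EuclideanSpace ℝ E) ∈ (Matrix.toEuclideanLin S).range := by
    -- the range of a symmetric matrix is the orthogonal complement of its kernel, and a linear form
    -- that is bounded above on the kernel vanishes there
    rw [← Submodule.orthogonal_orthogonal (Matrix.toEuclideanLin S).range, hsymm'.orthogonal_range,
      Submodule.mem_orthogonal']
    intro v hv
    rw [LinearMap.mem_ker] at hv
    have hv' : S.mulVec v.ofLp = 0 := by
      have := congrArg WithLp.ofLp hv
      simpa [Matrix.toLpLin_apply] using this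
    have hq : ∑ e, v.ofLp e * Q.mulVec v.ofLp e = 0 := by
      have h1 : ∑ e, v.ofLp e * S.mulVec v.ofLp e = 0 := by simp [hv']
      have h2 := htr v.ofLp
      simp only [hS, Matrix.add_mulVec, Pi.add_apply, mul_add, Finset.sum_add_distrib] at h1
      linarith
    have h3 : ∀ s : ℝ, s * (2 * ∑ e, F e * v.ofLp e) ≤ κ := fun s => by
      have h4 := hF (s • v.ofLp)
      simp only [Matrix.mulVec_smul, Pi.smul_apply, smul_eq_mul] at h4
      have h5 : ∑ e, s * v.ofLp e * (s * Q.mulVec v.ofLp e) = 0 := by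
        rw [← mul_zero (s * s), ← hq, Finset.mul_sum]
        exact Finset.sum_congr rfl fun e _ => by ring
      have h6 : ∑ e, F e * (s * v.ofLp e) = s * ∑ e, F e * v.ofLp e := by
        rw [Finset.mul_sum]
        exact Finset.sum_congr rfl fun e _ => by ring
      rw [h5, h6] at h4
      linarith
    have h7 : ∑ e, F e * v.ofLp e = 0 := by
      by_contra hne
      have := h3 ((κ + 1) / (2 * ∑ e, F e * v.ofLp e))
      rw [div_mul_cancel₀ _ (by simpa using hne)] at this
      linarith
    rw [PiLp.inner_apply]
    simpa [mul_comm] using h7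
  obtain ⟨w, hw⟩ := hmem
  have hw' : S.mulVec w.ofLp = F := by
    have := congrArg WithLp.ofLp hw
    simpa [Matrix.toLpLin_apply] using this
  have hg : ∀ e, -(Q.mulVec ((-2 : ℝ) • w.ofLp) e + Q.transpose.mulVec ((-2 : ℝ) • w.ofLp) e)
      = 2 * F e := fun e => by
    have := congr_fun hw' e
    simp only [hS, Matrix.add_mulVec, Pi.add_apply] at this
    simp only [Matrix.mulVec_smul, Pi.smul_apply, smul_eq_mul]
    linarith
  refine ⟨(-2 : ℝ) • w.ofLp, hg, ?_⟩
  set g := (-2 : ℝ) • w.ofLp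
  have h1 := hF g
  have h2 : 2 * ∑ e, F e * g e = -(2 * ∑ e, g e * Q.mulVec g e) := by
    have h3 : 2 * ∑ e, F e * g e =
        -(∑ e, g e * Q.mulVec g e + ∑ e, g e * Q.transpose.mulVec g e) := by
      rw [← Finset.sum_add_distrib, Finset.mul_sum, ← Finset.sum_neg_distrib]
      refine Finset.sum_congr rfl fun e _ => ?_
      rw [← mul_assoc, ← hg e]
      ring
    rw [h3, htr]
    ring
  linarith

variable {Ω : Type*} [MeasurableSpace Ω]

/-- Discretization: if the time integrals are pathwise limits of quantities dominated by `G N`,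
bounds for the expectations of `G N` pass to the limit. -/
lemma supSqTimeIntegral_le_of_tendsto {P : Measure Ω} {X : ℝ → Ω → E} {T : ℝ} {F : E → ℝ}
    (a : ℕ → ℝ → Ω → ℝ) (G : ℕ → Ω → ℝ) (v : ℕ → ℝ) {V : ℝ}
    (ha : ∀ ω, ∀ t ∈ Set.Icc 0 T,
      Tendsto (fun N => a N t ω) atTop (𝓝 (∫ s in (0 : ℝ)..t, F (X s ω))))
    (haG : ∀ᶠ N in atTop, ∀ ω, ∀ t ∈ Set.Icc 0 T, a N t ω ^ 2 ≤ G N ω)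
    (hGm : ∀ N, Measurable (G N)) (hGi : ∀ N, Integrable (G N) P) (hG0 : ∀ N ω, 0 ≤ G N ω)
    (hGv : ∀ᶠ N in atTop, ∫ ω, G N ω ∂P ≤ v N) (hv : Tendsto v atTop (𝓝 V)) :
    supSqTimeIntegral P X T F ≤ ENNReal.ofReal V := by
  calc supSqTimeIntegral P X T F
      ≤ ∫⁻ ω, liminf (fun N => ENNReal.ofReal (G N ω)) atTop ∂P := by
        refine lintegral_mono fun ω => iSup₂_le fun t ht => ?_
        have h1 : Tendsto (fun N => ENNReal.ofReal (a N t ω ^ 2)) atTop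
            (𝓝 (ENNReal.ofReal ((∫ s in (0 : ℝ)..t, F (X s ω)) ^ 2))) :=
          ENNReal.tendsto_ofReal ((ha ω t ht).pow 2)
        rw [← h1.liminf_eq]
        exact liminf_le_liminf (haG.mono fun N h => ENNReal.ofReal_le_ofReal (h ω t ht))
    _ ≤ liminf (fun N => ∫⁻ ω, ENNReal.ofReal (G N ω) ∂P) atTop :=
        lintegral_liminf_le fun N => (hGm N).ennreal_ofReal
    _ ≤ liminf (fun N => ENNReal.ofReal (v N)) atTop := by
        refine liminf_le_liminf (hGv.mono fun N h => ?_)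
        rw [← ofReal_integral_eq_lintegral_ofReal (hGi N) (ae_of_all _ (hG0 N))]
        exact ENNReal.ofReal_le_ofReal h
    _ = ENNReal.ofReal V := (ENNReal.tendsto_ofReal hv).liminf_eq

variable [Fintype E] [DecidableEq E] {L : (E → ℝ) → E → ℝ} {μ : E → ℝ} {P : Measure Ω}
  {X : ℝ → Ω → E}

lemma sum_exp_smul_eq_one {Q : Matrix E E ℝ} (hcol : ∀ e', ∑ e, Q e e' = 0) (δ : ℝ) (e' : E) :
    ∑ e, NormedSpace.exp (δ • Q) e e' = 1 := by
  have h1 : (δ • Q).transpose.mulVec (fun _ => (1 : ℝ)) = 0 := by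
    ext e
    simp [Matrix.mulVec, dotProduct, ← Finset.mul_sum, hcol]
  have h2 := congr_fun (exp_mulVec_eq_self h1) e'
  rw [Matrix.exp_transpose] at h2
  simpa [Matrix.mulVec, dotProduct] using h2

/-- **Kipnis–Varadhan inequality** for a stationary Markov process on a finite state space with
uniform invariant measure (`hcol`). The function `F` is controlled through its squared `H_{-1}` norm,
which `hF` bounds by `K` in its variational form, and the perturbation `F'` through its `L²` norm. -/
theorem IsMarkovProcess.supSqTimeIntegral_le (h : IsMarkovProcess L μ P X)
    (hμ : ∀ e, μ e = (Fintype.card E : ℝ)⁻¹)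
    (hcol : ∀ e', ∑ e, rateMatrix L e e' = 0) {T : ℝ} (hT : 0 < T) (F F' : E → ℝ) {K K' : ℝ}
    (hF : ∀ f : E → ℝ, 2 * ∑ e, F e * f e ≤
      Fintype.card E * K - ∑ e, f e * (rateMatrix L).mulVec f e)
    (hF' : ∑ e, F' e ^ 2 ≤ Fintype.card E * K') :
    supSqTimeIntegral P X T (fun e => F e + F' e) ≤
      ENNReal.ofReal (40 * T * K + 2 * T ^ 2 * K') := by
  have hP := h.isProbabilityMeasure
  set Q := rateMatrix L with hQ
  have hne : Nonempty E := by
    by_contra hE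
    rw [not_nonempty_iff] at hE
    have : IsEmpty Ω := ⟨fun ω => hE.elim (X 0 ω)⟩
    exact IsProbabilityMeasure.ne_zero P (Measure.eq_zero_of_isEmpty P)
  have hc : 0 < (Fintype.card E : ℝ) := by exact_mod_cast Fintype.card_pos
  obtain ⟨g, hg, hgK⟩ := exists_poisson_solution Q F hF
  -- step of the time grid, transition matrix, and the two sampled chains
  set δ : ℕ → ℝ := fun N => T / N with hδ
  have hδ0 : ∀ N, 0 ≤ δ N := fun N => by positivity
  have hδpos : ∀ᶠ N in atTop, 0 < δ N := by
    filter_upwards [eventually_gt_atTop 0] with N hN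
    exact div_pos hT (by exact_mod_cast hN)
  have hδlim : Tendsto δ atTop (𝓝 0) := tendsto_const_div_atTop_nhds_zero_nat T
  set R : ℕ → Matrix E E ℝ := fun N => NormedSpace.exp (δ N • Q) with hR
  have hfw : ∀ N, IsUniformChain P (fun i => X ((i : ℝ) * δ N)) (R N) N := fun N =>
    h.isUniformChain hμ (hδ0 N) (sum_exp_smul_eq_one hcol _) N
  have hbw : ∀ N, IsUniformChain P (fun i => X (((N - i : ℕ) : ℝ) * δ N)) (R N).transpose N :=
    fun N => h.isUniformChain_reverse hμ (hδ0 N) (sum_exp_smul_eq_one hcol _) N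
  set MF : ℕ → Ω → ℕ → ℝ := fun N => chainMart (fun i => X ((i : ℝ) * δ N)) (R N) g with hMF
  set MB : ℕ → Ω → ℕ → ℝ :=
    fun N => chainMart (fun i => X (((N - i : ℕ) : ℝ) * δ N)) (R N).transpose g with hMB
  -- difference quotients of the two semigroups
  set ψ : ℕ → E → ℝ := fun N e => (δ N)⁻¹ * (g e - (R N).mulVec g e) with hψ
  set ψ' : ℕ → E → ℝ := fun N e => (δ N)⁻¹ * (g e - (R N).transpose.mulVec g e) with hψ'
  have hψlim : ∀ e, Tendsto (fun N => ψ N e) atTop (𝓝 (-Q.mulVec g e)) := fun e =>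
    tendsto_exp_smul_slope Q g e hT
  have hψ'lim : ∀ e, Tendsto (fun N => ψ' N e) atTop (𝓝 (-Q.transpose.mulVec g e)) := fun e => by
    have := tendsto_exp_smul_slope Q.transpose g e hT
    simpa only [hψ', hR, ← Matrix.transpose_smul, Matrix.exp_transpose] using this
  set k : ℕ → ℝ → ℕ := fun N t => ⌊t / δ N⌋₊ with hk
  have hkN : ∀ᶠ N in atTop, ∀ t ∈ Set.Icc 0 T, k N t ≤ N := by
    filter_upwards [eventually_gt_atTop 0] with N hN t ht
    refine Nat.floor_le_of_le ?_
    have hN' : (0 : ℝ) < N := by exact_mod_cast hN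
    rw [div_le_iff₀ (div_pos hT hN'), mul_div_cancel₀ _ hN'.ne']
    exact ht.2
  have hNδ : ∀ᶠ N : ℕ in atTop, (N : ℝ) * δ N = T := by
    filter_upwards [eventually_gt_atTop 0] with N hN
    have hN' : (0 : ℝ) < N := by exact_mod_cast hN
    exact mul_div_cancel₀ _ hN'.ne'
  -- discrete approximation of the time integral of `F'`
  set S' : ℕ → ℝ → Ω → ℝ := fun N t ω =>
    δ N * ∑ j ∈ Finset.range (k N t), F' (X (((j : ℝ) + 1) * δ N) ω) with hS'
  have hriem : ∀ (φ : E → ℝ) (ω : Ω), ∀ t, 0 ≤ t → Tendsto (fun N =>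
      δ N * ∑ j ∈ Finset.range (k N t), φ (X (((j : ℝ) + 1) * δ N) ω)) atTop
      (𝓝 (∫ s in (0 : ℝ)..t, φ (X s ω))) := fun φ ω t ht =>
    tendsto_riemannSum (y := fun s => φ (X s ω)) (C := ∑ e, |φ e|)
      (fun s => Finset.single_le_sum (f := fun e => |φ e|) (fun _ _ => abs_nonneg _)
        (Finset.mem_univ (X s ω)))
      (fun t ht => (h.right_continuous ω t ht).mono fun s hs => by simp only [hs]) hT ht
  have hint : ∀ (φ : E → ℝ) (ω : Ω), ∀ t, 0 ≤ t →
      IntervalIntegrable (fun s => φ (X s ω)) volume 0 t := fun φ ω t ht =>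
    intervalIntegrable_of_rightContinuous (C := ∑ e, |φ e|)
      (fun s => Finset.single_le_sum (f := fun e => |φ e|) (fun _ _ => abs_nonneg _)
        (Finset.mem_univ (X s ω)))
      (fun t ht => (h.right_continuous ω t ht).mono fun s hs => by simp only [hs]) ht
  -- The time reversal of `[0, t]` is the last part of the reversed chain, whence the difference of
  -- two values of `MB`. By `hDsum` and the Poisson equation, `D` approximates the integral of `F`.
  set D : ℕ → ℝ → Ω → ℝ := fun N t ω =>
    (MF N ω (k N t) + (MB N ω N - MB N ω (N - k N t))) / 2 with hD
  -- the sum of the forward and the backward increments only involves the semigroups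
  have hDsum : ∀ N ω l, l ≤ N → MF N ω l + (MB N ω N - MB N ω (N - l)) =
      ∑ j ∈ Finset.range l, ((g (X ((j : ℝ) * δ N) ω) - (R N).mulVec g (X ((j : ℝ) * δ N) ω)) +
        (g (X (((j : ℝ) + 1) * δ N) ω) -
          (R N).transpose.mulVec g (X (((j : ℝ) + 1) * δ N) ω))) := by
    intro N ω l hl
    induction l with
    | zero => simp [hMF, chainMart]
    | succ l ih =>
      rw [Finset.sum_range_succ, ← ih (by omega)]
      have h1 : MF N ω (l + 1) = MF N ω l +
          (g (X (((l : ℝ) + 1) * δ N) ω) - (R N).mulVec g (X ((l : ℝ) * δ N) ω)) := by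
        simp [hMF, chainMart, chainIncr, Finset.sum_range_succ]
        ring
      have h2 : MB N ω (N - l) = MB N ω (N - (l + 1)) +
          (g (X ((l : ℝ) * δ N) ω) - (R N).transpose.mulVec g (X (((l : ℝ) + 1) * δ N) ω)) := by
        have h3 : N - l = N - (l + 1) + 1 := by omega
        have h4 : N - (N - (l + 1) + 1) = l := by omega
        have h5 : N - (N - (l + 1)) = l + 1 := by omega
        rw [h3]
        simp [hMB, chainMart, chainIncr, Finset.sum_range_succ, h4, h5]
        ring
      rw [h1, h2]
      ring
  have hDlim : ∀ ω, ∀ t ∈ Set.Icc 0 T,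
      Tendsto (fun N => D N t ω) atTop (𝓝 (∫ s in (0 : ℝ)..t, F (X s ω))) := by
    intro ω t ht
    have h1 := hriem F ω t ht.1
    have h2 : Tendsto (fun N => T * (∑ e, |(ψ N e + ψ' N e) / 2 - F e|) + δ N * ∑ e, |ψ N e|) atTop
        (𝓝 (T * (∑ e, |(-Q.mulVec g e + -Q.transpose.mulVec g e) / 2 - F e|)
          + 0 * ∑ e, |-Q.mulVec g e|)) :=
      ((tendsto_finsetSum _ fun e _ =>
        ((((hψlim e).add (hψ'lim e)).div_const 2).sub_const _).abs).const_mul T).add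
        (hδlim.mul (tendsto_finsetSum _ fun e _ => (hψlim e).abs))
    have h3 : T * (∑ e, |(-Q.mulVec g e + -Q.transpose.mulVec g e) / 2 - F e|)
          + 0 * ∑ e, |-Q.mulVec g e| = 0 := by
      have : ∀ e, (-Q.mulVec g e + -Q.transpose.mulVec g e) / 2 - F e = 0 := fun e => by
        have := hg e
        linarith
      simp [this]
    rw [h3] at h2
    have h4 : Tendsto (fun N => D N t ω -
        δ N * ∑ j ∈ Finset.range (k N t), F (X (((j : ℝ) + 1) * δ N) ω)) atTop (𝓝 0) := by
      refine squeeze_zero_norm' ?_ h2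
      filter_upwards [hδpos, hkN, hNδ] with N hN hkN hNδ
      have hkt := hkN t ht
      have h5 : ∀ e, g e - (R N).mulVec g e = δ N * ψ N e := fun e => by
        simp only [hψ]; rw [mul_inv_cancel_left₀ hN.ne']
      have h6 : ∀ e, g e - (R N).transpose.mulVec g e = δ N * ψ' N e := fun e => by
        simp only [hψ']; rw [mul_inv_cancel_left₀ hN.ne']
      -- shift the forward sum by one grid step, at the cost of two boundary terms
      have h7 : ∑ j ∈ Finset.range (k N t), ψ N (X ((j : ℝ) * δ N) ω) =
          ∑ j ∈ Finset.range (k N t), ψ N (X (((j : ℝ) + 1) * δ N) ω) +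
            (ψ N (X 0 ω) - ψ N (X ((k N t : ℝ) * δ N) ω)) := by
        have := Finset.sum_range_succ' (fun j : ℕ => ψ N (X ((j : ℝ) * δ N) ω)) (k N t)
        rw [Finset.sum_range_succ] at this
        push_cast at this
        rw [zero_mul] at this
        linarith
      have h8 : D N t ω - δ N * ∑ j ∈ Finset.range (k N t), F (X (((j : ℝ) + 1) * δ N) ω) =
          δ N * ∑ j ∈ Finset.range (k N t), ((ψ N (X (((j : ℝ) + 1) * δ N) ω)
            + ψ' N (X (((j : ℝ) + 1) * δ N) ω)) / 2 - F (X (((j : ℝ) + 1) * δ N) ω))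
            + δ N * ((ψ N (X 0 ω) - ψ N (X ((k N t : ℝ) * δ N) ω)) / 2) := by
        simp only [hD]
        rw [hDsum N ω _ hkt]
        simp only [h5, h6, Finset.sum_add_distrib, Finset.sum_sub_distrib, ← Finset.mul_sum,
          ← Finset.sum_div]
        rw [h7]
        ring
      rw [h8, Real.norm_eq_abs]
      have hs : ∀ (φ : E → ℝ) (e : E), |φ e| ≤ ∑ e, |φ e| := fun φ e =>
        Finset.single_le_sum (f := fun e => |φ e|) (fun _ _ => abs_nonneg _) (Finset.mem_univ e)
      refine (abs_add_le _ _).trans (add_le_add ?_ ?_)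
      · rw [abs_mul, abs_of_pos hN]
        calc δ N * |∑ j ∈ Finset.range (k N t), ((ψ N (X (((j : ℝ) + 1) * δ N) ω)
            + ψ' N (X (((j : ℝ) + 1) * δ N) ω)) / 2 - F (X (((j : ℝ) + 1) * δ N) ω))|
            ≤ δ N * ∑ j ∈ Finset.range (k N t), ∑ e, |(ψ N e + ψ' N e) / 2 - F e| := by
              refine mul_le_mul_of_nonneg_left ((Finset.abs_sum_le_sum_abs _ _).trans
                (Finset.sum_le_sum fun j _ => ?_)) hN.le
              exact hs (fun e => (ψ N e + ψ' N e) / 2 - F e) _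
          _ = (k N t * δ N) * ∑ e, |(ψ N e + ψ' N e) / 2 - F e| := by
              rw [Finset.sum_const, Finset.card_range, nsmul_eq_mul]; ring
          _ ≤ T * ∑ e, |(ψ N e + ψ' N e) / 2 - F e| := by
              rw [← hNδ]
              gcongr
      · rw [abs_mul, abs_of_pos hN]
        refine mul_le_mul_of_nonneg_left ?_ hN.le
        have := hs (ψ N) (X 0 ω)
        have := hs (ψ N) (X ((k N t : ℝ) * δ N) ω)
        rw [abs_div, abs_two]
        have := abs_sub (ψ N (X 0 ω)) (ψ N (X ((k N t : ℝ) * δ N) ω))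
        linarith
    have := h4.add h1
    simpa using this
  -- bounds uniform in `t`: two running maxima for `D`, the Cauchy–Schwarz inequality for `S'`
  set GF : ℕ → Ω → ℝ := fun N ω => runMax (MF N ω) N ^ 2 with hGF
  set GB : ℕ → Ω → ℝ := fun N ω => runMax (MB N ω) N ^ 2 with hGB
  set G' : ℕ → Ω → ℝ := fun N ω =>
    T * (δ N * ∑ j ∈ Finset.range N, F' (X (((j + 1 : ℕ) : ℝ) * δ N) ω) ^ 2) with hG'
  have hGFc : ∀ (N : ℕ) (ω ω' : Ω), (∀ i ≤ N, X ((i : ℝ) * δ N) ω = X ((i : ℝ) * δ N) ω') →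
      GF N ω = GF N ω' := fun N ω ω' hh => by
    simp only [hGF]
    rw [runMax_congr fun j hj =>
      chainMart_congr (Y := fun i => X ((i : ℝ) * δ N)) (R N) g hh hj]
  have hGBc : ∀ (N : ℕ) (ω ω' : Ω), (∀ i ≤ N, X ((i : ℝ) * δ N) ω = X ((i : ℝ) * δ N) ω') →
      GB N ω = GB N ω' := fun N ω ω' hh => by
    simp only [hGB]
    rw [runMax_congr fun j hj =>
      chainMart_congr (Y := fun i => X (((N - i : ℕ) : ℝ) * δ N)) (R N).transpose g
        (fun i _ => hh (N - i) (by omega)) hj]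
  have hG'c : ∀ (N : ℕ) (ω ω' : Ω), (∀ i ≤ N, X ((i : ℝ) * δ N) ω = X ((i : ℝ) * δ N) ω') →
      G' N ω = G' N ω' := fun N ω ω' hh => by
    simp only [hG']
    congr 2
    refine Finset.sum_congr rfl fun j hj => ?_
    have := Finset.mem_range.1 hj
    rw [hh (j + 1) (by omega)]
  set V : ℕ → ℝ := fun N => (Fintype.card E : ℝ)⁻¹ * (T * (2 * ∑ e, g e * ψ N e)) with hV
  have hgen : ∀ N : ℕ, (N : ℝ) * δ N = T → 0 < δ N → ∀ A : Matrix E E ℝ,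
      ∑ e, g e * A.mulVec g e = ∑ e, g e * (R N).mulVec g e →
      (N : ℝ) * ((Fintype.card E : ℝ)⁻¹ * ∑ e, (g e ^ 2 - A.mulVec g e ^ 2)) ≤ V N := by
    intro N hN hpos A hA
    have h1 := sum_sq_sub_mulVec_sq_le A g
    have h2 : ∑ e, g e * (g e - A.mulVec g e) = δ N * ∑ e, g e * ψ N e := by
      have h3 : ∑ e, g e * (g e - A.mulVec g e) = ∑ e, g e * (g e - (R N).mulVec g e) := by
        simp only [mul_sub, Finset.sum_sub_distrib, hA]
      rw [h3, Finset.mul_sum]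
      refine Finset.sum_congr rfl fun e _ => ?_
      simp only [hψ]
      rw [mul_left_comm, mul_inv_cancel_left₀ hpos.ne']
    rw [h2] at h1
    calc (N : ℝ) * ((Fintype.card E : ℝ)⁻¹ * ∑ e, (g e ^ 2 - A.mulVec g e ^ 2))
        ≤ (N : ℝ) * ((Fintype.card E : ℝ)⁻¹ * (2 * (δ N * ∑ e, g e * ψ N e))) := by gcongr
      _ = V N := by simp only [hV]; rw [← hN]; ring
  have hEF : ∀ᶠ N in atTop, ∫ ω, GF N ω ∂P ≤ 4 * V N := by
    filter_upwards [hNδ, hδpos] with N hN hpos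
    refine ((hfw N).integral_runMax_sq_le g).trans ?_
    have := hgen N hN hpos (R N) rfl
    linarith
  have hEB : ∀ᶠ N in atTop, ∫ ω, GB N ω ∂P ≤ 4 * V N := by
    filter_upwards [hNδ, hδpos] with N hN hpos
    refine ((hbw N).integral_runMax_sq_le g).trans ?_
    have := hgen N hN hpos (R N).transpose (by
      have h : g ⬝ᵥ (R N).transpose.mulVec g = g ⬝ᵥ (R N).mulVec g := by
        rw [Matrix.mulVec_transpose, dotProduct_comm, ← Matrix.dotProduct_mulVec]
      exact h)
    linarith
  have hm : ∀ N : ℕ, ∀ i e, MeasurableSet {ω | X ((i : ℕ) * δ N) ω = e} := fun N =>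
    (hfw N).measurableSet_eq
  have iF : ∀ N, Integrable (GF N) P := fun N => integrable_of_path (hm N) N (hGFc N)
  have iB : ∀ N, Integrable (GB N) P := fun N => integrable_of_path (hm N) N (hGBc N)
  have i' : ∀ N, Integrable (G' N) P := fun N => integrable_of_path (hm N) N (hG'c N)
  have hE' : ∀ᶠ N in atTop, ∫ ω, G' N ω ∂P ≤ T ^ 2 * K' := by
    filter_upwards [hNδ] with N hN
    have h1 : ∀ j ∈ Finset.range N, ∫ ω, F' (X (((j + 1 : ℕ) : ℝ) * δ N) ω) ^ 2 ∂P ≤ K' := by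
      intro j hj
      have := Finset.mem_range.1 hj
      have h2 := (hfw N).integral_eq (j := j + 1) (by omega) fun e => F' e ^ 2
      rw [h2, inv_mul_le_iff₀ hc]
      exact hF'
    simp only [hG']
    rw [integral_const_mul, integral_const_mul, integral_finsetSum]
    · calc T * (δ N * ∑ j ∈ Finset.range N, ∫ ω, F' (X (((j + 1 : ℕ) : ℝ) * δ N) ω) ^ 2 ∂P)
          ≤ T * (δ N * ∑ j ∈ Finset.range N, K') := by
            have := hδ0 N
            gcongr with j hj
            exact h1 j hj
        _ = T * ((N * δ N) * K') := by
            rw [Finset.sum_const, Finset.card_range, nsmul_eq_mul]; ring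
        _ = T ^ 2 * K' := by rw [hN]; ring
    · intro j hj
      exact integrable_of_path (hm N) (j + 1) fun ω ω' hh => by rw [hh (j + 1) le_rfl]
  have hVlim : Tendsto V atTop
      (𝓝 ((Fintype.card E : ℝ)⁻¹ * (T * (2 * ∑ e, g e * (-Q.mulVec g e))))) :=
    ((((tendsto_finsetSum _ fun e _ => (hψlim e).const_mul (g e)).const_mul 2).const_mul
      T).const_mul _)
  refine (supSqTimeIntegral_le_of_tendsto (fun N t ω => D N t ω + S' N t ω)
    (fun N ω => GF N ω + 4 * GB N ω + 2 * G' N ω) (fun N => 20 * V N + 2 * (T ^ 2 * K'))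
    ?_ ?_ ?_ ?_ ?_ ?_ ((hVlim.const_mul 20).add_const _)).trans (ENNReal.ofReal_le_ofReal ?_)
  · intro ω t ht
    rw [intervalIntegral.integral_add (hint F ω t ht.1) (hint F' ω t ht.1)]
    exact (hDlim ω t ht).add (hriem F' ω t ht.1)
  · filter_upwards [hkN, hNδ, hδpos] with N hkN hN hpos ω t ht
    have hkt := hkN t ht
    have h1 : D N t ω ^ 2 ≤ (GF N ω + 4 * GB N ω) / 2 := by
      have a1 := abs_le_runMax (MF N ω) hkt
      have a2 := abs_le_runMax (MB N ω) (le_refl N)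
      have a3 := abs_le_runMax (MB N ω) (Nat.sub_le N (k N t))
      have a4 : |D N t ω| ≤ (runMax (MF N ω) N + 2 * runMax (MB N ω) N) / 2 := by
        simp only [hD]
        rw [abs_div, abs_two]
        have := abs_add_le (MF N ω (k N t)) (MB N ω N - MB N ω (N - k N t))
        have := abs_sub (MB N ω N) (MB N ω (N - k N t))
        linarith
      rw [← sq_abs]
      refine (pow_le_pow_left₀ (abs_nonneg _) a4 2).trans ?_
      simp only [hGF, hGB]
      nlinarith [sq_nonneg (runMax (MF N ω) N - 2 * runMax (MB N ω) N)]
    have h2 : S' N t ω ^ 2 ≤ G' N ω := by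
      have b1 := sq_sum_le_card_mul_sum_sq (s := Finset.range (k N t))
        (f := fun j : ℕ => F' (X (((j : ℝ) + 1) * δ N) ω))
      have b2 : ∑ j ∈ Finset.range (k N t), F' (X (((j : ℝ) + 1) * δ N) ω) ^ 2 ≤
          ∑ j ∈ Finset.range N, F' (X (((j : ℝ) + 1) * δ N) ω) ^ 2 :=
        Finset.sum_le_sum_of_subset_of_nonneg (Finset.range_mono hkt)
          fun _ _ _ => sq_nonneg _
      have b3 : (k N t : ℝ) ≤ N := by exact_mod_cast hkt
      rw [Finset.card_range] at b1
      simp only [hS', hG']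
      push_cast
      rw [mul_pow]
      calc δ N ^ 2 * (∑ j ∈ Finset.range (k N t), F' (X (((j : ℝ) + 1) * δ N) ω)) ^ 2
          ≤ δ N ^ 2 * (N * ∑ j ∈ Finset.range N, F' (X (((j : ℝ) + 1) * δ N) ω) ^ 2) := by
            gcongr
            exact b1.trans (mul_le_mul b3 b2 (Finset.sum_nonneg fun _ _ => sq_nonneg _)
              (Nat.cast_nonneg _))
        _ = T * (δ N * ∑ j ∈ Finset.range N, F' (X (((j : ℝ) + 1) * δ N) ω) ^ 2) := by
            rw [← hN]; ring
    nlinarith [sq_nonneg (D N t ω - S' N t ω)]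
  · intro N
    exact measurable_of_path (hm N) N fun ω ω' hh => by
      rw [hGFc N ω ω' hh, hGBc N ω ω' hh, hG'c N ω ω' hh]
  · intro N
    exact integrable_of_path (hm N) N fun ω ω' hh => by
      rw [hGFc N ω ω' hh, hGBc N ω ω' hh, hG'c N ω ω' hh]
  · intro N ω
    have := hδ0 N
    simp only [hGF, hGB, hG']
    positivity
  · filter_upwards [hEF, hEB, hE'] with N h1 h2 h3
    have i4 : Integrable (fun ω => 4 * GB N ω) P := (iB N).const_mul 4
    have i5 : Integrable (fun ω => GF N ω + 4 * GB N ω) P := (iF N).add i4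
    rw [integral_add i5 ((i' N).const_mul 2), integral_add (iF N) i4,
      integral_const_mul, integral_const_mul]
    linarith
  · have h1 : (Fintype.card E : ℝ)⁻¹ * (-∑ e, g e * Q.mulVec g e) ≤ K := by
      rw [inv_mul_le_iff₀ hc]
      exact hgK
    have h2 : (Fintype.card E : ℝ)⁻¹ * (T * (2 * ∑ e, g e * (-Q.mulVec g e))) =
        2 * T * ((Fintype.card E : ℝ)⁻¹ * (-∑ e, g e * Q.mulVec g e)) := by
      simp only [mul_neg, Finset.sum_neg_distrib]
      ring
    rw [h2]
    have := mul_le_mul_of_nonneg_left h1 hT.le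
    nlinarith

end KipnisVaradhan

/-! ### Generators of jump processes -/

section JumpGenerator

variable {E ι : Type*} [Fintype E] [Fintype ι]

lemma rateMatrix_mulVec [DecidableEq E] {L : (E → ℝ) → E → ℝ} {c : ι → E → ℝ} {τ : ι → E → E}
    (hL : ∀ f e, L f e = ∑ i, c i e * (f (τ i e) - f e)) (f : E → ℝ) (e : E) :
    (rateMatrix L).mulVec f e = L f e := by
  simp only [Matrix.mulVec, dotProduct, rateMatrix, Matrix.of_apply, hL, Finset.sum_mul]
  rw [Finset.sum_comm]
  refine Finset.sum_congr rfl fun i _ => ?_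
  simp only [mul_assoc]
  rw [← Finset.mul_sum]
  simp [sub_mul, Finset.sum_sub_distrib, Pi.single_apply]

/-- The Dirichlet form in terms of the carré du champ, when the uniform measure is invariant. -/
lemma neg_sum_mul_generator {L : (E → ℝ) → E → ℝ} {c : ι → E → ℝ} {τ : ι → E → E}
    (hL : ∀ f e, L f e = ∑ i, c i e * (f (τ i e) - f e)) (hinv : ∀ f, ∑ e, L f e = 0) (f : E → ℝ) :
    -∑ e, f e * L f e = 1 / 2 * ∑ e, ∑ i, c i e * (f (τ i e) - f e) ^ 2 := by
  have h := hinv fun e => f e ^ 2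
  have h1 : ∑ e, ∑ i, c i e * (f (τ i e) - f e) ^ 2 =
      ∑ e, L (fun e => f e ^ 2) e - 2 * ∑ e, f e * L f e := by
    rw [Finset.mul_sum, ← Finset.sum_sub_distrib]
    refine Finset.sum_congr rfl fun e _ => ?_
    rw [hL, hL, Finset.mul_sum, Finset.mul_sum, ← Finset.sum_sub_distrib]
    exact Finset.sum_congr rfl fun i _ => by ring
  rw [h1, h]
  ring

end JumpGenerator

/-! ### Invariance of the uniform measure under the exclusion dynamics -/

lemma symRate_nonneg (α : ℝ) (z : ℤ) : 0 ≤ symRate α z := by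
  unfold symRate; split_ifs <;> positivity

lemma asymRate_nonneg (γ : ℝ) (z : ℤ) : 0 ≤ asymRate γ z := by
  unfold asymRate; split_ifs <;> positivity

lemma summable_asymRate {γ : ℝ} (hγ : 0 < γ) : Summable (asymRate γ) := by
  refine Summable.of_nonneg_of_le (asymRate_nonneg γ) (fun z => ?_)
    (Real.summable_abs_int_rpow (b := 1 + γ) (by linarith))
  unfold asymRate
  rw [neg_add']
  split_ifs
  · exact le_rfl
  · positivity

lemma occ_mem {n : ℕ} (η : Config n) (x : sites n) : 0 ≤ occ η x ∧ occ η x ≤ 1 := by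
  unfold occ
  have : (η x : ℕ) ≤ 1 := by omega
  exact ⟨by positivity, by exact_mod_cast this⟩

lemma occ_flip {n : ℕ} (η : Config n) (x : sites n) : occ (flip η x) x = 1 - occ η x := by
  unfold occ flip
  rw [Function.update_self]
  rcases Fin.exists_fin_two.1 ⟨η x, rfl⟩ with h | h <;> rw [h] <;> norm_num

lemma occ_flip_of_ne {n : ℕ} (η : Config n) {x z : sites n} (h : z ≠ x) :
    occ (flip η x) z = occ η z := by
  unfold occ flip
  rw [Function.update_of_ne h]

lemma occ_exchange {n : ℕ} (η : Config n) (x y z : sites n) :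
    occ (exchange η x y) z = occ η (Equiv.swap x y z) := rfl

lemma flip_involutive {n : ℕ} (x : sites n) : Function.Involutive fun η : Config n => flip η x := by
  intro η
  ext z
  by_cases h : z = x
  · subst h
    simp only [flip, Function.update_self]
    rw [sub_sub_cancel]
  · simp [flip, Function.update_of_ne h]

lemma exchange_involutive {n : ℕ} (x y : sites n) :
    Function.Involutive fun η : Config n => exchange η x y := by
  intro η
  ext z
  simp [exchange]

lemma sum_comp_flip {n : ℕ} (x : sites n) (f : Config n → ℝ) : ∑ η, f (flip η x) = ∑ η, f η :=
  Equiv.sum_comp (flip_involutive x).toPerm f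

lemma sum_comp_exchange {n : ℕ} (x y : sites n) (f : Config n → ℝ) :
    ∑ η, f (exchange η x y) = ∑ η, f η :=
  Equiv.sum_comp (exchange_involutive x y).toPerm f

/-- Total rate at which the reservoirs act on the site `x`, for the symmetric dynamics. -/
def outRate (α : ℝ) (n : ℕ) (x : sites n) : ℝ := ∑' y : {y : ℤ // y ∉ sites n}, symRate α (x - y)

/-- Total injection rate of the left reservoir at the site `x`. -/
def leftRate (γ : ℝ) (n : ℕ) (x : sites n) : ℝ := ∑' y : {y : ℤ // y ≤ 0}, asymRate γ (x - y)

/-- Total extraction rate of the right reservoir at the site `x`. -/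
def rightRate (γ : ℝ) (n : ℕ) (x : sites n) : ℝ :=
  ∑' y : {y : ℤ // (n : ℤ) ≤ y}, asymRate γ (y - x)

/-- The jump rates of the process: exchanges of `x, y` for `Sum.inl (x, y)` and flips at `x` for
`Sum.inr x`. -/
def jumpRate (α θ γ : ℝ) (n : ℕ) : (sites n × sites n) ⊕ sites n → Config n → ℝ
  | Sum.inl p, η => (n : ℝ) ^ 2 * symRate α (p.1 - p.2) +
      (n : ℝ) ^ θ * (asymRate γ (p.2 - p.1) * occ η p.1 * (1 - occ η p.2))
  | Sum.inr x, η => (n : ℝ) ^ 2 * (1 / 2 * outRate α n x) +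
      (n : ℝ) ^ θ * (1 / 2 * (leftRate γ n x * (1 - occ η x) + rightRate γ n x * occ η x))

/-- The jumps of the process, indexed as in `jumpRate`. -/
def jumpMap (n : ℕ) : (sites n × sites n) ⊕ sites n → Config n → Config n
  | Sum.inl p, η => exchange η p.1 p.2
  | Sum.inr x, η => flip η x

lemma gen_eq_sum_jump (α θ γ : ℝ) (n : ℕ) (f : Config n → ℝ) (η : Config n) :
    gen α θ γ n f η = ∑ i, jumpRate α θ γ n i η * (f (jumpMap n i η) - f η) := by
  simp only [Fintype.sum_sum_type, Fintype.sum_prod_type, jumpRate, jumpMap, gen, genSym, genAsym,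
    tsum_mul_right, add_mul, Finset.sum_add_distrib, outRate, leftRate, rightRate]
  simp only [mul_add, Finset.mul_sum, add_mul, Finset.sum_add_distrib, mul_assoc]
  ring

lemma jumpRate_nonneg (α θ γ : ℝ) (n : ℕ) (i : (sites n × sites n) ⊕ sites n) (η : Config n) :
    0 ≤ jumpRate α θ γ n i η := by
  rcases i with ⟨x, y⟩ | x
  · have h1 := occ_mem η x
    have h2 := occ_mem η y
    have := symRate_nonneg α (x - y)
    have := asymRate_nonneg γ (y - x)
    have : 0 ≤ 1 - occ η y := by linarith
    have := h1.1
    simp only [jumpRate]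
    positivity
  · have h1 := occ_mem η x
    have : 0 ≤ 1 - occ η x := by linarith
    have := h1.1
    have : 0 ≤ outRate α n x := tsum_nonneg fun y => symRate_nonneg _ _
    have : 0 ≤ leftRate γ n x := tsum_nonneg fun y => asymRate_nonneg _ _
    have : 0 ≤ rightRate γ n x := tsum_nonneg fun y => asymRate_nonneg _ _
    simp only [jumpRate]
    positivity

lemma sum_asymRate_add_leftRate {γ : ℝ} (hγ : 0 < γ) {n : ℕ} (x : sites n) :
    ∑ y : sites n, asymRate γ (x - y) + leftRate γ n x = ∑' z, asymRate γ z := by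
  have hs : Summable fun y : ℤ => asymRate γ (x - y) :=
    (summable_asymRate hγ).comp_injective (Equiv.subLeft (x : ℤ)).injective
  have h0 : ∑' y : ℤ, asymRate γ (x - y) = ∑' z, asymRate γ z :=
    (Equiv.subLeft (x : ℤ)).tsum_eq (asymRate γ)
  have h1 : ∑ y : sites n, asymRate γ (x - y) =
      ∑' y : ℤ, (↑(sites n) : Set ℤ).indicator (fun y => asymRate γ (x - y)) y := by
    rw [Finset.sum_coe_sort (sites n) fun y => asymRate γ (x - y), sum_eq_tsum_indicator]
  have h2 : leftRate γ n x = ∑' y : ℤ, {y : ℤ | y ≤ 0}.indicator (fun y => asymRate γ (x - y)) y :=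
    tsum_subtype {y : ℤ | y ≤ 0} fun y => asymRate γ (x - y)
  rw [h1, h2, ← Summable.tsum_add (hs.indicator _) (hs.indicator _), ← h0]
  refine tsum_congr fun y => ?_
  have hx := x.2
  simp only [sites, Finset.mem_Ioo] at hx
  by_cases h3 : y ≤ 0
  · simp [sites, h3]
  · by_cases h4 : y < n
    · simp [sites, h3, h4, not_le.1 h3]
    · simp [sites, h3, h4, asymRate]
      intro h5; omega

lemma sum_asymRate_add_rightRate {γ : ℝ} (hγ : 0 < γ) {n : ℕ} (x : sites n) :
    ∑ y : sites n, asymRate γ (y - x) + rightRate γ n x = ∑' z, asymRate γ z := by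
  have hs : Summable fun y : ℤ => asymRate γ (y - x) :=
    (summable_asymRate hγ).comp_injective (Equiv.subRight (x : ℤ)).injective
  have h0 : ∑' y : ℤ, asymRate γ (y - x) = ∑' z, asymRate γ z :=
    (Equiv.subRight (x : ℤ)).tsum_eq (asymRate γ)
  have h1 : ∑ y : sites n, asymRate γ (y - x) =
      ∑' y : ℤ, (↑(sites n) : Set ℤ).indicator (fun y => asymRate γ (y - x)) y := by
    rw [Finset.sum_coe_sort (sites n) fun y => asymRate γ (y - x), sum_eq_tsum_indicator]
  have h2 : rightRate γ n x =
      ∑' y : ℤ, {y : ℤ | (n : ℤ) ≤ y}.indicator (fun y => asymRate γ (y - x)) y :=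
    tsum_subtype {y : ℤ | (n : ℤ) ≤ y} fun y => asymRate γ (y - x)
  rw [h1, h2, ← Summable.tsum_add (hs.indicator _) (hs.indicator _), ← h0]
  refine tsum_congr fun y => ?_
  have hx := x.2
  simp only [sites, Finset.mem_Ioo] at hx
  by_cases h3 : (n : ℤ) ≤ y
  · simp [sites, h3]
  · by_cases h4 : 0 < y
    · simp [sites, h3, h4, not_le.1 h3]
    · simp [sites, h3, h4, asymRate]
      intro h5; omega

lemma sum_occ_mul_exchange {n : ℕ} (x y : sites n) (f : Config n → ℝ) :
    ∑ η, occ η x * (1 - occ η y) * (f (exchange η x y) - f η) =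
      ∑ η, (cocc η y - cocc η x) * f η := by
  have h := sum_comp_exchange x y fun η => occ η y * (1 - occ η x) * f η
  simp only [occ_exchange, Equiv.swap_apply_left, Equiv.swap_apply_right] at h
  simp only [mul_sub (_ * _), Finset.sum_sub_distrib] at h ⊢
  rw [h, ← Finset.sum_sub_distrib]
  exact Finset.sum_congr rfl fun η _ => by simp only [cocc]; ring

lemma sum_occ_mul_flip {n : ℕ} (x : sites n) (f : Config n → ℝ) (a b : ℝ) :
    ∑ η, (a * (1 - occ η x) + b * occ η x) * (f (flip η x) - f η) =
      ∑ η, 2 * (a - b) * cocc η x * f η := by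
  have h := sum_comp_flip x fun η => (a * occ η x + b * (1 - occ η x)) * f η
  simp only [occ_flip, sub_sub_cancel] at h
  simp only [mul_sub, Finset.sum_sub_distrib] at h ⊢
  rw [h, ← Finset.sum_sub_distrib]
  exact Finset.sum_congr rfl fun η _ => by simp only [cocc]; ring

/-- The uniform measure is invariant. The drift created by the bulk asymmetry at a site is
compensated by the reservoirs, as the total rates to the left and to the right agree. -/
lemma sum_gen_eq_zero (α θ : ℝ) {γ : ℝ} (hγ : 0 < γ) (n : ℕ) (f : Config n → ℝ) :
    ∑ η, gen α θ γ n f η = 0 := by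
  have h1 : ∀ x y : sites n, ∑ η, jumpRate α θ γ n (Sum.inl (x, y)) η *
      (f (jumpMap n (Sum.inl (x, y)) η) - f η) =
      (n : ℝ) ^ θ * ∑ η, asymRate γ (y - x) * (cocc η y - cocc η x) * f η := by
    intro x y
    have h2 : ∑ η, (f (exchange η x y) - f η) = 0 := by
      rw [Finset.sum_sub_distrib, sum_comp_exchange, sub_self]
    have h3 := sum_occ_mul_exchange x y f
    simp only [jumpRate, jumpMap, add_mul, Finset.sum_add_distrib, ← Finset.mul_sum, h2, mul_assoc,
      mul_zero, zero_add] at h3 ⊢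
    rw [h3]
  have h2 : ∀ x : sites n, ∑ η, jumpRate α θ γ n (Sum.inr x) η *
      (f (jumpMap n (Sum.inr x) η) - f η) =
      (n : ℝ) ^ θ * ∑ η, (leftRate γ n x - rightRate γ n x) * cocc η x * f η := by
    intro x
    have h2 : ∑ η, (f (flip η x) - f η) = 0 := by
      rw [Finset.sum_sub_distrib, sum_comp_flip, sub_self]
    have h3 := sum_occ_mul_flip x f (leftRate γ n x) (rightRate γ n x)
    simp only [jumpRate, jumpMap, add_mul _ _ (f _ - f _), Finset.sum_add_distrib,
      mul_assoc, ← Finset.mul_sum, h2, mul_zero, zero_add] at h3 ⊢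
    rw [h3]
    ring
  simp only [gen_eq_sum_jump]
  rw [Finset.sum_comm, Fintype.sum_sum_type, Fintype.sum_prod_type]
  simp only [h1, h2, ← Finset.mul_sum]
  rw [← mul_add]
  refine mul_eq_zero_of_right _ ?_
  rw [Finset.sum_congr rfl fun x _ => Finset.sum_comm, Finset.sum_comm,
    Finset.sum_comm (s := Finset.univ (α := sites n)) (t := Finset.univ (α := Config n)),
    ← Finset.sum_add_distrib]
  refine Finset.sum_eq_zero fun η _ => ?_
  have h3 : ∑ x : sites n, ∑ y : sites n, asymRate γ (y - x) * (cocc η y - cocc η x) * f η =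
      ∑ x : sites n, (∑ y : sites n, asymRate γ (x - y) - ∑ y : sites n, asymRate γ (y - x)) *
        cocc η x * f η := by
    have h4 : ∑ x : sites n, ∑ y : sites n, asymRate γ (y - x) * cocc η y * f η =
        ∑ x : sites n, ∑ y : sites n, asymRate γ (x - y) * cocc η x * f η := Finset.sum_comm
    simp only [mul_sub, sub_mul, Finset.sum_sub_distrib, h4, Finset.sum_mul]
  rw [h3, ← Finset.sum_add_distrib]
  refine Finset.sum_eq_zero fun x _ => ?_
  have h4 := sum_asymRate_add_leftRate hγ x
  have h5 := sum_asymRate_add_rightRate hγ x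
  rw [← add_mul, ← add_mul]
  have : ∑ y : sites n, asymRate γ (x - y) - ∑ y : sites n, asymRate γ (y - x) +
      (leftRate γ n x - rightRate γ n x) = 0 := by linarith
  rw [this]
  ring

lemma sum_rateMatrix_gen_eq_zero (α θ : ℝ) {γ : ℝ} (hγ : 0 < γ) (n : ℕ) (ξ : Config n) :
    ∑ η, rateMatrix (gen α θ γ n) η ξ = 0 :=
  sum_gen_eq_zero α θ hγ n _

lemma bernoulliWeight_half {n : ℕ} (η : Config n) :
    bernoulliWeight (1 / 2) η = (Fintype.card (Config n) : ℝ)⁻¹ := by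
  have h : ∀ x, (if η x = 1 then (1 / 2 : ℝ) else 1 - 1 / 2) = 2⁻¹ := fun x => by
    split_ifs <;> norm_num
  simp only [bernoulliWeight, h]
  simp

/-! ### Nearest-neighbour exchanges and the `H_{-1}` norm -/

/-- The exchange of the occupation variables at `z` and `z + 1`; the identity unless both are sites
of the lattice. -/
def bondSwap {n : ℕ} (z : ℤ) (η : Config n) : Config n :=
  if h : z ∈ sites n ∧ z + 1 ∈ sites n then exchange η ⟨z, h.1⟩ ⟨z + 1, h.2⟩ else η

/-- The centred occupation variable at an arbitrary integer, set to `0` outside `Λ_n`. -/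
def spin {n : ℕ} (η : Config n) (z : ℤ) : ℝ := if h : z ∈ sites n then cocc η ⟨z, h⟩ else 0

lemma bondSwap_involutive {n : ℕ} (z : ℤ) :
    Function.Involutive (bondSwap z : Config n → Config n) := by
  intro η
  unfold bondSwap
  split_ifs with h
  · exact exchange_involutive _ _ η
  · rfl

lemma sum_comp_bondSwap {n : ℕ} (z : ℤ) (f : Config n → ℝ) : ∑ η, f (bondSwap z η) = ∑ η, f η :=
  Equiv.sum_comp (bondSwap_involutive z).toPerm f

lemma spin_sq {n : ℕ} (η : Config n) {z : ℤ} (hz : z ∈ sites n) : spin η z ^ 2 = 1 / 4 := by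
  unfold spin
  rw [dif_pos hz]
  unfold cocc occ
  rcases Fin.exists_fin_two.1 ⟨η ⟨z, hz⟩, rfl⟩ with h | h <;> rw [h] <;> norm_num

lemma abs_spin_le {n : ℕ} (η : Config n) (z : ℤ) : |spin η z| ≤ 1 / 2 := by
  by_cases hz : z ∈ sites n
  · exact abs_le_of_sq_le_sq (by rw [spin_sq η hz]; norm_num) (by norm_num)
  · simp [spin, hz]

lemma spin_bondSwap {n : ℕ} (η : Config n) {z : ℤ} (h1 : z ∈ sites n) (h2 : z + 1 ∈ sites n)
    (w : ℤ) : spin (bondSwap z η) w = spin η (Equiv.swap z (z + 1) w) := by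
  unfold bondSwap
  rw [dif_pos ⟨h1, h2⟩]
  rcases eq_or_ne w z with rfl | hz
  · simp [spin, h1, h2, cocc, occ_exchange]
  rcases eq_or_ne w (z + 1) with rfl | hz'
  · simp [spin, h1, h2, cocc, occ_exchange]
  rw [Equiv.swap_apply_of_ne_of_ne hz hz']
  unfold spin
  split_ifs with h
  · unfold cocc
    rw [occ_exchange, Equiv.swap_apply_of_ne_of_ne] <;> simpa [Subtype.ext_iff]
  · rfl

lemma spin_bondSwap_of_ne {n : ℕ} (η : Config n) {z w : ℤ} (h1 : z ∈ sites n) (h2 : z + 1 ∈ sites n)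
    (hz : w ≠ z) (hz' : w ≠ z + 1) : spin (bondSwap z η) w = spin η w := by
  rw [spin_bondSwap η h1 h2, Equiv.swap_apply_of_ne_of_ne hz hz']

/-- The Dirichlet form dominates the one of the nearest-neighbour exclusion process speeded up by
`n² / 2`. -/
lemma le_neg_sum_mul_gen (α θ : ℝ) {γ : ℝ} (hγ : 0 < γ) (n : ℕ) (f : Config n → ℝ) :
    (n : ℝ) ^ 2 / 2 * ∑ z ∈ sites n, ∑ η, (f η - f (bondSwap z η)) ^ 2 ≤
      -∑ η, f η * gen α θ γ n f η := by
  rw [neg_sum_mul_generator (gen_eq_sum_jump α θ γ n) (sum_gen_eq_zero α θ hγ n), Finset.sum_comm]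
  have h : ∀ η : Config n, (n : ℝ) ^ 2 * ∑ z ∈ sites n, (f η - f (bondSwap z η)) ^ 2 ≤
      ∑ i, jumpRate α θ γ n i η * (f (jumpMap n i η) - f η) ^ 2 := by
    intro η
    have h0 : ∀ i, 0 ≤ jumpRate α θ γ n i η * (f (jumpMap n i η) - f η) ^ 2 := fun i =>
      mul_nonneg (jumpRate_nonneg _ _ _ _ _ _) (sq_nonneg _)
    rw [Fintype.sum_sum_type, Fintype.sum_prod_type, ← Finset.sum_coe_sort, Finset.mul_sum]
    refine le_add_of_le_of_nonneg (Finset.sum_le_sum fun x _ => ?_)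
      (Finset.sum_nonneg fun _ _ => h0 _)
    by_cases hx : (x : ℤ) + 1 ∈ sites n
    · refine le_trans ?_ (Finset.single_le_sum (fun y _ => h0 (Sum.inl (x, y)))
        (Finset.mem_univ (⟨x + 1, hx⟩ : sites n)))
      have h1 : bondSwap (x : ℤ) η = exchange η x ⟨x + 1, hx⟩ := by
        unfold bondSwap
        rw [dif_pos ⟨x.2, hx⟩]
      have h2 : symRate α ((x : ℤ) - (x + 1)) = 1 := by simp [symRate]
      have h3 : (n : ℝ) ^ 2 ≤ jumpRate α θ γ n (Sum.inl (x, ⟨x + 1, hx⟩)) η := by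
        have h4 := occ_mem η x
        have h5 := occ_mem η ⟨x + 1, hx⟩
        have h6 := asymRate_nonneg γ ((x : ℤ) + 1 - x)
        have h7 : 0 ≤ 1 - occ η ⟨x + 1, hx⟩ := by linarith
        have h8 := h4.1
        simp only [jumpRate, h2]
        have : 0 ≤ (n : ℝ) ^ θ * (asymRate γ ((x : ℤ) + 1 - x) * occ η x *
          (1 - occ η ⟨x + 1, hx⟩)) := by positivity
        linarith
      rw [h1]
      simp only [jumpMap]
      rw [← neg_sub, neg_sq]
      exact mul_le_mul_of_nonneg_right h3 (sq_nonneg _)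
    · have h1 : bondSwap (x : ℤ) η = η := by
        unfold bondSwap
        rw [dif_neg fun h => hx h.2]
      rw [h1]
      simp only [sub_self, ne_eq, OfNat.ofNat_ne_zero, not_false_eq_true, zero_pow, mul_zero]
      exact Finset.sum_nonneg fun y _ => h0 _
  have h2 := Finset.sum_le_sum fun η (_ : η ∈ Finset.univ) => h η
  rw [← Finset.mul_sum] at h2
  linarith

/-- The `H_{-1}` bound: a combination of gradients over bonds with coefficients invariant under the
exchange over the bond. -/
lemma two_mul_sum_gradient_le (α θ : ℝ) {γ : ℝ} (hγ : 0 < γ) {n : ℕ} (hn : 0 < n)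
    (g : ℤ → Config n → ℝ)
    (hg : ∀ z, z ∈ sites n → z + 1 ∈ sites n → ∀ η, g z (bondSwap z η) = g z η)
    (f : Config n → ℝ) :
    2 * ∑ η, (∑ z ∈ Finset.Ioo 0 ((n : ℤ) - 1), g z η * (spin η z - spin η (z + 1))) * f η ≤
      (∑ z ∈ Finset.Ioo 0 ((n : ℤ) - 1), ∑ η, g z η ^ 2) / (2 * (n : ℝ) ^ 2) -
        ∑ η, f η * gen α θ γ n f η := by
  have hn' : (0 : ℝ) < n := by exact_mod_cast hn
  have hsub : Finset.Ioo 0 ((n : ℤ) - 1) ⊆ sites n := by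
    intro z hz
    simp only [sites, Finset.mem_Ioo] at hz ⊢
    omega
  have h1 : ∀ z ∈ Finset.Ioo 0 ((n : ℤ) - 1),
      2 * ∑ η, (g z η * (spin η z - spin η (z + 1))) * f η ≤
        (∑ η, g z η ^ 2) / (2 * (n : ℝ) ^ 2) +
          (n : ℝ) ^ 2 / 2 * ∑ η, (f η - f (bondSwap z η)) ^ 2 := by
    intro z hz
    have hz1 : z ∈ sites n := hsub hz
    have hz2 : z + 1 ∈ sites n := by
      simp only [sites, Finset.mem_Ioo] at hz ⊢
      omega
    have h2 := sum_comp_bondSwap z fun η => (g z η * (spin η z - spin η (z + 1))) * f η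
    simp only [hg z hz1 hz2, spin_bondSwap _ hz1 hz2, Equiv.swap_apply_left,
      Equiv.swap_apply_right] at h2
    have h3 : 2 * ∑ η, (g z η * (spin η z - spin η (z + 1))) * f η =
        ∑ η, (g z η * (spin η z - spin η (z + 1))) * (f η - f (bondSwap z η)) := by
      rw [two_mul]
      nth_rewrite 2 [← h2]
      rw [← Finset.sum_add_distrib]
      exact Finset.sum_congr rfl fun η _ => by ring
    -- Young's inequality, weighted so that the gradient of `f` is absorbed by the Dirichlet form
    rw [h3, Finset.sum_div, Finset.mul_sum, ← Finset.sum_add_distrib]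
    refine Finset.sum_le_sum fun η _ => ?_
    have h4 : (spin η z - spin η (z + 1)) ^ 2 ≤ 1 := by
      have a1 := abs_le.1 (abs_spin_le η z)
      have a2 := abs_le.1 (abs_spin_le η (z + 1))
      rw [sq_le_one_iff_abs_le_one, abs_le]
      constructor <;> linarith
    set d := spin η z - spin η (z + 1)
    set b := f η - f (bondSwap z η)
    have h5 : g z η ^ 2 * d ^ 2 ≤ g z η ^ 2 := by nlinarith [sq_nonneg (g z η)]
    have h6 : g z η * d * b ≤ (g z η * d) ^ 2 / (2 * (n : ℝ) ^ 2) + (n : ℝ) ^ 2 / 2 * b ^ 2 := by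
      have h7 : (g z η * d) ^ 2 / (2 * (n : ℝ) ^ 2) + (n : ℝ) ^ 2 / 2 * b ^ 2 - g z η * d * b =
          (g z η * d / n - n * b) ^ 2 / 2 := by
        field_simp
        ring
      nlinarith [sq_nonneg (g z η * d / n - n * b)]
    refine h6.trans (add_le_add_left ?_ _)
    rw [mul_pow]
    gcongr
  have h2 := le_neg_sum_mul_gen α θ hγ n f
  have h3 : ∑ z ∈ Finset.Ioo 0 ((n : ℤ) - 1), ∑ η, (f η - f (bondSwap z η)) ^ 2 ≤
      ∑ z ∈ sites n, ∑ η, (f η - f (bondSwap z η)) ^ 2 :=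
    Finset.sum_le_sum_of_subset_of_nonneg hsub fun _ _ _ =>
      Finset.sum_nonneg fun _ _ => sq_nonneg _
  have h4 := Finset.sum_le_sum h1
  rw [Finset.sum_add_distrib, ← Finset.mul_sum, ← Finset.mul_sum, ← Finset.sum_div] at h4
  have h5 : ∑ η, (∑ z ∈ Finset.Ioo 0 ((n : ℤ) - 1), g z η * (spin η z - spin η (z + 1))) * f η =
      ∑ z ∈ Finset.Ioo 0 ((n : ℤ) - 1), ∑ η, (g z η * (spin η z - spin η (z + 1))) * f η := by
    simp only [Finset.sum_mul]
    exact Finset.sum_comm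
  rw [h5]
  have h6 := mul_le_mul_of_nonneg_left h3 (by positivity : 0 ≤ (n : ℝ) ^ 2 / 2)
  linarith

/-! ### Orthogonality of the spins under the uniform measure -/

lemma spin_flip {n : ℕ} (η : Config n) (x : sites n) (z : ℤ) :
    spin (flip η x) z = if z = x then -spin η z else spin η z := by
  unfold spin
  by_cases hz : z ∈ sites n
  · simp only [dif_pos hz, cocc]
    split_ifs with h
    · obtain rfl : (⟨z, hz⟩ : sites n) = x := Subtype.ext h
      rw [occ_flip]
      ring
    · rw [occ_flip_of_ne]
      exact fun h' => h (congrArg Subtype.val h')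
  · simp [hz]

lemma sum_eq_zero_of_flip {n : ℕ} (x : sites n) {f : Config n → ℝ} (hf : ∀ η, f (flip η x) = -f η) :
    ∑ η, f η = 0 := by
  have h := sum_comp_flip x f
  simp only [hf, Finset.sum_neg_distrib] at h
  linarith

lemma sum_spin_mul_spin {n : ℕ} {z w : ℤ} (h : z ≠ w) :
    ∑ η : Config n, spin η z * spin η w = 0 := by
  by_cases hz : z ∈ sites n
  · refine sum_eq_zero_of_flip ⟨z, hz⟩ fun η => ?_
    simp [spin_flip, h.symm]
  · simp [spin, hz]

lemma sum_spin_four {n : ℕ} {p q : ℤ × ℤ} (hp : p.1 ≠ p.2) (hq : q.1 ≠ q.2) (h1 : q ≠ p)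
    (h2 : q ≠ p.swap) :
    ∑ η : Config n, spin η p.1 * spin η p.2 * (spin η q.1 * spin η q.2) = 0 := by
  obtain ⟨x, y⟩ := p
  obtain ⟨z, w⟩ := q
  simp only [Prod.swap_prod_mk, ne_eq, Prod.mk.injEq] at hp hq h1 h2 ⊢
  by_cases hx : x ∈ sites n
  · by_cases hy : y ∈ sites n
    · by_cases h3 : z = x ∨ w = x
      · have h4 : z ≠ y ∧ w ≠ y := by
          constructor <;> rintro rfl <;> rcases h3 with rfl | rfl <;> simp_all
        refine sum_eq_zero_of_flip ⟨y, hy⟩ fun η => ?_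
        simp [spin_flip, h4.1, h4.2, hp]
      · push Not at h3
        refine sum_eq_zero_of_flip ⟨x, hx⟩ fun η => ?_
        simp [spin_flip, h3.1, h3.2, Ne.symm hp]
    · simp [spin, hy]
  · simp [spin, hx]

lemma card_config_pos (n : ℕ) : 0 < (Fintype.card (Config n) : ℝ) := by
  exact_mod_cast Fintype.card_pos

/-- Variance of a linear form in the spins. -/
lemma sum_linear_sq_le {n : ℕ} (s : Finset ℤ) (φ : ℤ → ℝ) :
    ∑ η : Config n, (∑ z ∈ s, φ z * spin η z) ^ 2 ≤
      Fintype.card (Config n) * (1 / 4 * ∑ z ∈ s, φ z ^ 2) := by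
  have h1 : ∑ η : Config n, (∑ z ∈ s, φ z * spin η z) ^ 2 =
      ∑ z ∈ s, ∑ w ∈ s, φ z * φ w * ∑ η : Config n, spin η z * spin η w := by
    simp only [sq, Finset.sum_mul_sum]
    rw [Finset.sum_comm]
    refine Finset.sum_congr rfl fun z _ => ?_
    rw [Finset.sum_comm]
    refine Finset.sum_congr rfl fun w _ => ?_
    rw [Finset.mul_sum]
    exact Finset.sum_congr rfl fun η _ => by ring
  rw [h1, Finset.mul_sum, Finset.mul_sum]
  refine Finset.sum_le_sum fun z hz => ?_
  rw [Finset.sum_eq_single_of_mem z hz fun w _ hw => by rw [sum_spin_mul_spin hw.symm, mul_zero]]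
  have h2 : ∑ η : Config n, spin η z * spin η z ≤ Fintype.card (Config n) * (1 / 4) := by
    rw [← nsmul_eq_mul, ← Finset.card_univ, ← Finset.sum_const]
    refine Finset.sum_le_sum fun η _ => ?_
    have := abs_le.1 (abs_spin_le η z)
    nlinarith
  nlinarith [mul_le_mul_of_nonneg_left h2 (mul_self_nonneg (φ z))]

/-- Variance of a quadratic form in the spins with vanishing diagonal. -/
lemma sum_quadratic_sq_le {n : ℕ} (S : Finset (ℤ × ℤ)) (hS : ∀ p ∈ S, p.1 ≠ p.2)
    (φ : ℤ × ℤ → ℝ) :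
    ∑ η : Config n, (∑ p ∈ S, φ p * (spin η p.1 * spin η p.2)) ^ 2 ≤
      Fintype.card (Config n) * (1 / 8 * ∑ p ∈ S, φ p ^ 2) := by
  have hc := card_config_pos n
  set c := (Fintype.card (Config n) : ℝ)
  have h1 : ∑ η : Config n, (∑ p ∈ S, φ p * (spin η p.1 * spin η p.2)) ^ 2 =
      ∑ p ∈ S, ∑ q ∈ S, φ p * φ q *
        ∑ η : Config n, spin η p.1 * spin η p.2 * (spin η q.1 * spin η q.2) := by
    simp only [sq, Finset.sum_mul_sum]
    rw [Finset.sum_comm]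
    refine Finset.sum_congr rfl fun z _ => ?_
    rw [Finset.sum_comm]
    refine Finset.sum_congr rfl fun w _ => ?_
    rw [Finset.mul_sum]
    exact Finset.sum_congr rfl fun η _ => by ring
  -- only the pairs `q` equal to `p` as unordered pairs are correlated with `p`
  have h2 : ∀ p ∈ S, ∀ q ∈ S, φ p * φ q *
        ∑ η : Config n, spin η p.1 * spin η p.2 * (spin η q.1 * spin η q.2) ≤
      c / 32 * ((if q = p then φ p ^ 2 + φ q ^ 2 else 0) +
        (if q = p.swap then φ p ^ 2 + φ q ^ 2 else 0)) := by
    intro p hp q hq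
    have h3 : |∑ η : Config n, spin η p.1 * spin η p.2 * (spin η q.1 * spin η q.2)| ≤ c / 16 := by
      refine (Finset.abs_sum_le_sum_abs _ _).trans ?_
      have : ∑ η : Config n, |spin η p.1 * spin η p.2 * (spin η q.1 * spin η q.2)| ≤
          ∑ η : Config n, 1 / 2 * (1 / 2) * (1 / 2 * (1 / 2)) := by
        refine Finset.sum_le_sum fun η _ => ?_
        simp only [abs_mul]
        gcongr <;> exact abs_spin_le _ _
      refine this.trans (le_of_eq ?_)
      rw [Finset.sum_const, Finset.card_univ, nsmul_eq_mul]
      ring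
    have h4 : φ p * φ q * ∑ η : Config n, spin η p.1 * spin η p.2 * (spin η q.1 * spin η q.2) ≤
        c / 32 * (φ p ^ 2 + φ q ^ 2) := by
      refine (le_abs_self _).trans ?_
      rw [abs_mul, abs_mul]
      have h5 : |φ p| * |φ q| ≤ (φ p ^ 2 + φ q ^ 2) / 2 := by
        nlinarith [sq_nonneg (|φ p| - |φ q|), sq_abs (φ p), sq_abs (φ q)]
      have h6 := mul_le_mul h5 h3 (abs_nonneg _) (by positivity)
      linarith
    by_cases e1 : q = p
    · rw [if_pos e1]
      refine h4.trans (mul_le_mul_of_nonneg_left ?_ (by positivity))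
      have : 0 ≤ (if q = p.swap then φ p ^ 2 + φ q ^ 2 else 0) := by split_ifs <;> positivity
      linarith
    · by_cases e2 : q = p.swap
      · rw [if_neg e1, if_pos e2, zero_add]
        exact h4
      · rw [sum_spin_four (hS p hp) (hS q hq) e1 e2]
        simp [e1, e2]
  rw [h1]
  refine (Finset.sum_le_sum fun p hp => Finset.sum_le_sum fun q hq => h2 p hp q hq).trans ?_
  simp only [← Finset.mul_sum, Finset.sum_add_distrib, Finset.sum_ite_eq']
  have h3 : ∑ p ∈ S, (if p ∈ S then φ p ^ 2 + φ p ^ 2 else 0) = 2 * ∑ p ∈ S, φ p ^ 2 := by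
    rw [Finset.mul_sum]
    exact Finset.sum_congr rfl fun p hp => by rw [if_pos hp]; ring
  have h4 : ∑ p ∈ S, (if p.swap ∈ S then φ p ^ 2 + φ p.swap ^ 2 else 0) ≤
      2 * ∑ p ∈ S, φ p ^ 2 := by
    have h5 : ∑ p ∈ S, (if p.swap ∈ S then φ p ^ 2 + φ p.swap ^ 2 else 0) =
        ∑ p ∈ S with p.swap ∈ S, φ p ^ 2 + ∑ p ∈ S with p.swap ∈ S, φ p.swap ^ 2 := by
      rw [← Finset.sum_add_distrib, Finset.sum_filter]
    have h6 : ∑ p ∈ S with p.swap ∈ S, φ p.swap ^ 2 = ∑ p ∈ S with p.swap ∈ S, φ p ^ 2 := by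
      refine Finset.sum_nbij' Prod.swap Prod.swap ?_ ?_ ?_ ?_ ?_ <;>
        simp +contextual
    have h7 : ∑ p ∈ S with p.swap ∈ S, φ p ^ 2 ≤ ∑ p ∈ S, φ p ^ 2 :=
      Finset.sum_le_sum_of_subset_of_nonneg (Finset.filter_subset _ _) fun _ _ _ => sq_nonneg _
    rw [h5, h6]
    linarith
  rw [h3]
  nlinarith

/-- The Kipnis–Varadhan inequality for the exclusion process, for the sum of a combination of
gradients and of a remainder controlled in `L²`. -/
lemma IsExclusionProcess.supSqTimeIntegral_le {α θ γ : ℝ} (hγ : 0 < γ) {n : ℕ} (hn : 0 < n)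
    {Ω : Type*} [MeasurableSpace Ω] {P : Measure Ω} {X : ℝ → Ω → Config n}
    (hX : IsExclusionProcess α θ γ n P X) {T : ℝ} (hT : 0 < T) (g : ℤ → Config n → ℝ)
    (hg : ∀ z, z ∈ sites n → z + 1 ∈ sites n → ∀ η, g z (bondSwap z η) = g z η)
    (R : Config n → ℝ) {K K' : ℝ}
    (hK : ∑ z ∈ Finset.Ioo 0 ((n : ℤ) - 1), ∑ η, g z η ^ 2 ≤
      Fintype.card (Config n) * (2 * (n : ℝ) ^ 2 * K))
    (hK' : ∑ η, R η ^ 2 ≤ Fintype.card (Config n) * K') :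
    supSqTimeIntegral P X T (fun η =>
      (∑ z ∈ Finset.Ioo 0 ((n : ℤ) - 1), g z η * (spin η z - spin η (z + 1))) + R η) ≤
      ENNReal.ofReal (40 * T * K + 2 * T ^ 2 * K') := by
  refine IsMarkovProcess.supSqTimeIntegral_le hX bernoulliWeight_half
    (sum_rateMatrix_gen_eq_zero α θ hγ n) hT _ R (fun f => ?_) hK'
  have h := two_mul_sum_gradient_le α θ hγ hn g hg f
  simp only [rateMatrix_mulVec (gen_eq_sum_jump α θ γ n)]
  refine h.trans (sub_le_sub_right ?_ _)
  have hn' : (0 : ℝ) < n := by exact_mod_cast hn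
  rw [div_le_iff₀ (by positivity)]
  linarith

/-! ### Summation by parts -/

/-- The flow through the bond `{z, z + 1}` created by the source `μ`. -/
def flow (μ : ℤ → ℝ) (z : ℤ) : ℝ := ∑ w ∈ Finset.Ioc 0 z, μ w

lemma flow_add_one (μ : ℤ → ℝ) {z : ℤ} (hz : 0 ≤ z) : flow μ (z + 1) = flow μ z + μ (z + 1) := by
  have : Finset.Ioc 0 (z + 1) = insert (z + 1) (Finset.Ioc 0 z) := by
    ext w; simp only [Finset.mem_Ioc, Finset.mem_insert]; omega
  rw [flow, this, Finset.sum_insert (by simp), flow, add_comm]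

lemma sum_Ioc_mul_eq (μ s : ℤ → ℝ) (k : ℕ) :
    ∑ w ∈ Finset.Ioc 0 (k : ℤ), μ w * s w =
      ∑ z ∈ Finset.Ioo 0 (k : ℤ), flow μ z * (s z - s (z + 1)) + flow μ k * s k := by
  induction k with
  | zero => simp [flow]
  | succ k ih =>
    have h1 : Finset.Ioc 0 ((k : ℤ) + 1) = insert ((k : ℤ) + 1) (Finset.Ioc 0 (k : ℤ)) := by
      ext w; simp only [Finset.mem_Ioc, Finset.mem_insert]; omega
    push_cast
    rw [h1, Finset.sum_insert (by simp), ih, flow_add_one μ (by omega)]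
    rcases Nat.eq_zero_or_pos k with rfl | hk
    · have h0 : Finset.Ioo (0 : ℤ) 1 = ∅ := by decide
      simp [h0, flow]
    · have h2 : Finset.Ioo 0 ((k : ℤ) + 1) = insert (k : ℤ) (Finset.Ioo 0 (k : ℤ)) := by
        ext w; simp only [Finset.mem_Ioo, Finset.mem_insert]; omega
      rw [h2, Finset.sum_insert (by simp)]
      ring

lemma sum_sites_mul_eq_sum_flow {n : ℕ} (μ s : ℤ → ℝ) (hμ : flow μ ((n : ℤ) - 1) = 0) :
    ∑ w ∈ sites n, μ w * s w =
      ∑ z ∈ Finset.Ioo 0 ((n : ℤ) - 1), flow μ z * (s z - s (z + 1)) := by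
  rcases Nat.eq_zero_or_pos n with rfl | hn
  · simp [sites]
  · obtain ⟨k, rfl⟩ : ∃ k, n = k + 1 := ⟨n - 1, by omega⟩
    have h1 : ((k + 1 : ℕ) : ℤ) - 1 = k := by push_cast; ring
    have h2 : sites (k + 1) = Finset.Ioc 0 (k : ℤ) := by
      ext w; simp only [sites, Finset.mem_Ioo, Finset.mem_Ioc]; omega
    rw [h1] at hμ ⊢
    rw [h2, sum_Ioc_mul_eq, hμ, zero_mul, add_zero]

lemma flow_eq_sum_Ico {μ : ℤ → ℝ} {a b z : ℤ} (ha : 0 < a)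
    (hsupp : ∀ w, w ∉ Finset.Ico a b → μ w = 0) (hz : b ≤ z + 1) :
    flow μ z = ∑ w ∈ Finset.Ico a b, μ w := by
  refine (Finset.sum_subset (fun w hw => ?_) fun w _ hw => hsupp w hw).symm
  simp only [Finset.mem_Ico, Finset.mem_Ioc] at hw ⊢
  omega

/-- A source of vanishing total mass supported on an interval creates no flow outside of it. -/
lemma flow_eq_zero {μ : ℤ → ℝ} {a b z : ℤ} (ha : 0 < a)
    (hsupp : ∀ w, w ∉ Finset.Ico a b → μ w = 0) (hsum : ∑ w ∈ Finset.Ico a b, μ w = 0)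
    (hz : ¬(a ≤ z ∧ z + 1 < b)) : flow μ z = 0 := by
  by_cases h : a ≤ z
  · rw [flow_eq_sum_Ico ha hsupp (by omega), hsum]
  · refine Finset.sum_eq_zero fun w hw => hsupp w ?_
    simp only [Finset.mem_Ico, Finset.mem_Ioc] at hw ⊢
    omega

/-- Moving mass `M` between two nonnegative distributions creates a flow of at most `M`. -/
lemma abs_flow_sub_le {q r : ℤ → ℝ} {a b : ℤ} {M : ℝ}
    (hq0 : ∀ w, 0 ≤ q w) (hr0 : ∀ w, 0 ≤ r w)
    (hq : ∀ w, w ∉ Finset.Ico a b → q w = 0) (hr : ∀ w, w ∉ Finset.Ico a b → r w = 0)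
    (hqM : ∑ w ∈ Finset.Ico a b, q w = M) (hrM : ∑ w ∈ Finset.Ico a b, r w = M) (z : ℤ) :
    |flow (fun w => q w - r w) z| ≤ M := by
  have h : ∀ f : ℤ → ℝ, (∀ w, 0 ≤ f w) → (∀ w, w ∉ Finset.Ico a b → f w = 0) →
      ∑ w ∈ Finset.Ico a b, f w = M → 0 ≤ flow f z ∧ flow f z ≤ M := by
    intro f hf0 hf hfM
    refine ⟨Finset.sum_nonneg fun w _ => hf0 w, ?_⟩
    have h1 : flow f z = ∑ w ∈ Finset.Ioc 0 z with w ∈ Finset.Ico a b, f w := by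
      rw [Finset.sum_filter]
      refine Finset.sum_congr rfl fun w _ => ?_
      split_ifs with hw
      · rfl
      · exact hf w hw
    rw [h1, ← hfM]
    refine Finset.sum_le_sum_of_subset_of_nonneg (fun w hw => ?_) fun w _ _ => hf0 w
    exact (Finset.mem_filter.1 hw).2
  have h1 := h q hq0 hq hqM
  have h2 := h r hr0 hr hrM
  have h3 : flow (fun w => q w - r w) z = flow q z - flow r z := Finset.sum_sub_distrib _ _
  rw [h3, abs_le]
  constructor <;> linarith

/-! ### Boxes and anchors -/

/-- One of the two orderings of each pair of distinct sites, the first component being the anchor of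
the pair: the smaller site if it is at distance more than `ℓ` from the right end, and the larger
site otherwise. -/
def selects (n ℓ : ℕ) (u w : ℤ) : Prop :=
  (u < n - ℓ ∧ u < w) ∨ ((n : ℤ) - ℓ ≤ u ∧ (n : ℤ) - ℓ ≤ w ∧ w < u)

instance (n ℓ : ℕ) (u w : ℤ) : Decidable (selects n ℓ u w) := by unfold selects; infer_instance

/-- The sites `w` at distance less than `ℓ` from `u` such that `u` is the anchor of `{u, w}`. -/
def nbrs (n ℓ : ℕ) (u : ℤ) : Finset ℤ := {w ∈ sites n | selects n ℓ u w ∧ |w - u| < ℓ}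

/-- The left end of the box over which `boxAvg` averages at `u`. -/
def boxStart (n ℓ : ℕ) (u : ℤ) : ℤ := if u < n - ℓ then u else u - ℓ + 1

/-- The box over which `boxAvg` averages at `u`. -/
def box (n ℓ : ℕ) (u : ℤ) : Finset ℤ := Finset.Ico (boxStart n ℓ u) (boxStart n ℓ u + ℓ)

/-- The left end of the box at `u` deprived of `u`. -/
def puncStart (n ℓ : ℕ) (u : ℤ) : ℤ := if u < n - ℓ then u + 1 else u - ℓ + 1

/-- The box at `u` deprived of its end point `u`. -/
def punc (n ℓ : ℕ) (u : ℤ) : Finset ℤ := Finset.Ico (puncStart n ℓ u) (puncStart n ℓ u + (ℓ - 1))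

/-- The average of the centred occupation variables over the box at `u`. -/
def boxMean {n : ℕ} (ℓ : ℕ) (η : Config n) (u : ℤ) : ℝ := 1 / (ℓ : ℝ) * ∑ w ∈ box n ℓ u, spin η w

section Boxes

variable {n ℓ : ℕ} {u : ℤ}

lemma card_box : (box n ℓ u).card = ℓ := by simp [box]

lemma card_punc (hℓ : 1 ≤ ℓ) : ((punc n ℓ u).card : ℝ) = ℓ - 1 := by
  have : (punc n ℓ u).card = ℓ - 1 := by simp [punc]
  rw [this, Nat.cast_sub hℓ, Nat.cast_one]

lemma boxStart_pos (hn : 2 * ℓ ≤ n) (hu : u ∈ sites n) : 0 < boxStart n ℓ u := by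
  simp only [sites, Finset.mem_Ioo] at hu
  unfold boxStart; split_ifs <;> omega

lemma puncStart_pos (hn : 2 * ℓ ≤ n) (hu : u ∈ sites n) : 0 < puncStart n ℓ u := by
  simp only [sites, Finset.mem_Ioo] at hu
  unfold puncStart; split_ifs <;> omega

lemma box_subset (hn : 2 * ℓ ≤ n) (hu : u ∈ sites n) : box n ℓ u ⊆ sites n := by
  intro w hw
  simp only [sites, Finset.mem_Ioo] at hu ⊢
  simp only [box, boxStart, Finset.mem_Ico] at hw
  split_ifs at hw <;> omega

lemma mem_box_self (hℓ : 1 ≤ ℓ) : u ∈ box n ℓ u := by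
  simp only [box, boxStart, Finset.mem_Ico]
  split_ifs <;> omega

lemma punc_eq_erase : punc n ℓ u = (box n ℓ u).erase u := by
  ext w
  simp only [punc, puncStart, box, boxStart, Finset.mem_Ico, Finset.mem_erase]
  split_ifs <;> omega

lemma abs_sub_lt_of_mem_box {z : ℤ} (hz : z ∈ box n ℓ u) : |z - u| < ℓ := by
  simp only [box, boxStart, Finset.mem_Ico] at hz
  rw [abs_lt]
  split_ifs at hz <;> omega

lemma punc_subset_box : punc n ℓ u ⊆ box n ℓ u := by
  rw [punc_eq_erase]; exact Finset.erase_subset _ _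

lemma nbrs_subset_punc : nbrs n ℓ u ⊆ punc n ℓ u := by
  intro w hw
  simp only [nbrs, selects, Finset.mem_filter, abs_lt] at hw
  simp only [punc, puncStart, Finset.mem_Ico]
  split_ifs <;> omega

lemma sum_box_eq (η : Config n) (hℓ : 1 ≤ ℓ) : ∑ w ∈ box n ℓ u, spin η w = ℓ * boxMean ℓ η u := by
  have : (ℓ : ℝ) ≠ 0 := by positivity
  unfold boxMean
  field_simp

lemma sum_punc_eq (η : Config n) (hℓ : 1 ≤ ℓ) :
    ∑ w ∈ punc n ℓ u, spin η w = ℓ * boxMean ℓ η u - spin η u := by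
  rw [← sum_box_eq η hℓ, punc_eq_erase, Finset.sum_erase_eq_sub (mem_box_self hℓ)]

/-- The box average is unchanged by an exchange inside the box. -/
lemma boxMean_bondSwap (η : Config n) {z : ℤ} (h1 : z ∈ sites n) (h2 : z + 1 ∈ sites n)
    (hz : z ∈ box n ℓ u) (hz' : z + 1 ∈ box n ℓ u) :
    boxMean ℓ (bondSwap z η) u = boxMean ℓ η u := by
  unfold boxMean
  congr 1
  refine Finset.sum_equiv (Equiv.swap z (z + 1)) (fun w => ?_) fun w _ => spin_bondSwap η h1 h2 w
  rcases eq_or_ne w z with rfl | hw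
  · simp [hz, hz']
  rcases eq_or_ne w (z + 1) with rfl | hw'
  · simp [hz, hz']
  rw [Equiv.swap_apply_of_ne_of_ne hw hw']

lemma sum_boxMean_sq_le (hℓ : 1 ≤ ℓ) :
    ∑ η : Config n, boxMean ℓ η u ^ 2 ≤ Fintype.card (Config n) * (1 / (4 * (ℓ : ℝ))) := by
  have h := sum_linear_sq_le (n := n) (box n ℓ u) fun _ => 1 / (ℓ : ℝ)
  have hℓ' : (ℓ : ℝ) ≠ 0 := by positivity
  simp only [← Finset.mul_sum, Finset.sum_const, card_box, nsmul_eq_mul] at h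
  refine h.trans (le_of_eq ?_)
  field_simp

/-- The centred square of the box average is a quadratic form off the diagonal. -/
lemma boxMean_sq_sub (η : Config n) (hℓ : 1 ≤ ℓ) (hn : 2 * ℓ ≤ n) (hu : u ∈ sites n) :
    boxMean ℓ η u ^ 2 - 1 / (4 * (ℓ : ℝ)) =
      ∑ p ∈ (box n ℓ u).offDiag, 1 / (ℓ : ℝ) ^ 2 * (spin η p.1 * spin η p.2) := by
  have hℓ' : (ℓ : ℝ) ≠ 0 := by positivity
  have h1 : (∑ w ∈ box n ℓ u, spin η w) ^ 2 =
      ∑ p ∈ (box n ℓ u).offDiag, spin η p.1 * spin η p.2 + ℓ * (1 / 4) := by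
    rw [sq, Finset.sum_mul_sum, ← Finset.sum_product', ← Finset.diag_union_offDiag,
      Finset.sum_union (Finset.disjoint_diag_offDiag _), Finset.sum_diag, add_comm]
    congr 1
    rw [Finset.sum_congr rfl fun w hw => by rw [← sq, spin_sq η (box_subset hn hu hw)],
      Finset.sum_const, card_box, nsmul_eq_mul]
  rw [← Finset.mul_sum]
  have h2 : ∑ p ∈ (box n ℓ u).offDiag, spin η p.1 * spin η p.2 =
      (∑ w ∈ box n ℓ u, spin η w) ^ 2 - ℓ * (1 / 4) := by rw [h1]; ring
  rw [h2, boxMean]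
  field_simp

lemma sum_boxMean_sq_sub_sq_le (hℓ : 1 ≤ ℓ) (hn : 2 * ℓ ≤ n) (hu : u ∈ sites n) :
    ∑ η : Config n, (boxMean ℓ η u ^ 2 - 1 / (4 * (ℓ : ℝ))) ^ 2 ≤
      Fintype.card (Config n) * (1 / (8 * (ℓ : ℝ) ^ 2)) := by
  have hℓ' : (0 : ℝ) < ℓ := by positivity
  simp only [boxMean_sq_sub _ hℓ hn hu]
  refine (sum_quadratic_sq_le _ (fun p hp => (Finset.mem_offDiag.1 hp).2.2) _).trans ?_
  have h : ((box n ℓ u).offDiag.card : ℝ) ≤ (ℓ : ℝ) ^ 2 := by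
    rw [Finset.offDiag_card, card_box]
    exact_mod_cast (by rw [sq]; omega : ℓ * ℓ - ℓ ≤ ℓ ^ 2)
  rw [Finset.sum_const, nsmul_eq_mul]
  have hc := card_config_pos n
  gcongr
  calc 1 / 8 * (((box n ℓ u).offDiag.card : ℝ) * (1 / (ℓ : ℝ) ^ 2) ^ 2)
      ≤ 1 / 8 * ((ℓ : ℝ) ^ 2 * (1 / (ℓ : ℝ) ^ 2) ^ 2) := by gcongr
    _ = 1 / (8 * (ℓ : ℝ) ^ 2) := by field_simp

/-- A weighted sum over the sites of centred squares of box averages is bounded in `L²` by the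
triangle inequality. -/
lemma sum_weighted_boxMean_sq_le (hℓ : 1 ≤ ℓ) (hn : 2 * ℓ ≤ n) (e : ℤ → ℝ) :
    ∑ η : Config n, (∑ u ∈ sites n, e u * (boxMean ℓ η u ^ 2 - 1 / (4 * (ℓ : ℝ)))) ^ 2 ≤
      Fintype.card (Config n) * ((∑ u ∈ sites n, |e u|) ^ 2 / (8 * (ℓ : ℝ) ^ 2)) := by
  have h1 : ∀ η : Config n, (∑ u ∈ sites n, e u * (boxMean ℓ η u ^ 2 - 1 / (4 * (ℓ : ℝ)))) ^ 2 ≤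
      (∑ u ∈ sites n, |e u|) *
        ∑ u ∈ sites n, |e u| * (boxMean ℓ η u ^ 2 - 1 / (4 * (ℓ : ℝ))) ^ 2 := by
    intro η
    refine Finset.sum_sq_le_sum_mul_sum_of_sq_le_mul _ (fun u _ => abs_nonneg _)
      (fun u _ => by positivity) fun u _ => ?_
    rw [mul_pow, ← mul_assoc, ← sq, sq_abs]
  refine (Finset.sum_le_sum fun η _ => h1 η).trans ?_
  rw [← Finset.mul_sum, Finset.sum_comm]
  have h2 : ∑ u ∈ sites n, ∑ η : Config n, |e u| * (boxMean ℓ η u ^ 2 - 1 / (4 * (ℓ : ℝ))) ^ 2 ≤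
      ∑ u ∈ sites n, |e u| * (Fintype.card (Config n) * (1 / (8 * (ℓ : ℝ) ^ 2))) := by
    refine Finset.sum_le_sum fun u hu => ?_
    rw [← Finset.mul_sum]
    exact mul_le_mul_of_nonneg_left (sum_boxMean_sq_sub_sq_le hℓ hn hu) (abs_nonneg _)
  rw [← Finset.sum_mul] at h2
  have h3 := mul_le_mul_of_nonneg_left h2
    (Finset.sum_nonneg fun u _ => abs_nonneg (e u) : 0 ≤ ∑ u ∈ sites n, |e u|)
  refine h3.trans (le_of_eq ?_)
  ring

end Boxes

/-! ### The flows replacing two-point products by squares of box averages -/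

/-- The weight `k p_γ(k)`, equal to `k^{-γ}` for `k ≥ 1`. -/
def rho (γ : ℝ) (k : ℤ) : ℝ := (k : ℝ) * asymRate γ k

lemma rho_nonneg (γ : ℝ) (k : ℤ) : 0 ≤ rho γ k := by
  unfold rho asymRate
  split_ifs with h
  · positivity
  · simp

/-- The total weight of the pairs anchored at `u` and of diameter less than `ℓ`. -/
def mass (γ : ℝ) (n ℓ : ℕ) (u : ℤ) : ℝ := ∑ w ∈ nbrs n ℓ u, rho γ |w - u|

lemma mass_nonneg (γ : ℝ) (n ℓ : ℕ) (u : ℤ) : 0 ≤ mass γ n ℓ u :=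
  Finset.sum_nonneg fun _ _ => rho_nonneg _ _

/-- The source moving the pairs anchored at `u` to the uniform distribution over the pairs
`{u, w}` with `w` in the punctured box. -/
def pairSource (γ : ℝ) (n ℓ : ℕ) (u w : ℤ) : ℝ :=
  (if w ∈ nbrs n ℓ u then rho γ |w - u| else 0) -
    (if w ∈ punc n ℓ u then mass γ n ℓ u / ((ℓ : ℝ) - 1) else 0)

/-- The source moving a unit mass at `u` to the uniform distribution over the box. -/
def pointSource (n ℓ : ℕ) (u w : ℤ) : ℝ :=
  (if w = u then 1 else 0) - (if w ∈ box n ℓ u then 1 / (ℓ : ℝ) else 0)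

section Flows

variable {γ : ℝ} {n ℓ : ℕ} {u : ℤ}

lemma pairSource_facts (hℓ : 2 ≤ ℓ) :
    (∑ w ∈ punc n ℓ u, if w ∈ nbrs n ℓ u then rho γ |w - u| else 0) = mass γ n ℓ u ∧
    (∑ w ∈ punc n ℓ u, if w ∈ punc n ℓ u then mass γ n ℓ u / ((ℓ : ℝ) - 1) else 0) =
      mass γ n ℓ u := by
  have h2 : (2 : ℝ) ≤ ℓ := by exact_mod_cast hℓ
  have h3 : (ℓ : ℝ) - 1 ≠ 0 := by linarith
  constructor
  · rw [← Finset.sum_filter, Finset.filter_mem_eq_inter,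
      Finset.inter_eq_right.2 nbrs_subset_punc, mass]
  · rw [Finset.sum_congr rfl fun w hw => if_pos hw, Finset.sum_const, nsmul_eq_mul,
      card_punc (by omega)]
    field_simp

lemma abs_flow_pairSource_le (hℓ : 2 ≤ ℓ) (z : ℤ) :
    |flow (pairSource γ n ℓ u) z| ≤ mass γ n ℓ u := by
  have h2 : (2 : ℝ) ≤ ℓ := by exact_mod_cast hℓ
  obtain ⟨h3, h4⟩ := pairSource_facts (γ := γ) (n := n) (u := u) hℓ
  refine abs_flow_sub_le (fun w => ?_) (fun w => ?_) (fun w hw => ?_) (fun w hw => ?_) h3 h4 z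
  · split_ifs
    · exact rho_nonneg _ _
    · exact le_rfl
  · split_ifs
    · exact div_nonneg (mass_nonneg _ _ _ _) (by linarith)
    · exact le_rfl
  · exact if_neg fun h => hw (nbrs_subset_punc h)
  · exact if_neg hw

lemma flow_pairSource_eq_zero (hℓ : 2 ≤ ℓ) (hn : 2 * ℓ ≤ n) (hu : u ∈ sites n) {z : ℤ}
    (hz : ¬(z ∈ punc n ℓ u ∧ z + 1 ∈ punc n ℓ u)) : flow (pairSource γ n ℓ u) z = 0 := by
  refine flow_eq_zero (puncStart_pos hn hu) (b := puncStart n ℓ u + (ℓ - 1)) (fun w hw => ?_) ?_ ?_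
  · have h1 : w ∉ punc n ℓ u := hw
    rw [pairSource, if_neg h1, if_neg fun h => h1 (nbrs_subset_punc h), sub_zero]
  · obtain ⟨h3, h4⟩ := pairSource_facts (γ := γ) (n := n) (u := u) hℓ
    unfold pairSource
    rw [Finset.sum_sub_distrib]
    exact sub_eq_zero.2 (h3.trans h4.symm)
  · simp only [punc, Finset.mem_Ico] at hz
    omega

lemma pointSource_facts (hℓ : 1 ≤ ℓ) :
    (∑ w ∈ box n ℓ u, if w = u then (1 : ℝ) else 0) = 1 ∧
    (∑ w ∈ box n ℓ u, if w ∈ box n ℓ u then 1 / (ℓ : ℝ) else 0) = 1 := by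
  have h2 : (ℓ : ℝ) ≠ 0 := by positivity
  constructor
  · rw [Finset.sum_ite_eq', if_pos (mem_box_self hℓ)]
  · rw [Finset.sum_congr rfl fun w hw => if_pos hw, Finset.sum_const, nsmul_eq_mul, card_box]
    field_simp

lemma abs_flow_pointSource_le (hℓ : 1 ≤ ℓ) (z : ℤ) : |flow (pointSource n ℓ u) z| ≤ 1 := by
  obtain ⟨h3, h4⟩ := pointSource_facts (n := n) (u := u) hℓ
  refine abs_flow_sub_le (fun w => ?_) (fun w => ?_) (fun w hw => ?_) (fun w hw => ?_) h3 h4 z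
  · split_ifs <;> norm_num
  · split_ifs <;> positivity
  · refine if_neg fun h => hw ?_
    rw [h]
    exact mem_box_self hℓ
  · exact if_neg hw

lemma flow_pointSource_eq_zero (hℓ : 1 ≤ ℓ) (hn : 2 * ℓ ≤ n) (hu : u ∈ sites n) {z : ℤ}
    (hz : ¬(z ∈ box n ℓ u ∧ z + 1 ∈ box n ℓ u)) : flow (pointSource n ℓ u) z = 0 := by
  refine flow_eq_zero (boxStart_pos hn hu) (b := boxStart n ℓ u + ℓ) (fun w hw => ?_) ?_ ?_
  · have h1 : w ∉ box n ℓ u := hw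
    rw [pointSource, if_neg h1, if_neg, sub_zero]
    rintro rfl
    exact h1 (mem_box_self hℓ)
  · obtain ⟨h3, h4⟩ := pointSource_facts (n := n) (u := u) hℓ
    unfold pointSource
    rw [Finset.sum_sub_distrib]
    exact sub_eq_zero.2 (h3.trans h4.symm)
  · simp only [box, Finset.mem_Ico] at hz
    omega

lemma last_notMem (hn : 2 * ℓ ≤ n) (hu : u ∈ sites n) : ((n : ℤ) - 1) + 1 ∉ box n ℓ u := fun h => by
  have := box_subset hn hu h
  simp [sites] at this

lemma sum_flow_pairSource (η : Config n) (hℓ : 2 ≤ ℓ) (hn : 2 * ℓ ≤ n) (hu : u ∈ sites n) :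
    ∑ z ∈ Finset.Ioo 0 ((n : ℤ) - 1), flow (pairSource γ n ℓ u) z * (spin η z - spin η (z + 1)) =
      ∑ w ∈ nbrs n ℓ u, rho γ |w - u| * spin η w -
        mass γ n ℓ u / ((ℓ : ℝ) - 1) * (ℓ * boxMean ℓ η u - spin η u) := by
  rw [← sum_sites_mul_eq_sum_flow _ _ (flow_pairSource_eq_zero hℓ hn hu fun h =>
    last_notMem hn hu (punc_subset_box h.2))]
  simp only [pairSource, sub_mul, Finset.sum_sub_distrib, ite_mul, zero_mul]
  have h1 : punc n ℓ u ⊆ sites n := punc_subset_box.trans (box_subset hn hu)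
  rw [← Finset.sum_filter, ← Finset.sum_filter, Finset.filter_mem_eq_inter,
    Finset.filter_mem_eq_inter, Finset.inter_eq_right.2 h1,
    Finset.inter_eq_right.2 (nbrs_subset_punc.trans h1), ← Finset.mul_sum,
    sum_punc_eq η (by omega)]

lemma sum_flow_pointSource (η : Config n) (hℓ : 1 ≤ ℓ) (hn : 2 * ℓ ≤ n) (hu : u ∈ sites n) :
    ∑ z ∈ Finset.Ioo 0 ((n : ℤ) - 1), flow (pointSource n ℓ u) z * (spin η z - spin η (z + 1)) =
      spin η u - boxMean ℓ η u := by
  rw [← sum_sites_mul_eq_sum_flow _ _ (flow_pointSource_eq_zero hℓ hn hu fun h =>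
    last_notMem hn hu h.2)]
  simp only [pointSource, sub_mul, Finset.sum_sub_distrib, ite_mul, zero_mul, one_mul]
  rw [← Finset.sum_filter, ← Finset.sum_filter, Finset.filter_mem_eq_inter,
    Finset.inter_eq_right.2 (box_subset hn hu), ← Finset.mul_sum, Finset.filter_eq', if_pos hu,
    Finset.sum_singleton, boxMean]

/-- The coefficient of the gradient over the bond `{z, z + 1}`. It is invariant under the exchange
over this bond: the punctured box does not contain `u`, so that the first flow does not see `η_u`, and
the second flow lives on bonds inside the box. -/
def bondCoeff (γ : ℝ) {n : ℕ} (ℓ : ℕ) (h : ℤ → ℝ) (z : ℤ) (η : Config n) : ℝ :=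
  ∑ u ∈ sites n, h u * flow (pairSource γ n ℓ u) z * spin η u +
    ∑ u ∈ sites n, h u * (mass γ n ℓ u * (ℓ / ((ℓ : ℝ) - 1))) * flow (pointSource n ℓ u) z *
      boxMean ℓ η u

lemma bondCoeff_bondSwap (hℓ : 2 ≤ ℓ) (hn : 2 * ℓ ≤ n) (h : ℤ → ℝ) {z : ℤ} (h1 : z ∈ sites n)
    (h2 : z + 1 ∈ sites n) (η : Config n) :
    bondCoeff γ ℓ h z (bondSwap z η) = bondCoeff γ ℓ h z η := by
  unfold bondCoeff
  congr 1
  · refine Finset.sum_congr rfl fun u hu => ?_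
    by_cases hz : z ∈ punc n ℓ u ∧ z + 1 ∈ punc n ℓ u
    · rw [punc_eq_erase, Finset.mem_erase, Finset.mem_erase] at hz
      rw [spin_bondSwap_of_ne η h1 h2 hz.1.1.symm hz.2.1.symm]
    · rw [flow_pairSource_eq_zero hℓ hn hu hz]
      ring
  · refine Finset.sum_congr rfl fun u hu => ?_
    by_cases hz : z ∈ box n ℓ u ∧ z + 1 ∈ box n ℓ u
    · rw [boxMean_bondSwap η h1 h2 hz.1 hz.2]
    · rw [flow_pointSource_eq_zero (by omega) hn hu hz]
      ring

/-- The two-step replacement: products of two spins are moved to products of a spin with a box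
average, and these to squares of box averages. -/
lemma sum_pairs_eq (η : Config n) (hℓ : 2 ≤ ℓ) (hn : 2 * ℓ ≤ n) (h : ℤ → ℝ) :
    ∑ u ∈ sites n, ∑ w ∈ nbrs n ℓ u, h u * rho γ |w - u| * (spin η u * spin η w) =
      ∑ z ∈ Finset.Ioo 0 ((n : ℤ) - 1), bondCoeff γ ℓ h z η * (spin η z - spin η (z + 1)) +
        ∑ u ∈ sites n, h u * (mass γ n ℓ u * (ℓ / ((ℓ : ℝ) - 1))) *
          (boxMean ℓ η u ^ 2 - 1 / (4 * (ℓ : ℝ))) := by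
  have h1 : ∑ z ∈ Finset.Ioo 0 ((n : ℤ) - 1), bondCoeff γ ℓ h z η * (spin η z - spin η (z + 1)) =
      ∑ u ∈ sites n, (h u * spin η u * ∑ z ∈ Finset.Ioo 0 ((n : ℤ) - 1),
          flow (pairSource γ n ℓ u) z * (spin η z - spin η (z + 1)) +
        h u * (mass γ n ℓ u * (ℓ / ((ℓ : ℝ) - 1))) * boxMean ℓ η u *
          ∑ z ∈ Finset.Ioo 0 ((n : ℤ) - 1),
            flow (pointSource n ℓ u) z * (spin η z - spin η (z + 1))) := by
    simp only [bondCoeff, ← Finset.sum_add_distrib, Finset.sum_mul, Finset.mul_sum]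
    rw [Finset.sum_comm]
    refine Finset.sum_congr rfl fun u _ => Finset.sum_congr rfl fun z _ => ?_
    ring
  rw [h1, ← Finset.sum_add_distrib]
  refine Finset.sum_congr rfl fun u hu => ?_
  rw [sum_flow_pairSource η hℓ hn hu, sum_flow_pointSource η (by omega) hn hu]
  have h2 : (2 : ℝ) ≤ ℓ := by exact_mod_cast hℓ
  have h3 : (ℓ : ℝ) - 1 ≠ 0 := by linarith
  have h4 : (ℓ : ℝ) ≠ 0 := by linarith
  have h5 := spin_sq η hu
  have h6 : ∑ w ∈ nbrs n ℓ u, h u * rho γ |w - u| * (spin η u * spin η w) =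
      h u * spin η u * ∑ w ∈ nbrs n ℓ u, rho γ |w - u| * spin η w := by
    rw [Finset.mul_sum]
    exact Finset.sum_congr rfl fun w _ => by ring
  rw [h6]
  -- the term `w = u` of the box average, `η̄_u² / ℓ = 1 / (4 ℓ)`, is the centring of the square
  field_simp
  linear_combination (-4 * h u * mass γ n ℓ u) * h5

/-- The energy of the flows. Each bond belongs to the boxes of at most `2ℓ` sites; the box average
has variance of order `1/ℓ`, which compensates for the correlations between these boxes. -/
lemma sum_bondCoeff_sq_le {M : ℝ} (hℓ : 2 ≤ ℓ) (hn : 2 * ℓ ≤ n) (h : ℤ → ℝ)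
    (hM : ∀ u ∈ sites n, mass γ n ℓ u ≤ M) :
    ∑ z ∈ Finset.Ioo 0 ((n : ℤ) - 1), ∑ η : Config n, bondCoeff γ ℓ h z η ^ 2 ≤
      Fintype.card (Config n) * (5 * M ^ 2 * ℓ * ∑ u ∈ sites n, h u ^ 2) := by
  have hc := card_config_pos n
  set c := (Fintype.card (Config n) : ℝ)
  have h2 : (2 : ℝ) ≤ ℓ := by exact_mod_cast hℓ
  have hℓ0 : (0 : ℝ) < ℓ := by linarith
  have hlam : (ℓ : ℝ) / (ℓ - 1) ≤ 2 := by rw [div_le_iff₀ (by linarith)]; linarith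
  have hlam0 : 0 ≤ (ℓ : ℝ) / (ℓ - 1) := div_nonneg hℓ0.le (by linarith)
  -- the contribution of the products of two spins
  have hA : ∀ z, ∑ η : Config n,
      (∑ u ∈ sites n, h u * flow (pairSource γ n ℓ u) z * spin η u) ^ 2 ≤
      c * (1 / 4 * ∑ u ∈ sites n, if z ∈ box n ℓ u then h u ^ 2 * M ^ 2 else 0) := by
    intro z
    refine (sum_linear_sq_le (n := n) (sites n)
      (fun u => h u * flow (pairSource γ n ℓ u) z)).trans ?_
    gcongr with u hu
    split_ifs with hz
    · rw [mul_pow]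
      refine mul_le_mul_of_nonneg_left (sq_le_sq' ?_ ?_) (sq_nonneg _) <;>
      · have := abs_le.1 ((abs_flow_pairSource_le hℓ z).trans (hM u hu))
        linarith
    · rw [flow_pairSource_eq_zero hℓ hn hu fun h => hz (punc_subset_box h.1)]
      simp
  -- the contribution of the products of a spin with a box average
  have hB : ∀ z, ∑ η : Config n, (∑ u ∈ sites n, h u * (mass γ n ℓ u * (ℓ / ((ℓ : ℝ) - 1))) *
      flow (pointSource n ℓ u) z * boxMean ℓ η u) ^ 2 ≤
      c * (2 * ∑ u ∈ sites n, if z ∈ box n ℓ u then h u ^ 2 * M ^ 2 else 0) := by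
    intro z
    set v : ℤ → ℝ := fun u => h u * (mass γ n ℓ u * (ℓ / ((ℓ : ℝ) - 1))) *
      flow (pointSource n ℓ u) z with hv
    set S : Finset ℤ := {u ∈ sites n | z ∈ box n ℓ u} with hS
    have hv0 : ∀ u ∈ sites n, z ∉ box n ℓ u → v u = 0 := fun u hu hz => by
      simp only [hv]
      rw [flow_pointSource_eq_zero (by omega) hn hu fun h => hz h.1, mul_zero]
    have hvsq : ∀ u ∈ sites n, v u ^ 2 ≤ 4 * (h u ^ 2 * M ^ 2) := fun u hu => by
      have h3 := abs_le.1 (abs_flow_pointSource_le (n := n) (u := u) (by omega : 1 ≤ ℓ) z)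
      have h4 : flow (pointSource n ℓ u) z ^ 2 ≤ 1 := by nlinarith
      have h5 : (mass γ n ℓ u * (ℓ / ((ℓ : ℝ) - 1))) ^ 2 ≤ (M * 2) ^ 2 :=
        pow_le_pow_left₀ (mul_nonneg (mass_nonneg _ _ _ _) hlam0)
          (mul_le_mul (hM u hu) hlam hlam0 ((mass_nonneg _ _ _ _).trans (hM u hu))) 2
      calc v u ^ 2 = h u ^ 2 * (mass γ n ℓ u * (ℓ / ((ℓ : ℝ) - 1))) ^ 2 *
            flow (pointSource n ℓ u) z ^ 2 := by simp only [hv]; ring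
        _ ≤ h u ^ 2 * (M * 2) ^ 2 * 1 := by gcongr
        _ = 4 * (h u ^ 2 * M ^ 2) := by ring
    have hcard : (S.card : ℝ) ≤ 2 * ℓ := by
      have h3 : S ⊆ Finset.Ioo (z - ℓ) (z + ℓ) := by
        intro u hu
        have := abs_lt.1 (abs_sub_lt_of_mem_box (Finset.mem_filter.1 hu).2)
        rw [Finset.mem_Ioo]
        omega
      have h4 := Finset.card_le_card h3
      rw [Int.card_Ioo] at h4
      exact_mod_cast (by omega : S.card ≤ 2 * ℓ)
    have hsum : ∀ η : Config n, (∑ u ∈ sites n, v u * boxMean ℓ η u) ^ 2 ≤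
        2 * ℓ * ∑ u ∈ S, v u ^ 2 * boxMean ℓ η u ^ 2 := fun η => by
      have h3 : ∑ u ∈ sites n, v u * boxMean ℓ η u = ∑ u ∈ S, v u * boxMean ℓ η u := by
        rw [hS, Finset.sum_filter]
        refine Finset.sum_congr rfl fun u hu => ?_
        split_ifs with hz
        · rfl
        · rw [hv0 u hu hz, zero_mul]
      rw [h3]
      refine sq_sum_le_card_mul_sum_sq.trans ?_
      simp only [mul_pow]
      exact mul_le_mul_of_nonneg_right hcard (Finset.sum_nonneg fun _ _ => by positivity)
    calc ∑ η : Config n, (∑ u ∈ sites n, v u * boxMean ℓ η u) ^ 2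
        ≤ ∑ η : Config n, 2 * ℓ * ∑ u ∈ S, v u ^ 2 * boxMean ℓ η u ^ 2 :=
          Finset.sum_le_sum fun η _ => hsum η
      _ = 2 * ℓ * ∑ u ∈ S, v u ^ 2 * ∑ η : Config n, boxMean ℓ η u ^ 2 := by
          rw [← Finset.mul_sum, Finset.sum_comm]
          simp only [Finset.mul_sum]
      _ ≤ 2 * ℓ * ∑ u ∈ S, (4 * (h u ^ 2 * M ^ 2)) * (c * (1 / (4 * (ℓ : ℝ)))) := by
          gcongr with u hu
          · exact hvsq u (Finset.mem_filter.1 hu).1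
          · exact sum_boxMean_sq_le (by omega)
      _ = c * (2 * ∑ u ∈ sites n, if z ∈ box n ℓ u then h u ^ 2 * M ^ 2 else 0) := by
          rw [← Finset.sum_filter, ← Finset.sum_mul, ← Finset.mul_sum]
          field_simp
          exact Finset.sum_congr rfl fun _ _ => by ring
  have hC : ∀ z, ∑ η : Config n, bondCoeff γ ℓ h z η ^ 2 ≤
      c * (5 * ∑ u ∈ sites n, if z ∈ box n ℓ u then h u ^ 2 * M ^ 2 else 0) := by
    intro z
    have h3 : ∀ η : Config n, bondCoeff γ ℓ h z η ^ 2 ≤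
        2 * (∑ u ∈ sites n, h u * flow (pairSource γ n ℓ u) z * spin η u) ^ 2 +
        2 * (∑ u ∈ sites n, h u * (mass γ n ℓ u * (ℓ / ((ℓ : ℝ) - 1))) *
          flow (pointSource n ℓ u) z * boxMean ℓ η u) ^ 2 := fun η => by
      unfold bondCoeff
      nlinarith [sq_nonneg ((∑ u ∈ sites n, h u * flow (pairSource γ n ℓ u) z * spin η u) -
        ∑ u ∈ sites n, h u * (mass γ n ℓ u * (ℓ / ((ℓ : ℝ) - 1))) *
          flow (pointSource n ℓ u) z * boxMean ℓ η u)]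
    have h4 := Finset.sum_le_sum fun η (_ : η ∈ Finset.univ) => h3 η
    rw [Finset.sum_add_distrib, ← Finset.mul_sum, ← Finset.mul_sum] at h4
    have h5 := hA z
    have h6 := hB z
    have h7 : 0 ≤ c * ∑ u ∈ sites n, if z ∈ box n ℓ u then h u ^ 2 * M ^ 2 else 0 :=
      mul_nonneg hc.le (Finset.sum_nonneg fun u _ => by split_ifs <;> positivity)
    nlinarith
  refine (Finset.sum_le_sum fun z _ => hC z).trans ?_
  rw [← Finset.mul_sum, ← Finset.mul_sum, Finset.sum_comm]
  have h3 : ∑ u ∈ sites n, ∑ z ∈ Finset.Ioo 0 ((n : ℤ) - 1),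
      (if z ∈ box n ℓ u then h u ^ 2 * M ^ 2 else 0) ≤ ∑ u ∈ sites n, ℓ * (h u ^ 2 * M ^ 2) := by
    refine Finset.sum_le_sum fun u _ => ?_
    rw [← Finset.sum_filter, Finset.sum_const, nsmul_eq_mul, Finset.filter_mem_eq_inter]
    refine mul_le_mul_of_nonneg_right ?_ (by positivity)
    have := Finset.card_le_card (Finset.inter_subset_right
      (s₁ := Finset.Ioo 0 ((n : ℤ) - 1)) (s₂ := box n ℓ u))
    rw [card_box] at this
    exact_mod_cast this
  refine mul_le_mul_of_nonneg_left ?_ hc.le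
  rw [← Finset.mul_sum, ← Finset.sum_mul] at h3
  nlinarith

end Flows

/-! ### The quadratic term as a sum over anchored pairs -/

/-- The anchored pairs `(u, w)`: each pair of distinct sites occurs in exactly one order. -/
def anchoredPairs (n ℓ : ℕ) : Finset (ℤ × ℤ) := {p ∈ sites n ×ˢ sites n | selects n ℓ p.1 p.2}

/-- The coefficient of a pair of sites in the rescaled quadratic term; it is symmetric in `u, w`. -/
def pairCoeff (γ : ℝ) (n : ℕ) (H : ℝ → ℝ) (u w : ℤ) : ℝ :=
  n * (2 * antiRate γ (w - u)) * (H (w / n) - H (u / n))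

/-- The size `n^(θ - 3/2)` of the quadratic term relative to the critical case `θ = 3/2`. -/
def scale (θ : ℝ) (n : ℕ) : ℝ := (n : ℝ) ^ θ / √(n : ℝ) / n

lemma cocc_eq_spin {n : ℕ} (η : Config n) (x : sites n) : cocc η x = spin η x := by
  simp [spin]

lemma pairCoeff_symm (γ : ℝ) (n : ℕ) (H : ℝ → ℝ) (u w : ℤ) :
    pairCoeff γ n H u w = pairCoeff γ n H w u := by
  unfold pairCoeff antiRate
  rw [neg_sub, neg_sub]
  ring

lemma selects_ne {n ℓ : ℕ} {u w : ℤ} (h : selects n ℓ u w) : u ≠ w := by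
  unfold selects at h; omega

lemma sum_eq_two_mul_sum_anchoredPairs (n ℓ : ℕ) (f : ℤ × ℤ → ℝ) (hf : ∀ p, f p.swap = f p)
    (hf0 : ∀ u, f (u, u) = 0) :
    ∑ p ∈ sites n ×ˢ sites n, f p = 2 * ∑ p ∈ anchoredPairs n ℓ, f p := by
  rw [← Finset.sum_filter_add_sum_filter_not _ fun p : ℤ × ℤ => selects n ℓ p.1 p.2]
  have h1 : ∑ p ∈ sites n ×ˢ sites n with ¬selects n ℓ p.1 p.2, f p =
      ∑ p ∈ sites n ×ˢ sites n with selects n ℓ p.2 p.1, f p := by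
    refine (Finset.sum_subset (fun p hp => ?_) fun p hp hp' => ?_).symm
    · rw [Finset.mem_filter] at hp ⊢
      refine ⟨hp.1, fun h => ?_⟩
      have := hp.2
      unfold selects at this h
      omega
    · rw [Finset.mem_filter] at hp hp'
      have h2 : p.1 = p.2 := by
        by_contra hne
        apply hp'
        refine ⟨hp.1, ?_⟩
        have := hp.2
        unfold selects at this ⊢
        omega
      obtain ⟨x, y⟩ := p
      obtain rfl : x = y := h2
      exact hf0 x
  have h2 : ∑ p ∈ sites n ×ˢ sites n with selects n ℓ p.2 p.1, f p =
      ∑ p ∈ anchoredPairs n ℓ, f p := by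
    refine Finset.sum_nbij' Prod.swap Prod.swap ?_ ?_ ?_ ?_ ?_ <;>
      simp +contextual [anchoredPairs, hf]
  rw [h1, h2, anchoredPairs]
  ring

lemma quadTerm_eq (θ γ : ℝ) {n : ℕ} (hn : 0 < n) (ℓ : ℕ) (H : ℝ → ℝ) (η : Config n) :
    quadTerm θ γ n H η = -scale θ n * ∑ p ∈ anchoredPairs n ℓ,
      pairCoeff γ n H p.1 p.2 * (spin η p.1 * spin η p.2) := by
  have hn' : (n : ℝ) ≠ 0 := by positivity
  have h1 : ∑ x : sites n, ∑ y : sites n, antiRate γ (y - x) *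
      (H (((y : ℤ) : ℝ) / n) - H (((x : ℤ) : ℝ) / n)) * cocc η x * cocc η y =
      ∑ x ∈ sites n, ∑ y ∈ sites n, antiRate γ (y - x) *
        (H ((y : ℝ) / n) - H ((x : ℝ) / n)) * spin η x * spin η y := by
    simp only [cocc_eq_spin]
    rw [← Finset.sum_coe_sort (sites n)]
    refine Finset.sum_congr rfl fun x _ => ?_
    rw [← Finset.sum_coe_sort (sites n)]
  have h2 := sum_eq_two_mul_sum_anchoredPairs n ℓ
    (fun p => pairCoeff γ n H p.1 p.2 * (spin η p.1 * spin η p.2))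
    (fun p => by simp only [Prod.fst_swap, Prod.snd_swap]; rw [pairCoeff_symm]; ring)
    (fun u => by simp [pairCoeff])
  have h3 : ∑ x ∈ sites n, ∑ y ∈ sites n, antiRate γ (y - x) *
        (H ((y : ℝ) / n) - H ((x : ℝ) / n)) * spin η x * spin η y =
      1 / (2 * n) * ∑ p ∈ sites n ×ˢ sites n,
        pairCoeff γ n H p.1 p.2 * (spin η p.1 * spin η p.2) := by
    rw [Finset.sum_product, Finset.mul_sum]
    refine Finset.sum_congr rfl fun x _ => ?_
    rw [Finset.mul_sum]
    refine Finset.sum_congr rfl fun y _ => ?_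
    unfold pairCoeff
    field_simp
  rw [quadTerm, h1, h3, h2, scale]
  field_simp

lemma occZ_eq {n : ℕ} (η : Config n) {z : ℤ} (hz : z ∈ sites n) :
    occZ η z = spin η z + 1 / 2 := by
  simp [occZ, spin, hz, cocc]

lemma boxAvg_eq {n ℓ : ℕ} (hℓ : 1 ≤ ℓ) (hn : 2 * ℓ ≤ n) (η : Config n) (x : sites n) :
    boxAvg ℓ η x - 1 / 2 = boxMean ℓ η x := by
  have hℓ' : (ℓ : ℝ) ≠ 0 := by positivity
  have h1 : ∑ w ∈ box n ℓ x, (spin η w + 1 / 2) =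
      if (x : ℤ) ≤ (n : ℤ) - ℓ - 1 then ∑ y ∈ Finset.range ℓ, occZ η (x + y)
      else ∑ y ∈ Finset.range ℓ, occZ η (x - y) := by
    rw [Finset.sum_congr rfl fun w hw => (occZ_eq η (box_subset hn x.2 hw)).symm]
    split_ifs with h
    · refine Finset.sum_nbij' (fun w => (w - x).toNat) (fun y => x + y) ?_ ?_ ?_ ?_ ?_
      all_goals
        intro w hw
        simp only [box, boxStart, Finset.mem_Ico, Finset.mem_range,
          if_pos (by omega : (x : ℤ) < n - ℓ)] at hw ⊢
      · omega
      · omega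
      · omega
      · omega
      · rw [Int.toNat_of_nonneg (by omega)]
        congr 1
        ring
    · refine Finset.sum_nbij' (fun w => (x - w).toNat) (fun y => x - y) ?_ ?_ ?_ ?_ ?_
      all_goals
        intro w hw
        simp only [box, boxStart, Finset.mem_Ico, Finset.mem_range,
          if_neg (by omega : ¬(x : ℤ) < n - ℓ)] at hw ⊢
      · omega
      · omega
      · omega
      · omega
      · rw [Int.toNat_of_nonneg (by omega)]
        congr 1
        ring
  rw [Finset.sum_add_distrib, Finset.sum_const, card_box, nsmul_eq_mul] at h1
  have h2 : boxAvg ℓ η x = 1 / (ℓ : ℝ) * (∑ w ∈ box n ℓ x, spin η w + ℓ * (1 / 2)) := by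
    rw [h1, boxAvg]
    split_ifs <;> rfl
  rw [h2, boxMean]
  field_simp
  ring

lemma boxSquareSum_eq {n ℓ : ℕ} (hℓ : 1 ≤ ℓ) (hn : 2 * ℓ ≤ n) (H : ℝ → ℝ) (η : Config n) :
    boxSquareSum n ℓ H η =
      ∑ u ∈ sites n, grad H (u / n) * (boxMean ℓ η u ^ 2 - 1 / (4 * (ℓ : ℝ))) := by
  unfold boxSquareSum
  simp only [boxAvg_eq hℓ hn]
  rw [← Finset.sum_coe_sort (sites n)]
  exact Finset.sum_congr rfl fun x _ => mul_comm _ _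

/-- What remains of the rescaled quadratic term after the replacement by squares of box averages:
the Taylor and truncation errors, and the mass missing near the right end of the lattice. -/
def remainder (γ : ℝ) {n : ℕ} (ℓ : ℕ) (H : ℝ → ℝ) (η : Config n) : ℝ :=
  -∑ p ∈ anchoredPairs n ℓ, (pairCoeff γ n H p.1 p.2 -
      if |p.2 - p.1| < ℓ then grad H (p.1 / n) * rho γ |p.2 - p.1| else 0) *
        (spin η p.1 * spin η p.2) +
    ∑ u ∈ sites n, grad H (u / n) * (meanRate γ - mass γ n ℓ u * (ℓ / ((ℓ : ℝ) - 1))) *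
      (boxMean ℓ η u ^ 2 - 1 / (4 * (ℓ : ℝ)))

/-- The decomposition into gradients and a part that is bounded in `L²`. The parameter `b` is `1` if
the square of the box average is subtracted, and `0` otherwise. -/
lemma quadTerm_add_eq (θ γ b : ℝ) {n ℓ : ℕ} (hℓ : 2 ≤ ℓ) (hn : 2 * ℓ ≤ n) (H : ℝ → ℝ)
    (η : Config n) :
    quadTerm θ γ n H η + b * (scale θ n * (meanRate γ * boxSquareSum n ℓ H η)) =
      ∑ z ∈ Finset.Ioo 0 ((n : ℤ) - 1),
        (-scale θ n * bondCoeff γ ℓ (fun u => grad H (u / n)) z η) * (spin η z - spin η (z + 1)) +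
      scale θ n * (remainder γ ℓ H η + (b - 1) * (meanRate γ * boxSquareSum n ℓ H η)) := by
  have h1 := sum_pairs_eq (γ := γ) η hℓ hn fun u => grad H (u / n)
  have h2 : ∑ p ∈ anchoredPairs n ℓ, (if |p.2 - p.1| < ℓ then
      grad H (p.1 / n) * rho γ |p.2 - p.1| else 0) * (spin η p.1 * spin η p.2) =
      ∑ u ∈ sites n, ∑ w ∈ nbrs n ℓ u, grad H (u / n) * rho γ |w - u| * (spin η u * spin η w) := by
    rw [anchoredPairs, Finset.sum_filter, Finset.sum_product]
    refine Finset.sum_congr rfl fun u _ => ?_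
    rw [nbrs, Finset.sum_filter]
    refine Finset.sum_congr rfl fun w _ => ?_
    by_cases h3 : selects n ℓ u w <;> by_cases h4 : |w - u| < ℓ <;> simp [h3, h4]
  have h3 : ∑ z ∈ Finset.Ioo 0 ((n : ℤ) - 1),
        (-scale θ n * bondCoeff γ ℓ (fun u => grad H (u / n)) z η) * (spin η z - spin η (z + 1)) =
      -scale θ n * ∑ z ∈ Finset.Ioo 0 ((n : ℤ) - 1),
        bondCoeff γ ℓ (fun u => grad H (u / n)) z η * (spin η z - spin η (z + 1)) := by
    rw [Finset.mul_sum]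
    exact Finset.sum_congr rfl fun z _ => by ring
  rw [h3, quadTerm_eq θ γ (by omega) ℓ, boxSquareSum_eq (by omega) hn, remainder]
  simp only [sub_mul, mul_sub, Finset.sum_sub_distrib] at h1 h2 ⊢
  rw [h2, h1]
  have h4 : ∀ f : ℤ → ℝ, ∑ u ∈ sites n, grad H (u / n) * meanRate γ * f u =
      meanRate γ * ∑ u ∈ sites n, grad H (u / n) * f u := fun f => by
    rw [Finset.mul_sum]
    exact Finset.sum_congr rfl fun u _ => by ring
  rw [h4, h4 fun _ => 1 / (4 * (ℓ : ℝ))]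
  ring

/-! ### Sums of the jump weights -/

lemma rho_of_pos {γ : ℝ} (hγ : 0 < γ) {k : ℤ} (hk : 0 < k) : rho γ k = (k : ℝ) ^ (-γ) := by
  have hk' : (0 : ℝ) < k := by exact_mod_cast hk
  rw [rho, asymRate, if_pos hk, abs_of_pos hk', ← Real.rpow_one_add' hk'.le]
  · congr 1
    ring
  · linarith

/-- The partial sums of the series `m = ∑ k^{-γ}`. -/
def partialMass (γ : ℝ) (j : ℕ) : ℝ := ∑ k ∈ Finset.range j, rho γ ((k : ℤ) + 1)

lemma hasSum_rho {γ : ℝ} (hγ : 1 < γ) :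
    HasSum (fun k : ℕ => rho γ ((k : ℤ) + 1)) (meanRate γ) := by
  have hinj : Function.Injective fun k : ℕ => (k : ℤ) + 1 := fun a b h => by
    simp only at h; omega
  have hsupp : ∀ z ∉ Set.range fun k : ℕ => (k : ℤ) + 1, rho γ z = 0 := fun z hz => by
    have : ¬0 < z := fun h => hz ⟨(z - 1).toNat, by simp only; omega⟩
    simp [rho, asymRate, this]
  have h1 : Summable fun k : ℕ => rho γ ((k : ℤ) + 1) := by
    have h2 := (summable_nat_add_iff 1).2 (Real.summable_nat_rpow.2 (by linarith : -γ < -1))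
    refine h2.congr fun k => ?_
    rw [rho_of_pos (by linarith) (by omega)]
    push_cast
    rfl
  have h2 := (hinj.hasSum_iff hsupp).1 h1.hasSum
  have h3 : meanRate γ = ∑' z, rho γ z := rfl
  rw [h3, h2.tsum_eq]
  exact h1.hasSum

lemma partialMass_le {γ : ℝ} (hγ : 1 < γ) (j : ℕ) : partialMass γ j ≤ meanRate γ :=
  sum_le_hasSum _ (fun _ _ => rho_nonneg _ _) (hasSum_rho hγ)

lemma meanRate_nonneg {γ : ℝ} (hγ : 1 < γ) : 0 ≤ meanRate γ :=
  (partialMass_le hγ 0).trans' (by simp [partialMass])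

lemma partialMass_mono (γ : ℝ) : Monotone (partialMass γ) := fun _ _ hij =>
  Finset.sum_le_sum_of_subset_of_nonneg (Finset.range_mono hij) fun _ _ _ => rho_nonneg _ _

/-- Around a fixed anchor, a pair is determined by its diameter. -/
lemma sum_selects_le {n ℓ : ℕ} {u : ℤ} (hu : u ∈ sites n) (f : ℤ → ℝ) (hf : ∀ k, 0 ≤ f k) :
    ∑ w ∈ sites n with selects n ℓ u w, f |w - u| ≤ ∑ k ∈ Finset.range n, f ((k : ℤ) + 1) := by
  have h1 : Set.InjOn (fun w => (|w - u| - 1).toNat) {w | selects n ℓ u w} := by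
    intro w hw w' hw' h
    simp only [Set.mem_ofPred_eq, selects] at hw hw' h
    rcases abs_cases (w - u) with h1 | h1 <;> rcases abs_cases (w' - u) with h2 | h2 <;> omega
  have h2 : ∑ w ∈ sites n with selects n ℓ u w, f |w - u| =
      ∑ k ∈ ({w ∈ sites n | selects n ℓ u w}).image fun w => (|w - u| - 1).toNat,
        f ((k : ℤ) + 1) := by
    rw [Finset.sum_image fun w hw w' hw' h => h1 (by simpa using (Finset.mem_filter.1 hw).2)
      (by simpa using (Finset.mem_filter.1 hw').2) h]
    refine Finset.sum_congr rfl fun w hw => ?_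
    have h3 := selects_ne (Finset.mem_filter.1 hw).2
    congr 1
    rcases abs_cases (w - u) with h1 | h1 <;> omega
  rw [h2]
  refine Finset.sum_le_sum_of_subset_of_nonneg (fun k hk => ?_) fun _ _ _ => hf _
  obtain ⟨w, hw, rfl⟩ := Finset.mem_image.1 hk
  have h3 := selects_ne (Finset.mem_filter.1 hw).2
  have h4 := (Finset.mem_filter.1 hw).1
  simp only [sites, Finset.mem_Ioo] at hu h4
  rw [Finset.mem_range]
  rcases abs_cases (w - u) with h1 | h1 <;> omega

/-- In the bulk all diameters `1, …, ℓ - 1` occur, whereas near the right end, where the anchors are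
the larger points, the partner must stay at distance at most `ℓ` from the end. -/
lemma mass_eq {γ : ℝ} {n ℓ : ℕ} {u : ℤ} (hu : u ∈ sites n) (hn : 2 * ℓ ≤ n) :
    mass γ n ℓ u = partialMass γ (if u < n - ℓ then ℓ - 1 else (u - (n - ℓ)).toNat) := by
  simp only [sites, Finset.mem_Ioo] at hu
  unfold mass partialMass
  split_ifs with h
  · refine Finset.sum_nbij' (fun w => (w - u - 1).toNat) (fun k => u + k + 1) ?_ ?_ ?_ ?_ ?_
    all_goals
      intro w hw
      simp only [nbrs, selects, sites, Finset.mem_filter, Finset.mem_Ioo, Finset.mem_range,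
        abs_lt] at hw ⊢
    · omega
    · omega
    · omega
    · omega
    · congr 1
      rw [abs_of_nonneg] <;> omega
  · refine Finset.sum_nbij' (fun w => (u - w - 1).toNat) (fun k => u - k - 1) ?_ ?_ ?_ ?_ ?_
    all_goals
      intro w hw
      simp only [nbrs, selects, sites, Finset.mem_filter, Finset.mem_Ioo, Finset.mem_range,
        abs_lt] at hw ⊢
    · omega
    · omega
    · omega
    · omega
    · congr 1
      rw [abs_of_nonpos] <;> omega

lemma mass_le {γ : ℝ} (hγ : 1 < γ) {n ℓ : ℕ} {u : ℤ} (hu : u ∈ sites n) (hn : 2 * ℓ ≤ n) :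
    mass γ n ℓ u ≤ meanRate γ := by
  rw [mass_eq hu hn]
  exact partialMass_le hγ _

/-- The sum of the tails of the series `m = ∑ k^{-γ}`. -/
def tailSum (γ : ℝ) (ℓ : ℕ) : ℝ := ∑ j ∈ Finset.range ℓ, (meanRate γ - partialMass γ j)

lemma tailSum_nonneg {γ : ℝ} (hγ : 1 < γ) (ℓ : ℕ) : 0 ≤ tailSum γ ℓ :=
  Finset.sum_nonneg fun j _ => sub_nonneg.2 (partialMass_le hγ j)

lemma sum_meanRate_sub_mass_le {γ : ℝ} (hγ : 1 < γ) {n ℓ : ℕ} (hℓ : 2 ≤ ℓ) (hn : 2 * ℓ ≤ n) :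
    ∑ u ∈ sites n, (meanRate γ - mass γ n ℓ u) ≤ (n / ℓ + 1) * tailSum γ ℓ := by
  have hℓ0 : (0 : ℝ) < ℓ := by positivity
  have h1 : sites n = Finset.Ioo 0 ((n : ℤ) - ℓ) ∪ Finset.Ico ((n : ℤ) - ℓ) n := by
    ext w; simp only [sites, Finset.mem_union, Finset.mem_Ioo, Finset.mem_Ico]; omega
  have h2 : Disjoint (Finset.Ioo 0 ((n : ℤ) - ℓ)) (Finset.Ico ((n : ℤ) - ℓ) n) := by
    rw [Finset.disjoint_left]; intro w; simp only [Finset.mem_Ioo, Finset.mem_Ico]; omega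
  -- in the bulk the defect is the last, hence the smallest, of the `ℓ` terms of `tailSum`
  have h3 : ∑ u ∈ Finset.Ioo 0 ((n : ℤ) - ℓ), (meanRate γ - mass γ n ℓ u) ≤
      n / ℓ * tailSum γ ℓ := by
    have h4 : ∀ u ∈ Finset.Ioo 0 ((n : ℤ) - ℓ), meanRate γ - mass γ n ℓ u ≤
        tailSum γ ℓ / ℓ := fun u hu => by
      have hu' : u ∈ sites n := by rw [h1]; exact Finset.mem_union_left _ hu
      rw [mass_eq hu' hn, if_pos (Finset.mem_Ioo.1 hu).2, le_div_iff₀ hℓ0, mul_comm,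
        ← nsmul_eq_mul, ← Finset.card_range ℓ, ← Finset.sum_const, tailSum, Finset.card_range]
      refine Finset.sum_le_sum fun j hj => sub_le_sub_left (partialMass_mono γ ?_) _
      have := Finset.mem_range.1 hj
      omega
    refine (Finset.sum_le_sum h4).trans ?_
    rw [Finset.sum_const, nsmul_eq_mul, div_mul_eq_mul_div, ← mul_div_assoc]
    have h5 : ((Finset.Ioo 0 ((n : ℤ) - ℓ)).card : ℝ) ≤ n := by
      rw [Int.card_Ioo]; exact_mod_cast (by omega : ((n : ℤ) - ℓ - 0 - 1).toNat ≤ n)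
    have := tailSum_nonneg hγ ℓ
    gcongr
  -- near the right end every partial sum occurs exactly once
  have h4 : ∑ u ∈ Finset.Ico ((n : ℤ) - ℓ) n, (meanRate γ - mass γ n ℓ u) = tailSum γ ℓ := by
    refine Finset.sum_nbij' (fun u => (u - (n - ℓ)).toNat) (fun j => n - ℓ + j) ?_ ?_ ?_ ?_ ?_
    all_goals
      intro w hw
      simp only [Finset.mem_Ico, Finset.mem_range] at hw ⊢
    · omega
    · omega
    · omega
    · omega
    · rw [mass_eq (by simp only [sites, Finset.mem_Ioo]; omega) hn, if_neg (by omega)]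
  rw [h1, Finset.sum_union h2, h4]
  linarith

lemma sum_abs_mass_defect_le {γ : ℝ} (hγ : 1 < γ) {n ℓ : ℕ} (hℓ : 2 ≤ ℓ) (hn : 2 * ℓ ≤ n) :
    ∑ u ∈ sites n, |meanRate γ - mass γ n ℓ u * (ℓ / ((ℓ : ℝ) - 1))| ≤
      (n / ℓ + 1) * tailSum γ ℓ + n * (meanRate γ / ((ℓ : ℝ) - 1)) := by
  have h2 : (2 : ℝ) ≤ ℓ := by exact_mod_cast hℓ
  have h3 : (0 : ℝ) < (ℓ : ℝ) - 1 := by linarith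
  have h4 : ∀ u ∈ sites n, |meanRate γ - mass γ n ℓ u * (ℓ / ((ℓ : ℝ) - 1))| ≤
      (meanRate γ - mass γ n ℓ u) + meanRate γ / ((ℓ : ℝ) - 1) := fun u hu => by
    have h5 := mass_le hγ hu hn
    have h6 := mass_nonneg γ n ℓ u
    have h7 : mass γ n ℓ u * (ℓ / ((ℓ : ℝ) - 1)) = mass γ n ℓ u + mass γ n ℓ u / ((ℓ : ℝ) - 1) := by
      field_simp
      ring
    have h8 : mass γ n ℓ u / ((ℓ : ℝ) - 1) ≤ meanRate γ / ((ℓ : ℝ) - 1) := by gcongr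
    have h9 : 0 ≤ mass γ n ℓ u / ((ℓ : ℝ) - 1) := by positivity
    rw [h7, abs_le]
    constructor <;> linarith
  refine (Finset.sum_le_sum h4).trans ?_
  rw [Finset.sum_add_distrib, Finset.sum_const, nsmul_eq_mul]
  have h5 : ((sites n).card : ℝ) ≤ n := by
    rw [sites, Int.card_Ioo]; exact_mod_cast (by omega : ((n : ℤ) - 0 - 1).toNat ≤ n)
  have h6 := meanRate_nonneg hγ
  have h7 := sum_meanRate_sub_mass_le hγ hℓ hn
  have h8 : ((sites n).card : ℝ) * (meanRate γ / ((ℓ : ℝ) - 1)) ≤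
    n * (meanRate γ / ((ℓ : ℝ) - 1)) := by gcongr
  linarith

lemma tendsto_tailSum_div {γ : ℝ} (hγ : 1 < γ) :
    Tendsto (fun ℓ : ℕ => tailSum γ ℓ / ℓ) atTop (𝓝 0) := by
  have h1 : Tendsto (fun j => meanRate γ - partialMass γ j) atTop (𝓝 0) := by
    have := (hasSum_rho hγ).tendsto_sum_nat.const_sub (meanRate γ)
    rwa [sub_self] at this
  refine h1.cesaro.congr fun ℓ => ?_
  rw [tailSum, div_eq_inv_mul]

/-- The sum `∑ k ≤ n` of `(k · k^{-γ})²`. -/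
def weightSum (γ : ℝ) (n : ℕ) : ℝ :=
  ∑ k ∈ Finset.range n, ((((k : ℤ) + 1 : ℤ) : ℝ) * rho γ ((k : ℤ) + 1)) ^ 2

lemma tendsto_weightSum_div {γ : ℝ} (hγ : 1 < γ) :
    Tendsto (fun n : ℕ => weightSum γ n / n) atTop (𝓝 0) := by
  have h1 : Tendsto (fun k : ℕ => ((((k : ℤ) + 1 : ℤ) : ℝ) * rho γ ((k : ℤ) + 1)) ^ 2) atTop
      (𝓝 0) := by
    have h2 : Tendsto (fun x : ℝ => x ^ (-(γ - 1))) atTop (𝓝 0) :=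
      tendsto_rpow_neg_atTop (by linarith)
    have h3 : Tendsto (fun k : ℕ => ((k : ℝ) + 1) ^ (-(γ - 1))) atTop (𝓝 0) :=
      h2.comp (tendsto_atTop_add_const_right _ _ tendsto_natCast_atTop_atTop)
    have h4 := h3.pow 2
    rw [zero_pow two_ne_zero] at h4
    refine h4.congr fun k => ?_
    rw [rho_of_pos (by linarith) (by omega)]
    push_cast
    have h5 : (0 : ℝ) < (k : ℝ) + 1 := by positivity
    rw [← Real.rpow_one_add' h5.le]
    · congr 2
      ring
    · intro h; linarith
  refine h1.cesaro.congr fun ℓ => ?_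
  rw [weightSum, div_eq_inv_mul]

/-! ### Regularity of test functions and Riemann sums -/

/-- The only regularity of the test functions that matters: it is that of a `C²` function. -/
lemma IsTestFunction.exists_bound {H : ℝ → ℝ} (hH : IsTestFunction H) :
    ContinuousOn (grad H) (Set.Icc 0 1) ∧ ∃ C : ℝ, 0 ≤ C ∧
      (∀ u ∈ Set.Icc (0 : ℝ) 1, |grad H u| ≤ C) ∧
      (∀ u ∈ Set.Icc (0 : ℝ) 1, ∀ v ∈ Set.Icc (0 : ℝ) 1, |H v - H u| ≤ C * |v - u|) ∧
      (∀ u ∈ Set.Icc (0 : ℝ) 1, ∀ v ∈ Set.Icc (0 : ℝ) 1,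
        |H v - H u - (v - u) * grad H u| ≤ C * |v - u| ^ 2) ∧
      (∀ u ∈ Set.Icc (0 : ℝ) 1, ∀ v ∈ Set.Icc (0 : ℝ) 1,
        |grad H v ^ 2 - grad H u ^ 2| ≤ C * |v - u|) := by
  have hud : UniqueDiffOn ℝ (Set.Icc (0 : ℝ) 1) := uniqueDiffOn_Icc one_pos
  have h2 : ContDiffOn ℝ 2 H (Set.Icc 0 1) := hH.smooth.of_le (by norm_cast)
  have h1 : ContDiffOn ℝ 1 (grad H) (Set.Icc 0 1) := h2.derivWithin hud (by norm_num)
  have hd : DifferentiableOn ℝ H (Set.Icc 0 1) := h2.differentiableOn (by norm_num)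
  have hd1 : DifferentiableOn ℝ (grad H) (Set.Icc 0 1) := h1.differentiableOn (by norm_num)
  have hc2 : ContinuousOn (derivWithin (grad H) (Set.Icc 0 1)) (Set.Icc 0 1) :=
    h1.continuousOn_derivWithin hud (by norm_num)
  obtain ⟨A, hA⟩ := isCompact_Icc.exists_bound_of_continuousOn h1.continuousOn
  obtain ⟨B, hB⟩ := isCompact_Icc.exists_bound_of_continuousOn hc2
  have hA0 : 0 ≤ A := (norm_nonneg _).trans (hA 0 (by simp))
  have hB0 : 0 ≤ B := (norm_nonneg _).trans (hB 0 (by simp))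
  have hlip : ∀ u ∈ Set.Icc (0 : ℝ) 1, ∀ v ∈ Set.Icc (0 : ℝ) 1, |H v - H u| ≤ A * |v - u| :=
    fun u hu v hv =>
      (convex_Icc (0 : ℝ) 1).norm_image_sub_le_of_norm_derivWithin_le hd hA hu hv
  have hlip1 : ∀ u ∈ Set.Icc (0 : ℝ) 1, ∀ v ∈ Set.Icc (0 : ℝ) 1,
      |grad H v - grad H u| ≤ B * |v - u| := fun u hu v hv =>
    (convex_Icc (0 : ℝ) 1).norm_image_sub_le_of_norm_derivWithin_le hd1 hB hu hv
  have htaylor : ∀ u ∈ Set.Icc (0 : ℝ) 1, ∀ v ∈ Set.Icc (0 : ℝ) 1,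
      |H v - H u - (v - u) * grad H u| ≤ B * |v - u| ^ 2 := fun u hu v hv => by
    have hsub : Set.uIcc u v ⊆ Set.Icc (0 : ℝ) 1 := Set.uIcc_subset_Icc hu hv
    have h3 := (convex_uIcc u v).norm_image_sub_le_of_norm_hasDerivWithin_le
      (f := fun w => H w - w * grad H u) (f' := fun w => grad H w - grad H u) (C := B * |v - u|)
      (fun w hw => (((hd w (hsub hw)).hasDerivWithinAt.mono hsub).sub
        (((hasDerivAt_id w).hasDerivWithinAt.mul_const (grad H u)).congr_deriv (one_mul _))))
      (fun w hw => (hlip1 u hu w (hsub hw)).trans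
        (mul_le_mul_of_nonneg_left (Set.abs_sub_left_of_mem_uIcc hw)
          hB0))
      Set.left_mem_uIcc Set.right_mem_uIcc
    simp only [Real.norm_eq_abs] at h3
    rw [sq, ← mul_assoc]
    refine le_trans (le_of_eq ?_) h3
    congr 1
    ring
  refine ⟨h1.continuousOn, A + B + 2 * A * B, by positivity, fun u hu => ?_, fun u hu v hv => ?_,
    fun u hu v hv => ?_, fun u hu v hv => ?_⟩
  · have := hA u hu
    rw [Real.norm_eq_abs] at this
    nlinarith
  · refine (hlip u hu v hv).trans (mul_le_mul_of_nonneg_right (by nlinarith) (abs_nonneg _))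
  · refine (htaylor u hu v hv).trans (mul_le_mul_of_nonneg_right (by nlinarith) (sq_nonneg _))
  · have h3 : |grad H v + grad H u| ≤ 2 * A := by
      have a1 := hA u hu
      have a2 := hA v hv
      rw [Real.norm_eq_abs] at a1 a2
      exact (abs_add_le _ _).trans (by linarith)
    rw [sq_sub_sq, abs_mul]
    calc |grad H v + grad H u| * |grad H v - grad H u| ≤ 2 * A * (B * |v - u|) :=
          mul_le_mul h3 (hlip1 u hu v hv) (abs_nonneg _) (by positivity)
      _ = 2 * A * B * |v - u| := by ring
      _ ≤ (A + B + 2 * A * B) * |v - u| :=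
          mul_le_mul_of_nonneg_right (by linarith) (abs_nonneg _)

lemma div_mem_Icc {n : ℕ} {u : ℤ} (hu : u ∈ sites n) : (u : ℝ) / n ∈ Set.Icc (0 : ℝ) 1 := by
  simp only [sites, Finset.mem_Ioo] at hu
  have h1 : (0 : ℝ) ≤ u := by exact_mod_cast hu.1.le
  have h2 : (u : ℝ) ≤ n := by exact_mod_cast hu.2.le
  exact ⟨by positivity, div_le_one_of_le₀ h2 (by positivity)⟩

/-- Riemann sums of a nonnegative Lipschitz function. -/
lemma sum_sites_le_integral {φ : ℝ → ℝ} {C : ℝ} (hφ0 : ∀ u, 0 ≤ φ u)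
    (hφ : ContinuousOn φ (Set.Icc 0 1))
    (hC : ∀ u ∈ Set.Icc (0 : ℝ) 1, ∀ v ∈ Set.Icc (0 : ℝ) 1, |φ v - φ u| ≤ C * |v - u|)
    (hC0 : 0 ≤ C) {n : ℕ} (hn : 0 < n) :
    (∑ u ∈ sites n, φ (u / n)) / n ≤ (∫ u in (0 : ℝ)..1, φ u) + C / n := by
  have hn' : (0 : ℝ) < n := by exact_mod_cast hn
  have h1 : ∑ u ∈ sites n, φ (u / n) ≤ ∑ k ∈ Finset.range n, φ ((k : ℝ) / n) := by
    have h2 : ∑ u ∈ sites n, φ (u / n) = ∑ k ∈ Finset.Ioo 0 n, φ ((k : ℝ) / n) := by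
      refine Finset.sum_nbij' Int.toNat (fun k => (k : ℤ)) ?_ ?_ ?_ ?_ ?_
      all_goals
        intro w hw
        simp only [sites, Finset.mem_Ioo] at hw ⊢
      · omega
      · omega
      · omega
      · omega
      · congr 2
        exact_mod_cast (Int.toNat_of_nonneg hw.1.le).symm
    rw [h2]
    refine Finset.sum_le_sum_of_subset_of_nonneg (fun k hk => ?_) fun _ _ _ => hφ0 _
    simp only [Finset.mem_Ioo, Finset.mem_range] at hk ⊢
    omega
  have hmem : ∀ k ∈ Finset.range n, (k : ℝ) / n ∈ Set.Icc (0 : ℝ) 1 ∧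
      ((k + 1 : ℕ) : ℝ) / n ∈ Set.Icc (0 : ℝ) 1 := fun k hk => by
    have h3 : k + 1 ≤ n := Finset.mem_range.1 hk
    have h4 : ((k + 1 : ℕ) : ℝ) ≤ n := by exact_mod_cast h3
    have h5 : (k : ℝ) ≤ n := by exact_mod_cast (by omega : k ≤ n)
    exact ⟨⟨by positivity, div_le_one_of_le₀ h5 hn'.le⟩,
      ⟨by positivity, div_le_one_of_le₀ h4 hn'.le⟩⟩
  have hint : ∀ k < n, IntervalIntegrable φ volume ((k : ℝ) / n) (((k + 1 : ℕ) : ℝ) / n) :=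
    fun k hk => by
      have h3 := hmem k (Finset.mem_range.2 hk)
      exact (hφ.mono (Set.uIcc_subset_Icc h3.1 h3.2)).intervalIntegrable
  have h2 := intervalIntegral.sum_integral_adjacent_intervals (a := fun k : ℕ => (k : ℝ) / n) hint
  simp only [Nat.cast_zero, zero_div, div_self hn'.ne'] at h2
  rw [← h2]
  have h3 : ∀ k ∈ Finset.range n, φ ((k : ℝ) / n) / n - C / n / n ≤
      ∫ u in ((k : ℝ) / n)..(((k + 1 : ℕ) : ℝ) / n), φ u := fun k hk => by
    have h4 := hmem k hk
    have h5 : (k : ℝ) / n ≤ ((k + 1 : ℕ) : ℝ) / n := by push_cast; gcongr; linarith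
    have h6 : ((k + 1 : ℕ) : ℝ) / n - (k : ℝ) / n = 1 / n := by push_cast; ring
    have h7 : ∫ _ in ((k : ℝ) / n)..(((k + 1 : ℕ) : ℝ) / n), (φ ((k : ℝ) / n) - C / n) ≤
        ∫ u in ((k : ℝ) / n)..(((k + 1 : ℕ) : ℝ) / n), φ u := by
      refine intervalIntegral.integral_mono_on h5 intervalIntegrable_const
        (hint k (Finset.mem_range.1 hk)) fun u hu => ?_
      have h8 := (abs_le.1 (hC _ h4.1 u ⟨h4.1.1.trans hu.1, hu.2.trans h4.2.2⟩)).1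
      have h9 : |u - (k : ℝ) / n| ≤ 1 / n := by
        rw [abs_of_nonneg (by linarith [hu.1])]
        linarith [hu.2]
      have h10 : C * |u - (k : ℝ) / n| ≤ C / n := by
        rw [div_eq_mul_one_div C]
        gcongr
      linarith
    rw [intervalIntegral.integral_const, h6, smul_eq_mul] at h7
    refine le_trans (le_of_eq ?_) h7
    ring
  have h4 := Finset.sum_le_sum h3
  rw [Finset.sum_sub_distrib, ← Finset.sum_div, Finset.sum_const, Finset.card_range,
    nsmul_eq_mul, mul_div_cancel₀ _ hn'.ne'] at h4
  have h5 : (∑ u ∈ sites n, φ (u / n)) / n ≤ (∑ k ∈ Finset.range n, φ ((k : ℝ) / n)) / n := by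
    gcongr
  linarith

/-! ### The remainder -/

lemma two_mul_antiRate_mul {γ : ℝ} {k : ℤ} : 2 * antiRate γ k * k = rho γ |k| := by
  unfold antiRate rho asymRate
  rcases lt_trichotomy k 0 with h | rfl | h
  · have h1 : ¬0 < k := by omega
    have h2 : 0 < -k := by omega
    rw [abs_of_neg h, if_neg h1, if_pos h2]
    push_cast
    ring
  · simp
  · have h2 : ¬0 < -k := by omega
    rw [abs_of_pos h, if_neg h2, if_pos h]
    ring

lemma abs_two_mul_antiRate {γ : ℝ} {k : ℤ} (hk : k ≠ 0) :
    |2 * antiRate γ k| = asymRate γ |k| := by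
  have hk' : 0 < |k| := abs_pos.2 hk
  have hk'' : (0 : ℝ) < |(k : ℝ)| := abs_pos.2 (by exact_mod_cast hk)
  have h := two_mul_antiRate_mul (γ := γ) (k := k)
  have h1 := congrArg abs h
  rw [abs_mul, abs_of_nonneg (rho_nonneg _ _), rho] at h1
  push_cast at h1
  rw [mul_comm |(k : ℝ)|] at h1
  exact mul_right_cancel₀ hk''.ne' h1

section Remainder

variable {γ C : ℝ} {n ℓ : ℕ} {H : ℝ → ℝ}

/-- The Taylor error for pairs of small diameter, and the size of the pairs of large diameter. -/
lemma abs_pairCoeff_sub_le (hC0 : 0 ≤ C)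
    (hlip : ∀ u ∈ Set.Icc (0 : ℝ) 1, ∀ v ∈ Set.Icc (0 : ℝ) 1, |H v - H u| ≤ C * |v - u|)
    (htay : ∀ u ∈ Set.Icc (0 : ℝ) 1, ∀ v ∈ Set.Icc (0 : ℝ) 1,
        |H v - H u - (v - u) * grad H u| ≤ C * |v - u| ^ 2)
    (hℓ : 1 ≤ ℓ) {u w : ℤ} (hu : u ∈ sites n) (hw : w ∈ sites n) (hne : u ≠ w) :
    |pairCoeff γ n H u w - if |w - u| < ℓ then grad H (u / n) * rho γ |w - u| else 0| ≤
      C * (1 + n / ℓ) / n * (((|w - u| : ℤ) : ℝ) * rho γ |w - u|) := by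
  have hu' := div_mem_Icc hu
  have hw' := div_mem_Icc hw
  have hn : (0 : ℝ) < n := by
    simp only [sites, Finset.mem_Ioo] at hu
    exact_mod_cast (by omega : 0 < n)
  have hℓ0 : (0 : ℝ) < ℓ := by exact_mod_cast hℓ
  have hk : w - u ≠ 0 := by omega
  have hkr : ((|w - u| : ℤ) : ℝ) = |(w : ℝ) - u| := by push_cast; rfl
  have hab : |(w : ℝ) / n - u / n| = ((|w - u| : ℤ) : ℝ) / n := by
    rw [← sub_div, abs_div, abs_of_pos hn, hkr]
  have hanti := abs_two_mul_antiRate (γ := γ) hk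
  have hrho : rho γ |w - u| = ((|w - u| : ℤ) : ℝ) * asymRate γ |w - u| := rfl
  have ha := asymRate_nonneg γ |w - u|
  set k := ((|w - u| : ℤ) : ℝ) with hkdef
  have hk0 : 0 ≤ k := by rw [hkr]; positivity
  split_ifs with hlt
  · have h1 : pairCoeff γ n H u w - grad H (u / n) * rho γ |w - u| =
        n * (2 * antiRate γ (w - u)) *
          (H (w / n) - H (u / n) - ((w : ℝ) / n - u / n) * grad H (u / n)) := by
      rw [← two_mul_antiRate_mul, pairCoeff]
      push_cast
      field_simp
    rw [h1, abs_mul, abs_mul, abs_of_pos hn, hanti]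
    have h2 := htay _ hu' _ hw'
    rw [hab] at h2
    calc (n : ℝ) * asymRate γ |w - u| * |H (w / n) - H (u / n) -
          ((w : ℝ) / n - u / n) * grad H (u / n)|
        ≤ n * asymRate γ |w - u| * (C * (k / n) ^ 2) := by gcongr
      _ = C * 1 / n * (k * rho γ |w - u|) := by rw [hrho]; field_simp
      _ ≤ C * (1 + n / ℓ) / n * (k * rho γ |w - u|) := by
          have : 0 ≤ (n : ℝ) / ℓ := by positivity
          have := rho_nonneg γ |w - u|
          gcongr
          linarith
  · rw [sub_zero, pairCoeff, abs_mul, abs_mul, abs_of_pos hn, hanti]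
    have h2 := hlip _ hu' _ hw'
    rw [hab] at h2
    have h3 : (ℓ : ℝ) ≤ k := by
      rw [hkdef]
      exact_mod_cast not_lt.1 hlt
    have hr := rho_nonneg γ |w - u|
    calc (n : ℝ) * asymRate γ |w - u| * |H (w / n) - H (u / n)|
        ≤ n * asymRate γ |w - u| * (C * (k / n)) := by gcongr
      _ = C * (n / ℓ) / n * (ℓ * rho γ |w - u|) := by rw [hrho]; field_simp
      _ ≤ C * (1 + n / ℓ) / n * (k * rho γ |w - u|) := by
          gcongr
          linarith

lemma sum_anchoredPairs_le (f : ℤ → ℝ) (hf : ∀ k, 0 ≤ f k) :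
    ∑ p ∈ anchoredPairs n ℓ, f |p.2 - p.1| ≤ n * ∑ k ∈ Finset.range n, f ((k : ℤ) + 1) := by
  rw [anchoredPairs, Finset.sum_filter, Finset.sum_product]
  have h1 : ∀ u ∈ sites n, (∑ w ∈ sites n, if selects n ℓ u w then f |w - u| else 0) ≤
      ∑ k ∈ Finset.range n, f ((k : ℤ) + 1) := fun u hu => by
    rw [← Finset.sum_filter]
    exact sum_selects_le hu f hf
  refine (Finset.sum_le_sum h1).trans ?_
  rw [Finset.sum_const, nsmul_eq_mul]
  have h5 : ((sites n).card : ℝ) ≤ n := by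
    rw [sites, Int.card_Ioo]; exact_mod_cast (by omega : ((n : ℤ) - 0 - 1).toNat ≤ n)
  exact mul_le_mul_of_nonneg_right h5 (Finset.sum_nonneg fun _ _ => hf _)

lemma anchoredPairs_ne : ∀ p ∈ anchoredPairs n ℓ, p.1 ≠ p.2 := fun _ hp =>
  selects_ne (Finset.mem_filter.1 hp).2

/-- The bound for the variance of the remainder; it vanishes as `n → ∞` with `ℓ` proportional to
`n`. -/
def remainderBound (γ C : ℝ) (n ℓ : ℕ) : ℝ :=
  (C * (1 + n / ℓ)) ^ 2 / 4 * (weightSum γ n / n) +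
    (C * ((n / ℓ + 1) * (tailSum γ ℓ / ℓ) + n / ℓ * (meanRate γ / ((ℓ : ℝ) - 1)))) ^ 2 / 4

lemma sum_remainder_sq_le (hγ : 1 < γ) (hC0 : 0 ≤ C)
    (hgrad : ∀ u ∈ Set.Icc (0 : ℝ) 1, |grad H u| ≤ C)
    (hlip : ∀ u ∈ Set.Icc (0 : ℝ) 1, ∀ v ∈ Set.Icc (0 : ℝ) 1, |H v - H u| ≤ C * |v - u|)
    (htay : ∀ u ∈ Set.Icc (0 : ℝ) 1, ∀ v ∈ Set.Icc (0 : ℝ) 1,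
        |H v - H u - (v - u) * grad H u| ≤ C * |v - u| ^ 2)
    (hℓ : 2 ≤ ℓ) (hn : 2 * ℓ ≤ n) :
    ∑ η : Config n, remainder γ ℓ H η ^ 2 ≤
      Fintype.card (Config n) * remainderBound γ C n ℓ := by
  have hc := card_config_pos n
  have hn0 : (0 : ℝ) < n := by exact_mod_cast (by omega : 0 < n)
  have hℓ2 : (2 : ℝ) ≤ ℓ := by exact_mod_cast hℓ
  have hℓ0 : (0 : ℝ) < ℓ := by linarith
  set ψ : ℤ × ℤ → ℝ := fun p => pairCoeff γ n H p.1 p.2 -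
      if |p.2 - p.1| < ℓ then grad H (p.1 / n) * rho γ |p.2 - p.1| else 0 with hψ
  set e : ℤ → ℝ := fun u =>
    grad H (u / n) * (meanRate γ - mass γ n ℓ u * (ℓ / ((ℓ : ℝ) - 1))) with he
  have h1 : ∑ η : Config n, (∑ p ∈ anchoredPairs n ℓ, ψ p * (spin η p.1 * spin η p.2)) ^ 2 ≤
      Fintype.card (Config n) * ((C * (1 + n / ℓ)) ^ 2 / 8 * (weightSum γ n / n)) := by
    refine (sum_quadratic_sq_le _ anchoredPairs_ne ψ).trans ?_
    refine mul_le_mul_of_nonneg_left ?_ hc.le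
    have h2 : ∑ p ∈ anchoredPairs n ℓ, ψ p ^ 2 ≤ ∑ p ∈ anchoredPairs n ℓ,
        (fun k : ℤ => (C * (1 + n / ℓ) / n) ^ 2 * ((k : ℝ) * rho γ k) ^ 2) |p.2 - p.1| := by
      refine Finset.sum_le_sum fun p hp => ?_
      have hp' := Finset.mem_product.1 (Finset.mem_filter.1 hp).1
      have h3 := abs_pairCoeff_sub_le (γ := γ) hC0 hlip htay (by omega : 1 ≤ ℓ) hp'.1 hp'.2
        (anchoredPairs_ne p hp)
      simp only
      rw [← mul_pow, ← sq_abs]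
      exact pow_le_pow_left₀ (abs_nonneg _) h3 2
    have h3 := h2.trans (sum_anchoredPairs_le (n := n) (ℓ := ℓ)
      (fun k : ℤ => (C * (1 + n / ℓ) / n) ^ 2 * ((k : ℝ) * rho γ k) ^ 2) fun k => by positivity)
    rw [← Finset.mul_sum] at h3
    have h4 : (n : ℝ) * ((C * (1 + n / ℓ) / n) ^ 2 * weightSum γ n) =
        (C * (1 + n / ℓ)) ^ 2 * (weightSum γ n / n) := by
      field_simp
    have h5 : ∑ p ∈ anchoredPairs n ℓ, ψ p ^ 2 ≤
        (n : ℝ) * ((C * (1 + n / ℓ) / n) ^ 2 * weightSum γ n) := h3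
    rw [h4] at h5
    linarith
  have h2 : ∑ η : Config n, (∑ u ∈ sites n, e u * (boxMean ℓ η u ^ 2 - 1 / (4 * (ℓ : ℝ)))) ^ 2 ≤
      Fintype.card (Config n) * ((C * ((n / ℓ + 1) * (tailSum γ ℓ / ℓ) +
        n / ℓ * (meanRate γ / ((ℓ : ℝ) - 1)))) ^ 2 / 8) := by
    refine (sum_weighted_boxMean_sq_le (by omega) hn e).trans ?_
    refine mul_le_mul_of_nonneg_left ?_ hc.le
    have h3 : ∑ u ∈ sites n, |e u| ≤
        C * ((n / ℓ + 1) * tailSum γ ℓ + n * (meanRate γ / ((ℓ : ℝ) - 1))) := by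
      refine le_trans ?_ (mul_le_mul_of_nonneg_left (sum_abs_mass_defect_le hγ hℓ hn) hC0)
      rw [Finset.mul_sum]
      refine Finset.sum_le_sum fun u hu => ?_
      rw [he, abs_mul]
      exact mul_le_mul_of_nonneg_right (hgrad _ (div_mem_Icc hu)) (abs_nonneg _)
    have h4 := pow_le_pow_left₀ (Finset.sum_nonneg fun u _ => abs_nonneg (e u)) h3 2
    calc (∑ u ∈ sites n, |e u|) ^ 2 / (8 * (ℓ : ℝ) ^ 2)
        ≤ (C * ((n / ℓ + 1) * tailSum γ ℓ + n * (meanRate γ / ((ℓ : ℝ) - 1)))) ^ 2 /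
          (8 * (ℓ : ℝ) ^ 2) := by gcongr
      _ = _ := by
        rw [← div_div, div_right_comm, ← div_pow]
        congr 2
        ring
  have h3 : ∀ η : Config n, remainder γ ℓ H η ^ 2 ≤
      2 * (∑ p ∈ anchoredPairs n ℓ, ψ p * (spin η p.1 * spin η p.2)) ^ 2 +
      2 * (∑ u ∈ sites n, e u * (boxMean ℓ η u ^ 2 - 1 / (4 * (ℓ : ℝ)))) ^ 2 := fun η => by
    have h4 : remainder γ ℓ H η = -(∑ p ∈ anchoredPairs n ℓ, ψ p * (spin η p.1 * spin η p.2)) +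
      ∑ u ∈ sites n, e u * (boxMean ℓ η u ^ 2 - 1 / (4 * (ℓ : ℝ))) := rfl
    rw [h4]
    nlinarith [sq_nonneg ((∑ p ∈ anchoredPairs n ℓ, ψ p * (spin η p.1 * spin η p.2)) +
      ∑ u ∈ sites n, e u * (boxMean ℓ η u ^ 2 - 1 / (4 * (ℓ : ℝ))))]
  refine (Finset.sum_le_sum fun η _ => h3 η).trans ?_
  rw [Finset.sum_add_distrib, ← Finset.mul_sum, ← Finset.mul_sum, remainderBound]
  linarith

lemma sum_boxSquareSum_sq_le (hgrad : ∀ u ∈ Set.Icc (0 : ℝ) 1, |grad H u| ≤ C)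
    (hℓ : 2 ≤ ℓ) (hn : 2 * ℓ ≤ n) :
    ∑ η : Config n, boxSquareSum n ℓ H η ^ 2 ≤
      Fintype.card (Config n) * ((C * (n / ℓ)) ^ 2 / 8) := by
  have hc := card_config_pos n
  have hC0 : 0 ≤ C := (abs_nonneg _).trans (hgrad 0 (by simp))
  simp only [boxSquareSum_eq (by omega : 1 ≤ ℓ) hn]
  refine (sum_weighted_boxMean_sq_le (by omega) hn _).trans ?_
  refine mul_le_mul_of_nonneg_left ?_ hc.le
  have h3 : ∑ u ∈ sites n, |grad H (u / n)| ≤ n * C := by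
    refine (Finset.sum_le_sum fun u hu => hgrad _ (div_mem_Icc hu)).trans ?_
    rw [Finset.sum_const, nsmul_eq_mul]
    have h5 : ((sites n).card : ℝ) ≤ n := by
      rw [sites, Int.card_Ioo]; exact_mod_cast (by omega : ((n : ℤ) - 0 - 1).toNat ≤ n)
    gcongr
  have h4 := pow_le_pow_left₀ (Finset.sum_nonneg fun (u : ℤ) _ => abs_nonneg (grad H (u / n))) h3 2
  calc (∑ u ∈ sites n, |grad H (u / n)|) ^ 2 / (8 * (ℓ : ℝ) ^ 2)
      ≤ (n * C) ^ 2 / (8 * (ℓ : ℝ) ^ 2) := by gcongr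
    _ = _ := by
      rw [← div_div, div_right_comm, ← div_pow]
      congr 2
      ring

end Remainder

/-! ### The second order Boltzmann–Gibbs principle -/

/-- The quantitative estimate from which both regimes follow; the parameter `b` is `1` if the
square of the box average is subtracted, and `0` otherwise. -/
lemma IsExclusionProcess.supSqTimeIntegral_quadTerm_le {α θ γ C : ℝ} (hγ : 1 < γ) {H : ℝ → ℝ}
    (hC0 : 0 ≤ C) (hgrad : ∀ u ∈ Set.Icc (0 : ℝ) 1, |grad H u| ≤ C)
    (hlip : ∀ u ∈ Set.Icc (0 : ℝ) 1, ∀ v ∈ Set.Icc (0 : ℝ) 1, |H v - H u| ≤ C * |v - u|)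
    (htay : ∀ u ∈ Set.Icc (0 : ℝ) 1, ∀ v ∈ Set.Icc (0 : ℝ) 1,
        |H v - H u - (v - u) * grad H u| ≤ C * |v - u| ^ 2)
    {n ℓ : ℕ} (hℓ : 2 ≤ ℓ) (hn : 2 * ℓ ≤ n) {Ω : Type*} [MeasurableSpace Ω] {P : Measure Ω}
    {X : ℝ → Ω → Config n} (hX : IsExclusionProcess α θ γ n P X) {T : ℝ} (hT : 0 < T) (b : ℝ) :
    supSqTimeIntegral P X T (fun ξ => quadTerm θ γ n H ξ +
        b * (scale θ n * (meanRate γ * boxSquareSum n ℓ H ξ))) ≤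
      ENNReal.ofReal (scale θ n ^ 2 * (100 * T * meanRate γ ^ 2 * (ℓ / n) *
        ((∑ u ∈ sites n, grad H (u / n) ^ 2) / n) + 4 * T ^ 2 * (remainderBound γ C n ℓ +
          (b - 1) ^ 2 * meanRate γ ^ 2 * ((C * (n / ℓ)) ^ 2 / 8)))) := by
  have hc := card_config_pos n
  have hn0 : (0 : ℝ) < n := by exact_mod_cast (by omega : 0 < n)
  simp only [quadTerm_add_eq θ γ b hℓ hn H]
  refine (IsExclusionProcess.supSqTimeIntegral_le (by linarith) (by omega) hX hT
    (fun z η => -scale θ n * bondCoeff γ ℓ (fun u => grad H (u / n)) z η)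
    (fun z h1 h2 η => by simp only [bondCoeff_bondSwap hℓ hn _ h1 h2]) _
    (K := scale θ n ^ 2 * (5 * meanRate γ ^ 2 * ℓ * ∑ u ∈ sites n, grad H (u / n) ^ 2) /
      (2 * (n : ℝ) ^ 2))
    (K' := scale θ n ^ 2 * (2 * remainderBound γ C n ℓ + 2 * ((b - 1) ^ 2 * meanRate γ ^ 2 *
      ((C * (n / ℓ)) ^ 2 / 8)))) ?_ ?_).trans (le_of_eq ?_)
  · have h1 := sum_bondCoeff_sq_le (γ := γ) hℓ hn (fun u => grad H (u / n))
      fun u hu => mass_le hγ hu hn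
    simp only [mul_pow, ← Finset.mul_sum, neg_sq]
    rw [mul_div_cancel₀ _ (by positivity), mul_left_comm]
    exact mul_le_mul_of_nonneg_left h1 (sq_nonneg _)
  · have h1 := sum_remainder_sq_le hγ hC0 hgrad hlip htay hℓ hn
    have h2 := sum_boxSquareSum_sq_le hgrad hℓ hn
    have h3 : ∀ η : Config n, (scale θ n * (remainder γ ℓ H η +
        (b - 1) * (meanRate γ * boxSquareSum n ℓ H η))) ^ 2 ≤
        scale θ n ^ 2 * (2 * remainder γ ℓ H η ^ 2 +
          2 * ((b - 1) ^ 2 * meanRate γ ^ 2 * boxSquareSum n ℓ H η ^ 2)) := fun η => by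
      rw [mul_pow]
      refine mul_le_mul_of_nonneg_left ?_ (sq_nonneg _)
      nlinarith [sq_nonneg (remainder γ ℓ H η -
        (b - 1) * (meanRate γ * boxSquareSum n ℓ H η))]
    refine (Finset.sum_le_sum fun η _ => h3 η).trans ?_
    rw [← Finset.mul_sum, mul_left_comm]
    refine mul_le_mul_of_nonneg_left ?_ (sq_nonneg _)
    rw [Finset.sum_add_distrib, ← Finset.mul_sum, ← Finset.mul_sum, ← Finset.mul_sum]
    have h4 := mul_le_mul_of_nonneg_left h2 (by positivity : 0 ≤ (b - 1) ^ 2 * meanRate γ ^ 2)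
    linarith
  · congr 1
    field_simp
    ring

/-- The static estimate for slowly decaying jump rates: the time integral is bounded by the
variance of the quadratic term. -/
lemma IsExclusionProcess.supSqTimeIntegral_quadTerm_le_of_le_one {α θ γ C : ℝ} (hγ0 : 0 < γ)
    (hγ : γ ≤ 1) {H : ℝ → ℝ}
    (hlip : ∀ u ∈ Set.Icc (0 : ℝ) 1, ∀ v ∈ Set.Icc (0 : ℝ) 1, |H v - H u| ≤ C * |v - u|)
    (hC0 : 0 ≤ C) {n : ℕ} (hn : 0 < n) {Ω : Type*} [MeasurableSpace Ω] {P : Measure Ω}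
    {X : ℝ → Ω → Config n} (hX : IsExclusionProcess α θ γ n P X) {T : ℝ} (hT : 0 < T) :
    supSqTimeIntegral P X T (quadTerm θ γ n H) ≤
      ENNReal.ofReal (T ^ 2 * C ^ 2 / 4 * (∑' k : ℕ, 1 / ((k : ℝ) + 1) ^ 2) *
        ((n : ℝ) ^ (θ - γ)) ^ 2) := by
  have hc := card_config_pos n
  have hn0 : (0 : ℝ) < n := by exact_mod_cast hn
  set Z := ∑' k : ℕ, 1 / ((k : ℝ) + 1) ^ 2 with hZ
  have hZs : Summable fun k : ℕ => 1 / ((k : ℝ) + 1) ^ 2 := by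
    have := (summable_nat_add_iff 1).2 (Real.summable_one_div_nat_pow.2 (by norm_num : 1 < 2))
    simpa using this
  have h1 : ∑ p ∈ anchoredPairs n 0, pairCoeff γ n H p.1 p.2 ^ 2 ≤
      n * ((C * (n : ℝ) ^ (1 - γ)) ^ 2 * Z) := by
    have h2 : ∑ p ∈ anchoredPairs n 0, pairCoeff γ n H p.1 p.2 ^ 2 ≤ ∑ p ∈ anchoredPairs n 0,
        (fun k : ℤ => (C * (n : ℝ) ^ (1 - γ)) ^ 2 * (1 / (k : ℝ) ^ 2)) |p.2 - p.1| := by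
      refine Finset.sum_le_sum fun p hp => ?_
      have hp' := Finset.mem_product.1 (Finset.mem_filter.1 hp).1
      have hne := anchoredPairs_ne p hp
      have hu := div_mem_Icc hp'.1
      have hw := div_mem_Icc hp'.2
      have hk : p.2 - p.1 ≠ 0 := by omega
      have hkr : ((|p.2 - p.1| : ℤ) : ℝ) = |(p.2 : ℝ) - p.1| := by push_cast; rfl
      have hab : |(p.2 : ℝ) / n - p.1 / n| = ((|p.2 - p.1| : ℤ) : ℝ) / n := by
        rw [← sub_div, abs_div, abs_of_pos hn0, hkr]
      have h3 := hlip _ hu _ hw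
      have hkpos : 0 < |p.2 - p.1| := abs_pos.2 hk
      have hle : |p.2 - p.1| ≤ n := by
        have h4 := hp'.1
        have h5 := hp'.2
        simp only [sites, Finset.mem_Ioo] at h4 h5
        rw [abs_le]
        omega
      have ha : asymRate γ |p.2 - p.1| = ((|p.2 - p.1| : ℤ) : ℝ) ^ (-1 - γ) := by
        rw [asymRate, if_pos hkpos, abs_of_pos (by exact_mod_cast hkpos)]
      have h4 : |pairCoeff γ n H p.1 p.2| ≤
          C * (n : ℝ) ^ (1 - γ) * (1 / ((|p.2 - p.1| : ℤ) : ℝ)) := by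
        rw [hab] at h3
        have hk0 : (0 : ℝ) < ((|p.2 - p.1| : ℤ) : ℝ) := by exact_mod_cast hkpos
        have hk1 : ((|p.2 - p.1| : ℤ) : ℝ) / n ≤ 1 := by
          rw [div_le_one hn0]; exact_mod_cast hle
        rw [pairCoeff, abs_mul, abs_mul, abs_of_pos hn0, abs_two_mul_antiRate hk, ha]
        set k := ((|p.2 - p.1| : ℤ) : ℝ)
        -- for `γ ≤ 1` the Lipschitz bound is weakened to a Hölder bound of exponent `γ`, which
        -- leaves the square summable weight `1 / k`
        have h5 : k / n ≤ (k / n) ^ γ := by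
          conv_lhs => rw [← Real.rpow_one (k / n)]
          exact Real.rpow_le_rpow_of_exponent_ge (by positivity) hk1 hγ
        calc (n : ℝ) * k ^ (-1 - γ) * |H (p.2 / n) - H (p.1 / n)|
            ≤ n * k ^ (-1 - γ) * (C * (k / n) ^ γ) := by
              gcongr
              exact h3.trans (by gcongr)
          _ = C * (n : ℝ) ^ (1 - γ) * (1 / k) := by
              rw [Real.div_rpow hk0.le hn0.le, Real.rpow_sub hk0, Real.rpow_sub hn0,
                Real.rpow_neg_one, Real.rpow_one]
              have : 0 < k ^ γ := by positivity
              have : 0 < (n : ℝ) ^ γ := by positivity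
              field_simp
      simp only
      rw [← sq_abs, ← one_div_pow, ← mul_pow]
      exact pow_le_pow_left₀ (abs_nonneg _) h4 2
    refine (h2.trans (sum_anchoredPairs_le
      (fun k : ℤ => (C * (n : ℝ) ^ (1 - γ)) ^ 2 * (1 / (k : ℝ) ^ 2)) fun k => by positivity)).trans ?_
    rw [← Finset.mul_sum]
    gcongr
    push_cast
    exact hZs.sum_le_tsum _ fun k _ => by positivity
  have h2 : ∑ η : Config n, quadTerm θ γ n H η ^ 2 ≤ Fintype.card (Config n) *
      (scale θ n ^ 2 * (1 / 8 * (n * ((C * (n : ℝ) ^ (1 - γ)) ^ 2 * Z)))) := by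
    simp only [quadTerm_eq θ γ hn 0, mul_pow, neg_sq, ← Finset.mul_sum]
    rw [mul_left_comm]
    refine mul_le_mul_of_nonneg_left ((sum_quadratic_sq_le _ anchoredPairs_ne
      fun p => pairCoeff γ n H p.1 p.2).trans ?_) (sq_nonneg _)
    rw [mul_pow] at h1
    gcongr
  have h3 := IsExclusionProcess.supSqTimeIntegral_le hγ0 hn hX hT (fun _ _ => 0)
    (fun _ _ _ _ => rfl) (quadTerm θ γ n H) (K := 0) (by simp) h2
  simp only [zero_mul, Finset.sum_const_zero, zero_add, mul_zero] at h3
  refine h3.trans (le_of_eq ?_)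
  congr 1
  have h4 : scale θ n ^ 2 * (n : ℝ) * ((n : ℝ) ^ (1 - γ)) ^ 2 = ((n : ℝ) ^ (θ - γ)) ^ 2 := by
    rw [scale, div_pow, div_pow, Real.sq_sqrt hn0.le, Real.rpow_sub hn0, Real.rpow_sub hn0,
      Real.rpow_one]
    have : 0 < (n : ℝ) ^ γ := by positivity
    field_simp
  rw [← h4]
  ring

lemma scale_eq (θ : ℝ) {n : ℕ} (hn : 0 < n) : scale θ n = (n : ℝ) ^ (θ - 3 / 2) := by
  have hn0 : (0 : ℝ) < n := by exact_mod_cast hn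
  rw [scale, Real.sqrt_eq_rpow, ← Real.rpow_sub hn0]
  nth_rewrite 2 [← Real.rpow_one (n : ℝ)]
  rw [← Real.rpow_sub hn0]
  congr 1
  ring

section Limits

variable {ε : ℝ}

lemma two_mul_floor_le (hε0 : 0 < ε) (hε : ε ≤ 1 / 2) (n : ℕ) : 2 * ⌊ε * n⌋₊ ≤ n := by
  have h1 : (⌊ε * n⌋₊ : ℝ) ≤ ε * n := Nat.floor_le (by positivity)
  have h2 : (2 * ⌊ε * n⌋₊ : ℝ) ≤ n := by
    have : (0 : ℝ) ≤ n := by positivity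
    nlinarith
  exact_mod_cast h2

lemma tendsto_floor (hε0 : 0 < ε) : Tendsto (fun n : ℕ => ⌊ε * n⌋₊) atTop atTop :=
  tendsto_nat_floor_atTop.comp (tendsto_natCast_atTop_atTop.const_mul_atTop hε0)

lemma div_floor_le (hε0 : 0 < ε) {n : ℕ} (hℓ : 2 ≤ ⌊ε * n⌋₊) :
    (n : ℝ) / (⌊ε * n⌋₊ : ℝ) ≤ 2 / ε := by
  have h1 := Nat.lt_floor_add_one (ε * n)
  have h2 : (2 : ℝ) ≤ (⌊ε * n⌋₊ : ℝ) := by exact_mod_cast hℓ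
  rw [div_le_div_iff₀ (by linarith) hε0]
  linarith

lemma remainderBound_le {γ C ρ : ℝ} (hγ : 1 < γ) (hC0 : 0 ≤ C) {n ℓ : ℕ} (hℓ : 2 ≤ ℓ)
    (hρ : (n : ℝ) / ℓ ≤ ρ) :
    remainderBound γ C n ℓ ≤ (C * (1 + ρ)) ^ 2 / 4 * (weightSum γ n / n) +
      (C * ((ρ + 1) * (tailSum γ ℓ / ℓ) + ρ * (meanRate γ / ((ℓ : ℝ) - 1)))) ^ 2 / 4 := by
  have h2 : (2 : ℝ) ≤ ℓ := by exact_mod_cast hℓ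
  have h3 : 0 ≤ meanRate γ / ((ℓ : ℝ) - 1) := div_nonneg (meanRate_nonneg hγ) (by linarith)
  have h4 : 0 ≤ tailSum γ ℓ / ℓ := div_nonneg (tailSum_nonneg hγ ℓ) (by linarith)
  have h5 : 0 ≤ weightSum γ n / n := by unfold weightSum; positivity
  have h6 : 0 ≤ (n : ℝ) / ℓ := by positivity
  unfold remainderBound
  gcongr

lemma tendsto_remainderBound {γ C : ℝ} (hγ : 1 < γ) (hC0 : 0 ≤ C) (hε0 : 0 < ε) :
    Tendsto (fun n : ℕ => remainderBound γ C n ⌊ε * n⌋₊) atTop (𝓝 0) := by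
  have hfl := tendsto_floor hε0
  have h1 := (tendsto_weightSum_div hγ).const_mul ((C * (1 + 2 / ε)) ^ 2 / 4)
  have h2 := ((tendsto_tailSum_div hγ).comp hfl).const_mul (2 / ε + 1)
  have h3 : Tendsto (fun ℓ : ℕ => meanRate γ / ((ℓ : ℝ) - 1)) atTop (𝓝 0) :=
    tendsto_const_nhds.div_atTop
      (tendsto_atTop_add_const_right _ (-1) tendsto_natCast_atTop_atTop)
  have h4 := (h3.comp hfl).const_mul (2 / ε)
  have h5 := h1.add ((((h2.add h4).const_mul C).pow 2).div_const 4)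
  simp only [mul_zero, add_zero, ne_eq, OfNat.ofNat_ne_zero, not_false_eq_true, zero_pow,
    zero_div] at h5
  refine tendsto_of_tendsto_of_tendsto_of_le_of_le' tendsto_const_nhds h5
    (Eventually.of_forall fun n => ?_) ?_
  · unfold remainderBound weightSum
    positivity
  · filter_upwards [hfl.eventually_ge_atTop 2] with n hn
    exact remainderBound_le hγ hC0 hn (div_floor_le hε0 hn)

end Limits

section Regimes

variable {α θ γ : ℝ} {H : ℝ → ℝ} {T : ℝ} {Ω : ℕ → Type*} {mΩ : ∀ n, MeasurableSpace (Ω n)}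
  {P : ∀ n, Measure (Ω n)} {X : ∀ n, ℝ → Ω n → Config n}

lemma gradSqNorm_nonneg (H : ℝ → ℝ) : 0 ≤ gradSqNorm H :=
  intervalIntegral.integral_nonneg zero_le_one fun _ _ => sq_nonneg _

lemma tendsto_natCast_rpow_sq {s : ℝ} (hs : s < 0) :
    Tendsto (fun n : ℕ => ((n : ℝ) ^ s) ^ 2) atTop (𝓝 0) := by
  have h := ((tendsto_rpow_neg_atTop (neg_pos.2 hs)).comp tendsto_natCast_atTop_atTop).pow 2
  simpa [Function.comp_def] using h

lemma tendsto_supSqTimeIntegral_quadTerm_of_le_one (hθγ : θ < γ) (hγ0 : 0 < γ) (hγ : γ ≤ 1)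
    (hH : IsTestFunction H) (hT : 0 < T) (hX : ∀ n, IsExclusionProcess α θ γ n (P n) (X n)) :
    Tendsto (fun n : ℕ => supSqTimeIntegral (P n) (X n) T (quadTerm θ γ n H)) atTop (𝓝 0) := by
  obtain ⟨-, C, hC0, -, hlip, -, -⟩ := hH.exists_bound
  have h1 := ENNReal.tendsto_ofReal ((tendsto_natCast_rpow_sq (sub_neg.2 hθγ)).const_mul
    (T ^ 2 * C ^ 2 / 4 * (∑' k : ℕ, 1 / ((k : ℝ) + 1) ^ 2)))
  rw [mul_zero, ENNReal.ofReal_zero] at h1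
  refine tendsto_of_tendsto_of_tendsto_of_le_of_le' tendsto_const_nhds h1
    (Eventually.of_forall fun _ => bot_le) ?_
  filter_upwards [eventually_gt_atTop 0] with n hn
  exact (hX n).supSqTimeIntegral_quadTerm_le_of_le_one hγ0 hγ hlip hC0 hn hT

lemma tendsto_supSqTimeIntegral_quadTerm_of_one_lt (hθ : θ < 3 / 2) (hγ : 1 < γ)
    (hH : IsTestFunction H) (hT : 0 < T) (hX : ∀ n, IsExclusionProcess α θ γ n (P n) (X n)) :
    Tendsto (fun n : ℕ => supSqTimeIntegral (P n) (X n) T (quadTerm θ γ n H)) atTop (𝓝 0) := by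
  obtain ⟨hcont, C, hC0, hgrad, hlip, htay, hsq⟩ := hH.exists_bound
  have hε : (0 : ℝ) < 1 / 2 := by norm_num
  -- boxes of macroscopic size `ε = 1/2`, for which the sum of squares of box averages is bounded
  -- in `L²`
  have h1 : Tendsto (fun n : ℕ => ((n : ℝ) ^ (θ - 3 / 2)) ^ 2 *
      (100 * T * meanRate γ ^ 2 * (1 / 2) * (gradSqNorm H + C / n) +
        4 * T ^ 2 * (remainderBound γ C n ⌊(1 / 2 : ℝ) * n⌋₊ +
        meanRate γ ^ 2 * ((C * (2 / (1 / 2))) ^ 2 / 8)))) atTop (𝓝 0) := by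
    have h2 := ((tendsto_const_div_atTop_nhds_zero_nat C).const_add (gradSqNorm H)).const_mul
      (100 * T * meanRate γ ^ 2 * (1 / 2))
    have h3 := ((tendsto_remainderBound hγ hC0 hε).add_const
      (meanRate γ ^ 2 * ((C * (2 / (1 / 2))) ^ 2 / 8))).const_mul (4 * T ^ 2)
    simpa using (tendsto_natCast_rpow_sq (sub_neg.2 hθ)).mul (h2.add h3)
  have h2 := ENNReal.tendsto_ofReal h1
  rw [ENNReal.ofReal_zero] at h2
  refine tendsto_of_tendsto_of_tendsto_of_le_of_le' tendsto_const_nhds h2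
    (Eventually.of_forall fun _ => bot_le) ?_
  filter_upwards [(tendsto_floor hε).eventually_ge_atTop 2, eventually_gt_atTop 0] with n hℓ hn
  have hn0 : (0 : ℝ) < n := by exact_mod_cast hn
  have h3 := (hX n).supSqTimeIntegral_quadTerm_le hγ hC0 hgrad hlip htay hℓ
    (two_mul_floor_le hε le_rfl n) hT 0
  simp only [zero_mul, add_zero, zero_sub] at h3
  refine h3.trans (ENNReal.ofReal_le_ofReal ?_)
  rw [scale_eq θ hn]
  have h4 := div_floor_le hε hℓ
  have h5 := sum_sites_le_integral (fun u => sq_nonneg (grad H u)) (hcont.pow 2) hsq hC0 hn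
  have h6 : ((⌊(1 / 2 : ℝ) * n⌋₊ : ℕ) : ℝ) / n ≤ 1 / 2 := by
    rw [div_le_iff₀ hn0]
    exact Nat.floor_le (by positivity)
  have h7 : 0 ≤ (∑ u ∈ sites n, grad H (u / n) ^ 2) / n := by positivity
  rw [neg_one_sq, one_mul]
  change _ ≤ gradSqNorm H + C / n at h5
  gcongr

lemma limsup_supSqTimeIntegral_quadTerm_add_le (hγ : 1 < γ) (hH : IsTestFunction H) (hT : 0 < T)
    {ε : ℝ} (hε0 : 0 < ε) (hε : ε ≤ 1 / 2)
    (hX : ∀ n, IsExclusionProcess α (3 / 2) γ n (P n) (X n)) :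
    limsup (fun n : ℕ => supSqTimeIntegral (P n) (X n) T
        (fun ξ => quadTerm (3 / 2) γ n H ξ + meanRate γ * boxSquareSum n ⌊ε * n⌋₊ H ξ)) atTop ≤
      ENNReal.ofReal (100 * T * meanRate γ ^ 2 * ε * gradSqNorm H) := by
  obtain ⟨hcont, C, hC0, hgrad, hlip, htay, hsq⟩ := hH.exists_bound
  have h1 : Tendsto (fun n : ℕ => 100 * T * meanRate γ ^ 2 * ε * (gradSqNorm H + C / n) +
      4 * T ^ 2 * remainderBound γ C n ⌊ε * n⌋₊) atTop
      (𝓝 (100 * T * meanRate γ ^ 2 * ε * gradSqNorm H)) := by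
    have h2 := ((tendsto_const_div_atTop_nhds_zero_nat C).const_add (gradSqNorm H)).const_mul
      (100 * T * meanRate γ ^ 2 * ε)
    simpa using h2.add ((tendsto_remainderBound hγ hC0 hε0).const_mul (4 * T ^ 2))
  rw [← (ENNReal.tendsto_ofReal h1).limsup_eq]
  refine limsup_le_limsup ?_
  filter_upwards [(tendsto_floor hε0).eventually_ge_atTop 2, eventually_gt_atTop 0] with n hℓ hn
  have hn0 : (0 : ℝ) < n := by exact_mod_cast hn
  have h3 := (hX n).supSqTimeIntegral_quadTerm_le hγ hC0 hgrad hlip htay hℓ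
    (two_mul_floor_le hε0 hε n) hT 1
  rw [scale_eq _ hn, sub_self, sub_self, Real.rpow_zero] at h3
  simp only [one_mul, one_pow, ne_eq, OfNat.ofNat_ne_zero, not_false_eq_true, zero_pow, zero_mul,
    add_zero] at h3
  refine h3.trans (ENNReal.ofReal_le_ofReal ?_)
  have h5 := sum_sites_le_integral (fun u => sq_nonneg (grad H u)) (hcont.pow 2) hsq hC0 hn
  have h6 : ((⌊ε * n⌋₊ : ℕ) : ℝ) / n ≤ ε := by
    rw [div_le_iff₀ hn0]
    exact Nat.floor_le (by positivity)
  have h7 : 0 ≤ (∑ u ∈ sites n, grad H (u / n) ^ 2) / n := by positivity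
  change _ ≤ gradSqNorm H + C / n at h5
  gcongr

end Regimes

end LongJumpExclusion

end

theorem proposition3p1 (α θ γ : ℝ) (hα : 2 < α) (hθ : 0 < θ) (hγ : 0 < γ)
    (hθγ : θ < min γ 2) :
    (θ < 3 / 2 →
      ∀ (T : ℝ), 0 < T → ∀ (H : ℝ → ℝ), LongJumpExclusion.IsTestFunction H →
      ∀ (Ω : ℕ → Type*) (mΩ : ∀ n, MeasurableSpace (Ω n)) (P : ∀ n, Measure (Ω n))
        (η : ∀ n, ℝ → Ω n → LongJumpExclusion.Config n),
        (∀ n, LongJumpExclusion.IsExclusionProcess α θ γ n (P n) (η n)) →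
        Tendsto
          (fun n : ℕ => LongJumpExclusion.supSqTimeIntegral (P n) (η n) T
            (LongJumpExclusion.quadTerm θ γ n H))
          atTop (𝓝 0)) ∧
    (θ = 3 / 2 →
      ∃ C : ℝ, 0 < C ∧
      ∀ (T : ℝ), 0 < T → ∀ (H : ℝ → ℝ), LongJumpExclusion.IsTestFunction H →
      ∀ (ε : ℝ), 0 < ε → ε ≤ 1 / 2 →
      ∀ (Ω : ℕ → Type*) (mΩ : ∀ n, MeasurableSpace (Ω n)) (P : ∀ n, Measure (Ω n))
        (η : ∀ n, ℝ → Ω n → LongJumpExclusion.Config n),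
        (∀ n, LongJumpExclusion.IsExclusionProcess α θ γ n (P n) (η n)) →
        limsup
          (fun n : ℕ => LongJumpExclusion.supSqTimeIntegral (P n) (η n) T
            (fun ξ => LongJumpExclusion.quadTerm θ γ n H ξ
              + LongJumpExclusion.meanRate γ
                * LongJumpExclusion.boxSquareSum n ⌊ε * n⌋₊ H ξ))
          atTop
          ≤ ENNReal.ofReal (C * T * ε * LongJumpExclusion.gradSqNorm H)) := by
  have hθγ' : θ < γ := hθγ.trans_le (min_le_left _ _)
  refine ⟨fun hθ' T hT H hH Ω mΩ P η hη => ?_, fun hθ' =>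
    ⟨100 * LongJumpExclusion.meanRate γ ^ 2 + 1, by positivity,
      fun T hT H hH ε hε0 hε Ω mΩ P η hη => ?_⟩⟩
  · rcases le_or_gt γ 1 with h | h
    · exact LongJumpExclusion.tendsto_supSqTimeIntegral_quadTerm_of_le_one hθγ' hγ h hH hT hη
    · exact LongJumpExclusion.tendsto_supSqTimeIntegral_quadTerm_of_one_lt hθ' h hH hT hη
  · subst hθ'
    refine (LongJumpExclusion.limsup_supSqTimeIntegral_quadTerm_add_le (by linarith) hH hT hε0 hε
      hη).trans (ENNReal.ofReal_le_ofReal ?_)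
    -- the summand `1` in the constant only serves to make it positive
    have h : 0 ≤ T * ε * LongJumpExclusion.gradSqNorm H :=
      mul_nonneg (by positivity) (LongJumpExclusion.gradSqNorm_nonneg H)
    linarith
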